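/- Let $c\in\mathbb R$, let $b(x)=0$ for $0<x\le\frac12$ and $b(x)=1$ for $\frac12<x\le1$, and let $\mathcal H=(H_0^1(0,1)\times L^2(0,1))^2$ (complex-valued functions). Let $\mathcal A$ be the unbounded operator on $\mathcal H$ given by $$\mathcal A(u,v,y,z)=\bigl(v,\ (u_x+b\,v_x)_x-c\,z,\ z,\ y_{xx}+c\,v\bigr)$$ with domain $D(\mathcal A)=\{(u,v,y,z)\in\mathcal H:\ v,z\in H_0^1(0,1),\ (u_x+b\,v_x)_x\in L^2(0,1),\ y\in H^2(0,1)\cap H^1_0(0,1)\}$. For $\lambda\in\mathbb C$ put, with principal square roots, $r_1=\lambda\sqrt{1+\frac{ic}{\lambda}}$, $r_2=\lambda\sqrt{1-\frac{ic}{\lambda}}$, $\Delta=\sqrt{1-\frac{4c^2}{\lambda^3}-\frac{4c^2}{\lambda^4}}$, $$s_1=\lambda\sqrt{\frac{1+\frac2\lambda+\Delta}{2(1+\frac1\lambda)}},\qquad s_2=\sqrt\lambda\sqrt{\frac{\lambda+2-\lambda\Delta}{2(1+\frac1\lambda)}},$$ and let $M_1=M_1(\lambda)$ be the characteristic matrix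 $$M_1=\begin{pmatrix} \sinh\frac{r_1}2&\sinh\frac{r_2}2&\sinh\frac{s_1}2&1-e^{-s_2}\\ r_1\cosh\frac{r_1}2&r_2\cosh\frac{r_2}2&-s_1\cosh\frac{s_1}2&-s_2(1+e^{-s_2})\\ r_1^2\sinh\frac{r_1}2&r_2^2\sinh\frac{r_2}2&s_1^2\sinh\frac{s_1}2&s_2^2(1-e^{-s_2})\\ r_1^3\cosh\frac{r_1}2&r_2^3\cosh\frac{r_2}2&-s_1(s_1^2-\lambda(\lambda^2-s_1^2))\cosh\frac{s_1}2&-s_2(s_2^2-\lambda(\lambda^2-s_2^2))(1+e^{-s_2}) \end{pmatrix}.$$ Then there exist $n_0\in\mathbb N$ and two sequences $(\lambda_{1,n})_{|n|\ge n_0}$, $(\lambda_{2,n})_{|n|\ge n_0}$ ($n\in\mathbb Z$) of eigenvalues of $\mathcal A$, each of algebraic multiplicity one, which, if $c\ne0$, are also simple roots of the function $\lambda\mapsto\det M_1(\lambda)$. As $|n|\to\infty$ they satisfy the following. Case 1. If $\sin(\frac c4)\neq0$, then $$\lambda_{1,n}=2n\pi i+i\pi-\frac{2\sin^2(\frac c4)\,(1-i\,\mathrm{sign}(n))}{(3+\cos(\frac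 c2))\sqrt{|n|\pi}}+O\Bigl(\frac1n\Bigr),$$ $$\lambda_{2,n}=2n\pi i+i\theta-\frac{\gamma}{\sqrt{|n|\pi}}+i\,\frac{\mathrm{sign}(n)\,\gamma}{\sqrt{|n|\pi}}+O\Bigl(\frac1n\Bigr),$$ where $\theta=\arccos(\cos^2(\frac c4))$ and $$\gamma=\frac{\cos(\frac c2)\sin(\frac\theta2)+\sin(\frac{3\theta}2)}{4\sqrt{1-\cos^4(\frac c4)}\,\cos(\frac\theta2)}.$$ Case 2. If $\sin(\frac c4)=0$, then $$\lambda_{1,n}=2n\pi i+i\pi+\frac{i\,c^2}{32\pi n}-\frac{(4+i\pi)c^2}{64\pi^2n^2}+O\Bigl(\frac1{|n|^{5/2}}\Bigr),\qquad \lambda_{2,n}=2n\pi i+O\Bigl(\frac1n\Bigr).$$ In particular, in both cases $\Re\lambda_{1,n}\to0$ and $\Re\lambda_{2,n}\to0$ as $|n|\to\infty$. -/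

import Mathlib

open MeasureTheory Set

/-! ### Sobolev spaces on the interval `(0, L)` -/

/-- Lebesgue measure on `(0, L)`. -/
noncomputable abbrev intervalMeasure (L : ℝ) : Measure ℝ := volume.restrict (Ioo 0 L)

/-- The complex Lebesgue space `L²(0, L)`. -/
abbrev L2 (L : ℝ) : Type := Lp ℂ 2 (intervalMeasure L)

/-- Test functions on `(0, L)`: the elements of `C_c^∞(0, L)`. -/
def IsTestFunction (L : ℝ) (φ : ℝ → ℝ) : Prop :=
  ContDiff ℝ (⊤ : ℕ∞) φ ∧ HasCompactSupport φ ∧ tsupport φ ⊆ Ioo 0 L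

/-- `g` is the weak derivative of `f` on `(0, L)`. -/
def HasWeakDeriv {L : ℝ} (f g : L2 L) : Prop :=
  ∀ φ : ℝ → ℝ, IsTestFunction L φ →
    ∫ x, deriv φ x • f x ∂(intervalMeasure L) = -∫ x, φ x • g x ∂(intervalMeasure L)

theorem integrable_smul_L2 {L : ℝ} {φ : ℝ → ℝ} (hφ : Continuous φ) (hc : HasCompactSupport φ)
    (f : L2 L) : Integrable (fun x => φ x • f x) (intervalMeasure L) := by
  obtain ⟨C, hC⟩ := hφ.bounded_above_of_compact_support hc
  have hf : Integrable (fun x => f x) (intervalMeasure L) :=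
    (Lp.memLp f).integrable (by norm_num)
  exact hf.bdd_smul C hφ.aestronglyMeasurable (Filter.Eventually.of_forall hC)

theorem IsTestFunction.deriv_continuous {L : ℝ} {φ : ℝ → ℝ} (h : IsTestFunction L φ) :
    Continuous (deriv φ) :=
  h.1.continuous_deriv (by simp)

theorem HasWeakDeriv.add {L : ℝ} {f g f₁ g₁ : L2 L} (h : HasWeakDeriv f g)
    (h₁ : HasWeakDeriv f₁ g₁) : HasWeakDeriv (f + f₁) (g + g₁) := by
  intro φ hφ
  have e1 : ∫ x, deriv φ x • (f + f₁ : L2 L) x ∂(intervalMeasure L)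
      = ∫ x, (deriv φ x • f x + deriv φ x • f₁ x) ∂(intervalMeasure L) := by
    refine integral_congr_ae ?_
    filter_upwards [Lp.coeFn_add f f₁] with x hx
    rw [hx, Pi.add_apply, smul_add]
  have e2 : ∫ x, φ x • (g + g₁ : L2 L) x ∂(intervalMeasure L)
      = ∫ x, (φ x • g x + φ x • g₁ x) ∂(intervalMeasure L) := by
    refine integral_congr_ae ?_
    filter_upwards [Lp.coeFn_add g g₁] with x hx
    rw [hx, Pi.add_apply, smul_add]
  rw [e1, e2, integral_add (integrable_smul_L2 hφ.deriv_continuous hφ.2.1.deriv _)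
    (integrable_smul_L2 hφ.deriv_continuous hφ.2.1.deriv _),
    integral_add (integrable_smul_L2 hφ.1.continuous hφ.2.1 _)
    (integrable_smul_L2 hφ.1.continuous hφ.2.1 _), h φ hφ, h₁ φ hφ]
  ring

theorem HasWeakDeriv.smul {L : ℝ} {f g : L2 L} (k : ℂ) (h : HasWeakDeriv f g) :
    HasWeakDeriv (k • f) (k • g) := by
  intro φ hφ
  have e1 : ∫ x, deriv φ x • (k • f : L2 L) x ∂(intervalMeasure L)
      = ∫ x, k • (deriv φ x • f x) ∂(intervalMeasure L) := by
    refine integral_congr_ae ?_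
    filter_upwards [Lp.coeFn_smul k f] with x hx
    rw [hx, Pi.smul_apply, smul_comm]
  have e2 : ∫ x, φ x • (k • g : L2 L) x ∂(intervalMeasure L)
      = ∫ x, k • (φ x • g x) ∂(intervalMeasure L) := by
    refine integral_congr_ae ?_
    filter_upwards [Lp.coeFn_smul k g] with x hx
    rw [hx, Pi.smul_apply, smul_comm]
  rw [e1, e2, integral_smul, integral_smul, h φ hφ, smul_neg]

theorem HasWeakDeriv.zero {L : ℝ} : HasWeakDeriv (0 : L2 L) 0 := by
  intro φ _
  have e (ψ : ℝ → ℝ) : ∫ x, ψ x • (0 : L2 L) x ∂(intervalMeasure L) = 0 := by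
    refine (integral_congr_ae ?_).trans (integral_zero ℝ ℂ)
    filter_upwards [Lp.coeFn_zero ℂ 2 (intervalMeasure L)] with x hx
    rw [hx, Pi.zero_apply, smul_zero]
  rw [e, e, neg_zero]

/-- The weak derivative of an `L²` function is unique. -/
theorem HasWeakDeriv.unique {L : ℝ} {f g g₁ : L2 L} (h : HasWeakDeriv f g)
    (h₁ : HasWeakDeriv f g₁) : g = g₁ := by
  have h0 : HasWeakDeriv (0 : L2 L) (g - g₁) := by
    have := h.add (h₁.smul (-1))
    simpa [sub_eq_add_neg] using this
  have hloc : LocallyIntegrableOn (fun x => (g - g₁ : L2 L) x) (Ioo 0 L) volume :=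
    IntegrableOn.locallyIntegrableOn ((Lp.memLp (g - g₁)).integrable (by norm_num))
  have key : ∀ᵐ x, x ∈ Ioo 0 L → (g - g₁ : L2 L) x = 0 := by
    refine isOpen_Ioo.ae_eq_zero_of_integral_contDiff_smul_eq_zero hloc ?_
    intro φ h1 h2 h3
    have e := h0 φ ⟨h1, h2, h3⟩
    have z : ∫ x, deriv φ x • (0 : L2 L) x ∂(intervalMeasure L) = 0 := by
      refine (integral_congr_ae ?_).trans (integral_zero ℝ ℂ)
      filter_upwards [Lp.coeFn_zero ℂ 2 (intervalMeasure L)] with x hx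
      rw [hx, Pi.zero_apply, smul_zero]
    rw [z, eq_comm, neg_eq_zero] at e
    rw [← e]
    refine (setIntegral_eq_integral_of_forall_compl_eq_zero ?_).symm
    intro x hx
    rw [image_eq_zero_of_notMem_tsupport (fun hx' => hx (h3 hx')), zero_smul]
  have : (g - g₁ : L2 L) = 0 := by
    rw [Lp.eq_zero_iff_ae_eq_zero]
    exact (ae_restrict_iff' measurableSet_Ioo).2 key
  exact sub_eq_zero.1 this

/-- `H¹₀(0, L)`: the functions in `L²(0, L)` with a weak derivative in `L²(0, L)` whose continuous
representative on `[0, L]` vanishes at both end points. -/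
noncomputable def H10 (L : ℝ) : Submodule ℂ (L2 L) where
  carrier := {f | (∃ g : L2 L, HasWeakDeriv f g) ∧
    ∃ w : ℝ → ℂ, ContinuousOn w (Icc 0 L) ∧ f =ᵐ[intervalMeasure L] w ∧ w 0 = 0 ∧ w L = 0}
  zero_mem' := ⟨⟨0, HasWeakDeriv.zero⟩, 0, continuousOn_const, Lp.coeFn_zero _ _ _, rfl, rfl⟩
  add_mem' := by
    rintro f f₁ ⟨⟨g, hg⟩, w, hw, he, h0, hL⟩ ⟨⟨g₁, hg₁⟩, w₁, hw₁, he₁, h0₁, hL₁⟩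
    refine ⟨⟨g + g₁, hg.add hg₁⟩, w + w₁, hw.add hw₁, ?_, by simp [h0, h0₁], by simp [hL, hL₁]⟩
    exact (Lp.coeFn_add f f₁).trans (he.add he₁)
  smul_mem' := by
    rintro k f ⟨⟨g, hg⟩, w, hw, he, h0, hL⟩
    refine ⟨⟨k • g, hg.smul k⟩, k • w, hw.const_smul k, ?_, by simp [h0], by simp [hL]⟩
    exact (Lp.coeFn_smul k f).trans (he.const_smul k)

/-! ### The operator -/

/-- The energy space `(H¹₀(0, L) × L²(0, L))²`, with elements `(u, v, y, z)`. Only its vector space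
structure is used. -/
abbrev EnergySpace (L : ℝ) : Type := H10 L × L2 L × H10 L × L2 L

/-- `U = (u, v, y, z)` lies in the domain
`{(u, v, y, z) : u ∈ H¹₀, v, z ∈ H¹₀, y ∈ H² ∩ H¹₀, (a uₓ + b vₓ)ₓ ∈ L²}` and `F` is equal to
`(v, (a uₓ + b vₓ)ₓ - c z, z, yₓₓ + c v)`. -/
def IsGeneratorPair (L a : ℝ) (b c : ℝ → ℝ) (U F : EnergySpace L) : Prop :=
  (U.2.1 ∈ H10 L ∧ U.2.2.2 ∈ H10 L) ∧
  ((F.1 : L2 L) = U.2.1 ∧ (F.2.2.1 : L2 L) = U.2.2.2) ∧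
  (∃ ux vx p q : L2 L, HasWeakDeriv (U.1 : L2 L) ux ∧ HasWeakDeriv U.2.1 vx ∧
    (p =ᵐ[intervalMeasure L] fun x => (a : ℂ) * ux x + (b x : ℂ) * vx x) ∧ HasWeakDeriv p q ∧
    (F.2.1 =ᵐ[intervalMeasure L] fun x => q x - (c x : ℂ) * U.2.2.2 x)) ∧
  (∃ yx r : L2 L, HasWeakDeriv (U.2.2.1 : L2 L) yx ∧ HasWeakDeriv yx r ∧
    (F.2.2.2 =ᵐ[intervalMeasure L] fun x => r x + (c x : ℂ) * U.2.1 x))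

/-- The graph of the operator `𝒜`. -/
noncomputable def generatorGraph (L a : ℝ) (b c : ℝ → ℝ) :
    Submodule ℂ (EnergySpace L × EnergySpace L) where
  carrier := {P | IsGeneratorPair L a b c P.1 P.2}
  zero_mem' := by
    have hz := Lp.coeFn_zero ℂ 2 (intervalMeasure L)
    refine ⟨⟨Submodule.zero_mem _, Submodule.zero_mem _⟩, ⟨rfl, rfl⟩,
      ⟨0, 0, 0, 0, HasWeakDeriv.zero, HasWeakDeriv.zero, ?_, HasWeakDeriv.zero, ?_⟩,
      ⟨0, 0, HasWeakDeriv.zero, HasWeakDeriv.zero, ?_⟩⟩ <;>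
    · filter_upwards [hz] with x hx
      have h0 : (0 : L2 L) x = 0 := hx
      simp only [Prod.snd_zero, Prod.fst_zero, h0, mul_zero, add_zero, sub_zero]
  add_mem' := by
    rintro ⟨U, F⟩ ⟨U₁, F₁⟩ ⟨⟨m1, m2⟩, ⟨e1, e2⟩, ⟨ux, vx, p, q, hu, hv, hp, hq, hF⟩,
      ⟨yx, r, hy, hr, hG⟩⟩ ⟨⟨m1', m2'⟩, ⟨e1', e2'⟩, ⟨ux', vx', p', q', hu', hv', hp', hq', hF'⟩,
      ⟨yx', r', hy', hr', hG'⟩⟩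
    dsimp only at *
    refine ⟨⟨Submodule.add_mem _ m1 m1', Submodule.add_mem _ m2 m2'⟩, ⟨?_, ?_⟩,
      ⟨ux + ux', vx + vx', p + p', q + q', hu.add hu', hv.add hv', ?_, hq.add hq', ?_⟩,
      ⟨yx + yx', r + r', hy.add hy', hr.add hr', ?_⟩⟩
    · simp [e1, e1']
    · simp [e2, e2']
    · filter_upwards [hp, hp', Lp.coeFn_add p p', Lp.coeFn_add ux ux', Lp.coeFn_add vx vx']
        with x h1 h2 h3 h4 h5
      simp only [h3, h4, h5, Pi.add_apply, h1, h2]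
      ring
    · filter_upwards [hF, hF', Lp.coeFn_add F.2.1 F₁.2.1, Lp.coeFn_add q q',
        Lp.coeFn_add U.2.2.2 U₁.2.2.2] with x h1 h2 h3 h4 h5
      simp only [Prod.mk_add_mk, Prod.snd_add, Prod.fst_add, h3, h4, h5, Pi.add_apply, h1, h2]
      ring
    · filter_upwards [hG, hG', Lp.coeFn_add F.2.2.2 F₁.2.2.2, Lp.coeFn_add r r',
        Lp.coeFn_add U.2.1 U₁.2.1] with x h1 h2 h3 h4 h5
      simp only [Prod.mk_add_mk, Prod.snd_add, Prod.fst_add, h3, h4, h5, Pi.add_apply, h1, h2]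
      ring
  smul_mem' := by
    rintro k ⟨U, F⟩ ⟨⟨m1, m2⟩, ⟨e1, e2⟩, ⟨ux, vx, p, q, hu, hv, hp, hq, hF⟩,
      ⟨yx, r, hy, hr, hG⟩⟩
    dsimp only at *
    refine ⟨⟨Submodule.smul_mem _ k m1, Submodule.smul_mem _ k m2⟩, ⟨?_, ?_⟩,
      ⟨k • ux, k • vx, k • p, k • q, hu.smul k, hv.smul k, ?_, hq.smul k, ?_⟩,
      ⟨k • yx, k • r, hy.smul k, hr.smul k, ?_⟩⟩
    · simp [e1]
    · simp [e2]
    · filter_upwards [hp, Lp.coeFn_smul k p, Lp.coeFn_smul k ux, Lp.coeFn_smul k vx]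
        with x h1 h3 h4 h5
      simp only [h3, h4, h5, Pi.smul_apply, h1, smul_eq_mul]
      ring
    · filter_upwards [hF, Lp.coeFn_smul k F.2.1, Lp.coeFn_smul k q, Lp.coeFn_smul k U.2.2.2]
        with x h1 h3 h4 h5
      simp only [Prod.smul_mk, Prod.smul_snd, Prod.smul_fst, h3, h4, h5, Pi.smul_apply, h1,
        smul_eq_mul]
      ring
    · filter_upwards [hG, Lp.coeFn_smul k F.2.2.2, Lp.coeFn_smul k r, Lp.coeFn_smul k U.2.1]
        with x h1 h3 h4 h5
      simp only [Prod.smul_mk, Prod.smul_snd, Prod.smul_fst, h3, h4, h5, Pi.smul_apply, h1,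
        smul_eq_mul]
      ring

theorem IsGeneratorPair.unique {L a : ℝ} {b c : ℝ → ℝ} {U F F₁ : EnergySpace L}
    (h : IsGeneratorPair L a b c U F) (h₁ : IsGeneratorPair L a b c U F₁) : F = F₁ := by
  obtain ⟨-, ⟨e1, e2⟩, ⟨ux, vx, p, q, hu, hv, hp, hq, hF⟩, ⟨yx, r, hy, hr, hG⟩⟩ := h
  obtain ⟨-, ⟨e1', e2'⟩, ⟨ux', vx', p', q', hu', hv', hp', hq', hF'⟩,
    ⟨yx', r', hy', hr', hG'⟩⟩ := h₁
  obtain rfl := hu.unique hu'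
  obtain rfl := hv.unique hv'
  obtain rfl := hy.unique hy'
  obtain rfl := hr.unique hr'
  obtain rfl : p = p' := Lp.ext (hp.trans hp'.symm)
  obtain rfl := hq.unique hq'
  refine Prod.ext (Subtype.ext (e1.trans e1'.symm)) (Prod.ext (Lp.ext (hF.trans hF'.symm))
    (Prod.ext (Subtype.ext (e2.trans e2'.symm)) (Lp.ext (hG.trans hG'.symm))))

/-- The unbounded operator
`𝒜 (u, v, y, z) = (v, (a uₓ + b vₓ)ₓ - c z, z, yₓₓ + c v)` on the energy space. -/
noncomputable def generator (L a : ℝ) (b c : ℝ → ℝ) : EnergySpace L →ₗ.[ℂ] EnergySpace L :=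
  (generatorGraph L a b c).toLinearPMap

/-- The operator is single valued: its graph is the set of all pairs `(U, 𝒜 U)` above. -/
theorem mem_graph_generator {L a : ℝ} {b c : ℝ → ℝ} {U F : EnergySpace L} :
    (U, F) ∈ (generator L a b c).graph ↔ IsGeneratorPair L a b c U F := by
  have h : (generator L a b c).graph = generatorGraph L a b c := by
    refine Submodule.toLinearPMap_graph_eq _ ?_
    rintro ⟨U, F⟩ hx (h0 : U = 0)
    subst h0
    exact IsGeneratorPair.unique hx (generatorGraph L a b c).zero_mem
  rw [h]
  rfl

/-- `μ` is an eigenvalue of `A` of algebraic multiplicity one: `ker (A - μ)` and `ker (A - μ)²`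
are both the line spanned by one eigenvector (hence so is `ker (A - μ)ᵏ` for every `k ≥ 1`). -/
def IsSimpleEigenvalue {E : Type*} [AddCommGroup E] [Module ℂ E] (A : E →ₗ.[ℂ] E) (μ : ℂ) :
    Prop :=
  ∃ U : A.domain, (U : E) ≠ 0 ∧ A U = μ • (U : E) ∧
    ∀ V W : A.domain, A V - μ • (V : E) = W → A W - μ • (W : E) = 0 → ∃ k : ℂ, (V : E) = k • (U : E)

/-- The local damping coefficient: `1` on `(1/2, 1]` and `0` elsewhere. -/
noncomputable def localDamping : ℝ → ℝ := indicator (Ioc (1 / 2) 1) 1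

/-- `𝒜` for `L = 1`, `a = 1`, the local damping and the constant global coupling `c`. -/
noncomputable def localGenerator (c : ℝ) : EnergySpace 1 →ₗ.[ℂ] EnergySpace 1 :=
  generator 1 1 localDamping fun _ => c

/-! ### The characteristic determinant -/

/-- The square root with nonnegative real part (principal branch). -/
noncomputable def csqrt (z : ℂ) : ℂ := z ^ (1 / 2 : ℂ)

noncomputable def charR₁ (c : ℝ) (z : ℂ) : ℂ := z * csqrt (1 + Complex.I * c / z)

noncomputable def charR₂ (c : ℝ) (z : ℂ) : ℂ := z * csqrt (1 - Complex.I * c / z)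

/-- The inner root `√(1 - 4c²/z³ - 4c²/z⁴)`. -/
noncomputable def charDelta (c : ℝ) (z : ℂ) : ℂ :=
  csqrt (1 - 4 * c ^ 2 / z ^ 3 - 4 * c ^ 2 / z ^ 4)

noncomputable def charS₁ (c : ℝ) (z : ℂ) : ℂ :=
  z * csqrt ((1 + 2 / z + charDelta c z) / (2 * (1 + 1 / z)))

noncomputable def charS₂ (c : ℝ) (z : ℂ) : ℂ :=
  csqrt z * csqrt ((z + 2 - z * charDelta c z) / (2 * (1 + 1 / z)))

open Complex in
/-- The characteristic matrix with entries in `r₁, r₂, s₁, s₂` and `z`. -/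
noncomputable def charMatrix (r₁ r₂ s₁ s₂ z : ℂ) : Matrix (Fin 4) (Fin 4) ℂ :=
  !![sinh (r₁ / 2), sinh (r₂ / 2), sinh (s₁ / 2), 1 - exp (-s₂);
     r₁ * cosh (r₁ / 2), r₂ * cosh (r₂ / 2), -s₁ * cosh (s₁ / 2), -s₂ * (1 + exp (-s₂));
     r₁ ^ 2 * sinh (r₁ / 2), r₂ ^ 2 * sinh (r₂ / 2), s₁ ^ 2 * sinh (s₁ / 2),
       s₂ ^ 2 * (1 - exp (-s₂));
     r₁ ^ 3 * cosh (r₁ / 2), r₂ ^ 3 * cosh (r₂ / 2),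
       -s₁ * (s₁ ^ 2 - z * (z ^ 2 - s₁ ^ 2)) * cosh (s₁ / 2),
       -s₂ * (s₂ ^ 2 - z * (z ^ 2 - s₂ ^ 2)) * (1 + exp (-s₂))]

/-- The determinant `det M₁` as a function of the spectral parameter `z`. -/
noncomputable def charDet (c : ℝ) (z : ℂ) : ℂ :=
  (charMatrix (charR₁ c z) (charR₂ c z) (charS₁ c z) (charS₂ c z) z).det

/-! ### Constants in the asymptotic expansions -/

/-- The angle `arccos (cos² (c/4))`. -/
noncomputable def branchAngle (c : ℝ) : ℝ := Real.arccos (Real.cos (c / 4) ^ 2)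

noncomputable def branchGamma (c : ℝ) : ℝ :=
  (Real.cos (c / 2) * Real.sin (branchAngle c / 2) + Real.sin (3 * branchAngle c / 2)) /
    (4 * √(1 - Real.cos (c / 4) ^ 4) * Real.cos (branchAngle c / 2))

/-! ### Weak derivatives and absolutely continuous representatives -/

/-! Reduction to a determinant. For an eigenvector one has v = λu and z = λy, and what remains is a
linear system with constant coefficients on each side of x = 1/2. On the undamped side u - iy and u
+ iy decouple, with exponents r₁ and r₂. On the damped side the solutions vanishing at x = 1 are
spanned by an oscillating mode (exponent s₁) and a boundary layer (exponent s₂). At x = 1/2 the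
functions u, y, y_x and the flux u_x + b v_x are continuous. Eliminating the left coefficients
leaves a 2 × 2 system for the right ones, whose determinant is `detFun` up to a factor i. The
structure `ModeData` records the algebraic relations this uses, and `CharGood` the conditions under
which the closed formulas satisfy them and are analytic. The value c = 0 is included.

Multiplicity. If (𝒜 - λ)V = W with W an eigenvector, the equations for V are the λ-derivatives of
those for W. Subtracting from V the λ-derivative of the explicit modes of W leaves a solution of the
homogeneous system, so the interface conditions become Mβ' + M'β = 0, where M is the interface
matrix and Mβ = 0. Multiplication by the adjugate of M gives (det M)' β = 0. A simple zero of the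
determinant therefore admits no Jordan chain, and there M has rank one
(`ModeData.isSimpleEigenvalue`). The identity `charDet_eq` relates `detFun` to det M₁ by factors
that do not vanish when c ≠ 0, so that simple zeros correspond.

Asymptotics. In a vertical strip with |Im z| → ∞ the boundary layer gives tanh(s₂/2) → 1, and
everything expands in powers of z^(-1/2). The normalized determinant satisfies detNorm = limitDet +
z^(-1/2) limitLayer + O(1/z) (`stripApprox_detNorm`), and Cauchy's estimate lets this be
differentiated (`deriv_detNorm_sub`). The leading term cosh(3z/2) - cos(c/2) cosh(z/2) vanishes at
iπ and at iθ and is multiplied by (-1)^n under translation by 2πin. Actual zeros are found by a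
quantitative Newton argument (`exists_zero_near`, `exists_branch`): it suffices to know the
determinant at an approximate zero and its derivative nearby.

If sin(c/4) ≠ 0 both zeros of the leading term are simple, and one Newton step with the layer term
gives the corrections of order |n|^(-1/2) (`exists_branch_of_simple`). If sin(c/4) = 0 then θ = 0 is
a double zero. The derivative near 2πin then comes from the layer term and has size |n|^(-1/2),
while the determinant at 2πin is O(|n|^(-3/2)), so the error is still O(1/n)
(`exists_branch_of_double`). In that case the layer term also vanishes at iπ, and a finer expansion
is needed: `piPoint` is chosen so that the contributions of c and -c to the determinant cancel up to
O(|n|^(-5/2)) (`detNorm_piPoint`). -/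

theorem integrable_coe_L2 {L : ℝ} (f : L2 L) : Integrable (fun x => f x) (intervalMeasure L) :=
  (Lp.memLp f).integrable (by norm_num)

theorem integrable_test_smul {L : ℝ} {φ : ℝ → ℝ} (hφ : Continuous φ) (hc : HasCompactSupport φ)
    {h : ℝ → ℂ} (hh : Integrable h (intervalMeasure L)) :
    Integrable (fun x => φ x • h x) (intervalMeasure L) := by
  obtain ⟨C, hC⟩ := hφ.bounded_above_of_compact_support hc
  exact hh.bdd_smul C hφ.aestronglyMeasurable (Filter.Eventually.of_forall hC)

theorem IsTestFunction.eq_zero_of_notMem {L : ℝ} {φ : ℝ → ℝ} (h : IsTestFunction L φ) {x : ℝ}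
    (hx : x ∉ Ioo 0 L) : φ x = 0 :=
  image_eq_zero_of_notMem_tsupport fun hx' => hx (h.2.2 hx')

theorem IsTestFunction.hasDerivAt {L : ℝ} {φ : ℝ → ℝ} (h : IsTestFunction L φ) (x : ℝ) :
    HasDerivAt φ (deriv φ x) x :=
  (h.1.differentiable (by simp)).differentiableAt.hasDerivAt

/-- A function orthogonal to the derivatives of all test functions is constant. -/
theorem ae_eq_const_of_integral_deriv_smul_eq_zero {L : ℝ} {h : ℝ → ℂ} (hL : 0 < L)
    (hh : Integrable h (intervalMeasure L))
    (H : ∀ φ : ℝ → ℝ, IsTestFunction L φ → ∫ x, deriv φ x • h x ∂(intervalMeasure L) = 0) :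
    ∃ C : ℂ, h =ᵐ[intervalMeasure L] fun _ => C := by
  have hx0 : L / 2 ∈ Ioo 0 L := ⟨by linarith, by linarith⟩
  -- A normalized bump ρ of mean one is used to correct the mean of other test functions; the
  -- constant is then the average of h against ρ.
  obtain ⟨ρ₀, hρs, hρc, hρd, hρr, hρ1⟩ :=
    exists_contDiff_tsupport_subset (n := ⊤) (isOpen_Ioo.mem_nhds hx0)
  have hρ0 : ∀ x, 0 ≤ ρ₀ x := fun x => (hρr ⟨x, rfl⟩).1
  have hpos : 0 < ∫ x, ρ₀ x := by
    refine hρd.continuous.integral_pos_of_hasCompactSupport_nonneg_nonzero hρc hρ0 (x := L / 2) ?_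
    rw [hρ1]; exact one_ne_zero
  set ρ : ℝ → ℝ := fun x => (∫ x, ρ₀ x)⁻¹ * ρ₀ x with hρ
  have tρ : IsTestFunction L ρ := by
    refine ⟨contDiff_const.mul hρd, hρc.mul_left, ?_⟩
    exact (tsupport_mul_subset_right).trans hρs
  have iρ : ∫ x, ρ x = 1 := by
    rw [hρ, integral_const_mul, inv_mul_cancel₀ hpos.ne']
  refine ⟨∫ x, ρ x • h x ∂(intervalMeasure L), ?_⟩
  set C := ∫ x, ρ x • h x ∂(intervalMeasure L) with hC
  have hloc : LocallyIntegrableOn (fun x => h x - C) (Ioo 0 L) volume :=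
    IntegrableOn.locallyIntegrableOn (hh.sub (integrable_const C))
  have key : ∀ᵐ x, x ∈ Ioo 0 L → h x - C = 0 := by
    refine isOpen_Ioo.ae_eq_zero_of_integral_contDiff_smul_eq_zero hloc ?_
    intro ψ h1 h2 h3
    have tψ : IsTestFunction L ψ := ⟨h1, h2, h3⟩
    -- The function η = ψ - mρ has mean zero, which is what makes its primitive compactly supported
    -- and hence a test function.
    set m := ∫ x, ψ x with hm
    set η : ℝ → ℝ := fun x => ψ x - m * ρ x with hη
    have cη : Continuous η := h1.continuous.sub (continuous_const.mul tρ.1.continuous)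
    have dη : ContDiff ℝ (⊤ : ℕ∞) η := h1.sub (contDiff_const.mul tρ.1)
    have z : ∀ x, x ∉ Ioo 0 L → η x = 0 := fun x hx => by
      simp [hη, tψ.eq_zero_of_notMem hx, tρ.eq_zero_of_notMem hx]
    have kη : HasCompactSupport η := h2.sub (tρ.2.1.mul_left)
    have sη : tsupport η ⊆ Ioo 0 L := by
      refine (tsupport_sub ψ (fun x => m * ρ x)).trans (union_subset h3 ?_)
      exact tsupport_mul_subset_right.trans tρ.2.2
    have Iη : ∫ x, η x = 0 := by
      rw [hη, integral_sub (h1.continuous.integrable_of_hasCompactSupport h2)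
        ((tρ.1.continuous.integrable_of_hasCompactSupport tρ.2.1).const_mul m),
        integral_const_mul, iρ]
      simp [hm]
    set φ : ℝ → ℝ := fun x => ∫ t in (0:ℝ)..x, η t with hφ
    have dφ : ∀ x, HasDerivAt φ (η x) x := fun x =>
      intervalIntegral.integral_hasDerivAt_right (cη.intervalIntegrable _ _)
        (cη.stronglyMeasurableAtFilter _ _) cη.continuousAt
    have dφ' : deriv φ = η := funext fun x => (dφ x).deriv
    -- the support of `η` lies in a compact interval
    have hcomp : IsCompact (tsupport η) := kη
    have hcases : ∃ p q, 0 < p ∧ q < L ∧ tsupport η ⊆ Icc p q := by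
      rcases (tsupport η).eq_empty_or_nonempty with he | hne
      -- When η vanishes identically any p > 0 and q < L serve; the interval from p to q may be
      -- empty.
      · exact ⟨1, L - 1, one_pos, by linarith, by simp [he]⟩
      · obtain ⟨p, hp, hp'⟩ := hcomp.exists_isLeast hne
        obtain ⟨q, hq, hq'⟩ := hcomp.exists_isGreatest hne
        exact ⟨p, q, (sη hp).1, (sη hq).2, fun x hx => ⟨hp' hx, hq' hx⟩⟩
    obtain ⟨p, q, hp, hq, hpq⟩ := hcases
    have zη : ∀ x, x ∉ Icc p q → η x = 0 := fun x hx =>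
      image_eq_zero_of_notMem_tsupport fun h => hx (hpq h)
    have zφ : ∀ x, x ∉ Icc p q → φ x = 0 := by
      intro x hx
      rcases lt_or_ge x p with h | h
      · refine (intervalIntegral.integral_congr (g := fun _ => (0 : ℝ)) fun t ht => ?_).trans
          (by simp)
        refine zη t fun ht' => ?_
        have : t ≤ max 0 x := ht.2
        have := ht'.1
        have : max 0 x < p := max_lt hp h
        linarith
      · have hxq : q < x := by
          by_contra hh'; exact hx ⟨h, not_lt.1 hh'⟩
        have : φ x = ∫ t, η t := by
          refine intervalIntegral.integral_eq_integral_of_support_subset ?_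
          intro t ht
          have : t ∈ Icc p q := by by_contra h'; exact ht (zη t h')
          exact ⟨hp.trans_le this.1, this.2.trans hxq.le⟩
        rw [this, Iη]
    have sφ : tsupport φ ⊆ Icc p q := by
      refine closure_minimal (fun x hx => ?_) isClosed_Icc
      by_contra h'; exact hx (zφ x h')
    have tφ : IsTestFunction L φ := by
      refine ⟨?_, ?_, sφ.trans fun x hx => ⟨hp.trans_le hx.1, hx.2.trans_lt hq⟩⟩
      · rw [contDiff_infty_iff_deriv]
        exact ⟨fun x => (dφ x).differentiableAt, by rw [dφ']; exact dη⟩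
      · exact isCompact_Icc.of_isClosed_subset (isClosed_tsupport _) sφ
    have e := H φ tφ
    rw [dφ'] at e
    have e1 : ∫ x, η x • h x ∂(intervalMeasure L)
        = ∫ x, ψ x • h x ∂(intervalMeasure L) - m • C := by
      have i2 : Integrable (fun x => m • ρ x • h x) (intervalMeasure L) :=
        (integrable_test_smul tρ.1.continuous tρ.2.1 hh).smul m
      rw [hC, ← integral_smul, ← integral_sub (integrable_test_smul h1.continuous h2 hh) i2]
      refine integral_congr_ae (Filter.Eventually.of_forall fun x => ?_)
      simp only [hη, sub_smul, mul_smul]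
    have e2 : ∫ x, ψ x • (h x - C) = ∫ x, ψ x • (h x - C) ∂(intervalMeasure L) := by
      refine (setIntegral_eq_integral_of_forall_compl_eq_zero ?_).symm
      intro x hx
      rw [tψ.eq_zero_of_notMem hx, zero_smul]
    have e3 : ∫ x, ψ x • C ∂(intervalMeasure L) = m • C := by
      rw [setIntegral_eq_integral_of_forall_compl_eq_zero (f := fun x => ψ x • C)
        (fun x hx => by rw [tψ.eq_zero_of_notMem hx, zero_smul]), integral_smul_const]
    rw [e2]
    simp only [smul_sub]
    rw [integral_sub (integrable_test_smul h1.continuous h2 hh)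
      (integrable_test_smul h1.continuous h2 (integrable_const C)), e3, ← e1, e]
  have : ∀ᵐ x ∂(intervalMeasure L), h x - C = 0 := (ae_restrict_iff' measurableSet_Ioo).2 key
  filter_upwards [this] with x hx using sub_eq_zero.1 hx

/-- Integration by parts for the primitive of an integrable function. -/
theorem integral_deriv_smul_primitive {L : ℝ} {g : ℝ → ℂ} (hg : Integrable g (intervalMeasure L))
    {φ : ℝ → ℝ} (hφ : IsTestFunction L φ) :
    ∫ x, deriv φ x • (∫ t in (0:ℝ)..x, g t) ∂(intervalMeasure L)
      = -∫ x, φ x • g x ∂(intervalMeasure L) := by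
  have hint : Integrable (deriv φ) (intervalMeasure L) :=
    (hφ.deriv_continuous.integrable_of_hasCompactSupport hφ.2.1.deriv).restrict
  have hprod : Integrable (fun p : ℝ × ℝ => deriv φ p.1 • g p.2)
      ((intervalMeasure L).prod (intervalMeasure L)) := hint.smul_prod hg
  have hset : MeasurableSet {p : ℝ × ℝ | p.2 < p.1} :=
    measurableSet_lt measurable_snd measurable_fst
  -- Both sides are iterated integrals of φ'(x) g(t) over the triangle t < x. Integrating first in x
  -- gives -φ(t) g(t), because φ vanishes at L.
  have hswap := integral_integral_swap (μ := intervalMeasure L) (ν := intervalMeasure L)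
    (f := fun x t => {p : ℝ × ℝ | p.2 < p.1}.indicator (fun p => deriv φ p.1 • g p.2) (x, t))
    (hprod.indicator hset)
  have e1 : ∀ x ∈ Ioo 0 L, ∫ t, {p : ℝ × ℝ | p.2 < p.1}.indicator
      (fun p => deriv φ p.1 • g p.2) (x, t) ∂(intervalMeasure L)
      = deriv φ x • (∫ t in (0:ℝ)..x, g t) := by
    intro x hx
    have : (fun t => {p : ℝ × ℝ | p.2 < p.1}.indicator (fun p => deriv φ p.1 • g p.2) (x, t))
        = (Iio x).indicator fun t => deriv φ x • g t := by
      funext t; by_cases h : t < x <;> simp [indicator, h]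
    rw [this, integral_indicator measurableSet_Iio, integral_smul,
      Measure.restrict_restrict measurableSet_Iio,
      intervalIntegral.integral_of_le hx.1.le, integral_Ioc_eq_integral_Ioo]
    congr 3
    ext t; simp only [mem_inter_iff, mem_Iio, mem_Ioo]
    exact ⟨fun h => ⟨h.2.1, h.1⟩, fun h => ⟨h.2, h.1, h.2.trans hx.2⟩⟩
  have e2 : ∀ t ∈ Ioo 0 L, ∫ x, {p : ℝ × ℝ | p.2 < p.1}.indicator
      (fun p => deriv φ p.1 • g p.2) (x, t) ∂(intervalMeasure L) = -(φ t • g t) := by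
    intro t ht
    have : (fun x => {p : ℝ × ℝ | p.2 < p.1}.indicator (fun p => deriv φ p.1 • g p.2) (x, t))
        = (Ioi t).indicator fun x => deriv φ x • g t := by
      funext x; by_cases h : t < x <;> simp [indicator, h]
    rw [this, integral_indicator measurableSet_Ioi, integral_smul_const,
      Measure.restrict_restrict measurableSet_Ioi]
    have h2 : Ioi t ∩ Ioo 0 L = Ioo t L := by
      ext x; simp only [mem_inter_iff, mem_Ioi, mem_Ioo]
      exact ⟨fun h => ⟨h.1, h.2.2⟩, fun h => ⟨h.1, ht.1.trans h.1, h.2⟩⟩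
    rw [h2, ← integral_Ioc_eq_integral_Ioo, ← intervalIntegral.integral_of_le ht.2.le,
      intervalIntegral.integral_eq_sub_of_hasDerivAt (fun x _ => hφ.hasDerivAt x)
        (hφ.deriv_continuous.intervalIntegrable _ _),
      hφ.eq_zero_of_notMem (x := L) (fun h => lt_irrefl _ h.2), zero_sub, neg_smul]
  rw [← setIntegral_congr_fun measurableSet_Ioo e1, hswap,
    setIntegral_congr_fun measurableSet_Ioo e2, integral_neg]

/-- The difference of f and a primitive of g has zero weak derivative, hence is constant. -/
theorem HasWeakDeriv.ae_eq_primitive {L : ℝ} (hL : 0 < L) {f g : L2 L} (h : HasWeakDeriv f g) :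
    ∃ C : ℂ, f =ᵐ[intervalMeasure L] fun x => C + ∫ t in (0:ℝ)..x, g t := by
  have hg := integrable_coe_L2 g
  have hcont : ContinuousOn (fun x => ∫ t in (0:ℝ)..x, g t) (Icc 0 L) :=
    intervalIntegral.continuousOn_primitive_interval
      (by rw [uIcc_of_le hL.le]; exact (integrableOn_Icc_iff_integrableOn_Ioo).2 hg)
      |>.mono (by rw [uIcc_of_le hL.le])
  have hG : Integrable (fun x => ∫ t in (0:ℝ)..x, g t) (intervalMeasure L) :=
    (hcont.integrableOn_Icc).mono_set Ioo_subset_Icc_self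
  obtain ⟨C, hC⟩ := ae_eq_const_of_integral_deriv_smul_eq_zero hL
    ((integrable_coe_L2 f).sub hG) (fun φ hφ => by
      have : ∫ x, deriv φ x • ((fun x => f x) - fun x => ∫ t in (0:ℝ)..x, g t) x
          ∂(intervalMeasure L) = ∫ x, (deriv φ x • f x -
            deriv φ x • ∫ t in (0:ℝ)..x, g t) ∂(intervalMeasure L) := by
        simp only [Pi.sub_apply, smul_sub]
      rw [this, integral_sub
        (integrable_test_smul hφ.deriv_continuous hφ.2.1.deriv (integrable_coe_L2 f))
        (integrable_test_smul hφ.deriv_continuous hφ.2.1.deriv hG), h φ hφ,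
        integral_deriv_smul_primitive hg hφ, sub_self])
  refine ⟨C, ?_⟩
  filter_upwards [hC] with x hx
  rw [← hx]; simp

/-- Two functions continuous on `[0, L]` that agree almost everywhere agree everywhere. -/
theorem eqOn_Icc_of_ae_eq {L : ℝ} (hL : 0 < L) {v w : ℝ → ℂ} (hv : ContinuousOn v (Icc 0 L))
    (hw : ContinuousOn w (Icc 0 L)) (h : v =ᵐ[intervalMeasure L] w) : EqOn v w (Icc 0 L) := by
  have h' : v =ᵐ[volume.restrict (Icc 0 L)] w := by
    rwa [Measure.restrict_congr_set Ioo_ae_eq_Icc.symm]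
  exact Measure.eqOn_Icc_of_ae_eq volume hL.ne h' hv hw

/-- The continuous representative of a weakly differentiable function is a primitive of the weak
derivative. -/
theorem HasWeakDeriv.exists_rep {L : ℝ} (hL : 0 < L) {f g : L2 L} (h : HasWeakDeriv f g) :
    ∃ w : ℝ → ℂ, ContinuousOn w (Icc 0 L) ∧ f =ᵐ[intervalMeasure L] w ∧
      ∀ (p q : ℝ) (γ : ℝ → ℂ), Ioo p q ⊆ Ioo 0 L → ContinuousOn γ (Ioo p q) →
        (∀ᵐ x ∂(volume.restrict (Ioo p q)), g x = γ x) →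
        ∀ x ∈ Ioo p q, HasDerivAt w (γ x) x := by
  obtain ⟨C, hC⟩ := h.ae_eq_primitive hL
  have hg := integrable_coe_L2 g
  have hgI : IntegrableOn (fun x => g x) (Icc 0 L) :=
    (integrableOn_Icc_iff_integrableOn_Ioo).2 hg
  have hcont : ContinuousOn (fun x => ∫ t in (0:ℝ)..x, g t) (Icc 0 L) :=
    intervalIntegral.continuousOn_primitive_interval (by rwa [uIcc_of_le hL.le])
      |>.mono (by rw [uIcc_of_le hL.le])
  refine ⟨_, continuousOn_const.add hcont, hC, ?_⟩
  intro p q γ hsub hγ hae x hx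
  refine HasDerivAt.const_add C ?_
  -- Differentiability at x is local, so the interval is shrunk to a compact one on which γ is
  -- integrable; nothing is assumed about γ at the end points p and q.
  obtain ⟨p', hp1, hp2⟩ := exists_between hx.1
  obtain ⟨q', hq1, hq2⟩ := exists_between hx.2
  have hs' : Icc p' q' ⊆ Ioo p q := fun y hy => ⟨hp1.trans_le hy.1, hy.2.trans_lt hq2⟩
  have hp'0 : p' ∈ Ioo 0 L := hsub (hs' ⟨le_rfl, (hp2.trans hq1).le⟩)
  have hxin : x ∈ Ioo p' q' := ⟨hp2, hq1⟩
  have hint : ∀ y ∈ Icc 0 L, IntervalIntegrable (fun x => g x) volume 0 y := fun y hy =>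
    (intervalIntegrable_iff_integrableOn_Icc_of_le hy.1).2
      (hgI.mono_set (Icc_subset_Icc_right hy.2))
  have hloc : ∀ y ∈ Ioo p' q', (∫ t in (0:ℝ)..y, g t) =
      (∫ t in (0:ℝ)..p', g t) + ∫ t in p'..y, γ t := by
    intro y hy
    have hyL : y ∈ Ioo 0 L := hsub (hs' (Ioo_subset_Icc_self hy))
    have e : ∫ t in p'..y, g t = ∫ t in p'..y, γ t := by
      refine intervalIntegral.integral_congr_ae ?_
      have h1 := (ae_restrict_iff' measurableSet_Ioo).1 hae
      filter_upwards [h1] with t ht ht'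
      rw [uIoc_of_le hy.1.le] at ht'
      exact ht (hs' ⟨ht'.1.le, ht'.2.trans hy.2.le⟩)
    rw [← e, ← intervalIntegral.integral_add_adjacent_intervals (b := p')
      (hint p' (Ioo_subset_Icc_self hp'0)) ?_]
    exact (hint p' (Ioo_subset_Icc_self hp'0)).symm.trans (hint y (Ioo_subset_Icc_self hyL))
  have hγ' : ContinuousOn γ (Icc p' q') := hγ.mono hs'
  have hd : HasDerivAt (fun y => (∫ t in (0:ℝ)..p', g t) + ∫ t in p'..y, γ t) (γ x) x := by
    refine HasDerivAt.const_add _ ?_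
    refine intervalIntegral.integral_hasDerivAt_right ?_ ?_ ?_
    · exact (hγ'.mono (Icc_subset_Icc_right hxin.2.le)).intervalIntegrable_of_Icc hxin.1.le
    · exact (hγ'.mono Ioo_subset_Icc_self).stronglyMeasurableAtFilter isOpen_Ioo x hxin
    · exact hγ'.continuousAt (Icc_mem_nhds hxin.1 hxin.2)
  refine hd.congr_of_eventuallyEq ?_
  filter_upwards [isOpen_Ioo.mem_nhds hxin] with y hy using hloc y hy

/-! ### Gluing functions at the interface -/

/-- The function equal to `f` on the left and to `g` on the right of the interface `1/2`. -/
noncomputable def glue (f g : ℝ → ℂ) : ℝ → ℂ := fun x => if x ≤ 1 / 2 then f x else g x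

theorem memLp_glue {f g : ℝ → ℂ} (hf : Continuous f) (hg : Continuous g) :
    MemLp (glue f g) 2 (intervalMeasure 1) := by
  obtain ⟨A, hA⟩ := isCompact_Icc.exists_bound_of_continuousOn (s := Icc (0:ℝ) 1) hf.continuousOn
  obtain ⟨B, hB⟩ := isCompact_Icc.exists_bound_of_continuousOn (s := Icc (0:ℝ) 1) hg.continuousOn
  refine MemLp.of_bound ?_ (max A B) ?_
  · exact (Measurable.ite (measurableSet_le measurable_id measurable_const) hf.measurable
      hg.measurable).aestronglyMeasurable
  · refine (ae_restrict_iff' measurableSet_Ioo).2 (Filter.Eventually.of_forall fun x hx => ?_)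
    unfold glue
    split_ifs
    · exact (hA x (Ioo_subset_Icc_self hx)).trans (le_max_left _ _)
    · exact (hB x (Ioo_subset_Icc_self hx)).trans (le_max_right _ _)

/-- The glued function as an element of `L²(0, 1)`. -/
noncomputable def glueL2 {f g : ℝ → ℂ} (hf : Continuous f) (hg : Continuous g) : L2 1 :=
  (memLp_glue hf hg).toLp _

theorem coeFn_glueL2 {f g : ℝ → ℂ} (hf : Continuous f) (hg : Continuous g) :
    glueL2 hf hg =ᵐ[intervalMeasure 1] glue f g := MemLp.coeFn_toLp _

/-- Integration by parts on each half: the boundary terms at 0 and 1 vanish with φ, and those at 1/2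
cancel because the two pieces agree there. -/
theorem hasWeakDeriv_glueL2 {f g f' g' : ℝ → ℂ} (hf : Continuous f) (hg : Continuous g)
    (hf' : Continuous f') (hg' : Continuous g') (df : ∀ x, HasDerivAt f (f' x) x)
    (dg : ∀ x, HasDerivAt g (g' x) x) (hfg : f (1 / 2) = g (1 / 2)) :
    HasWeakDeriv (glueL2 hf hg) (glueL2 hf' hg') := by
  intro φ hφ
  have split : ∀ {p q : ℝ → ℂ} (hp : Continuous p) (hq : Continuous q) {ψ : ℝ → ℝ},
      Continuous ψ → ∫ x, ψ x • glueL2 hp hq x ∂(intervalMeasure 1)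
        = (∫ x in (0:ℝ)..(1/2), ψ x • p x) + ∫ x in (1/2:ℝ)..1, ψ x • q x := by
    intro p q hp hq ψ hψ
    have e1 : ∫ x, ψ x • glueL2 hp hq x ∂(intervalMeasure 1)
        = ∫ x in (0:ℝ)..1, ψ x • glue p q x := by
      rw [intervalIntegral.integral_of_le zero_le_one, integral_Ioc_eq_integral_Ioo]
      refine integral_congr_ae ?_
      filter_upwards [coeFn_glueL2 hp hq] with x hx
      rw [hx]
    have c1 : ∀ x ∈ uIcc (0:ℝ) (1/2), ψ x • glue p q x = ψ x • p x := by
      intro x hx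
      rw [uIcc_of_le (by norm_num)] at hx
      simp only [glue, if_pos hx.2]
    have c2 : ∀ x ∈ uIoc (1/2:ℝ) 1, ψ x • glue p q x = ψ x • q x := by
      intro x hx
      rw [uIoc_of_le (by norm_num)] at hx
      simp only [glue, if_neg (not_le.2 hx.1)]
    have i1 : IntervalIntegrable (fun x => ψ x • glue p q x) volume 0 (1/2) :=
      ((hψ.smul hp).intervalIntegrable 0 (1/2)).congr
        (fun x hx => (c1 x (uIoc_subset_uIcc hx)).symm)
    have i2 : IntervalIntegrable (fun x => ψ x • glue p q x) volume (1/2) 1 :=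
      ((hψ.smul hq).intervalIntegrable (1/2) 1).congr (fun x hx => (c2 x hx).symm)
    rw [e1, ← intervalIntegral.integral_add_adjacent_intervals i1 i2,
      intervalIntegral.integral_congr c1, intervalIntegral.integral_congr_ae
        (Filter.Eventually.of_forall fun x hx => c2 x hx)]
  have cφ := hφ.1.continuous
  have cφ' := hφ.deriv_continuous
  rw [split hf hg cφ', split hf' hg' cφ]
  have parts : ∀ {p p' : ℝ → ℂ}, Continuous p → Continuous p' → (∀ x, HasDerivAt p (p' x) x) →
      ∀ a b : ℝ, (∫ x in a..b, deriv φ x • p x) + ∫ x in a..b, φ x • p' x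
        = φ b • p b - φ a • p a := by
    intro p p' hp hp' dp a b
    have i1 : IntervalIntegrable (fun x => deriv φ x • p x) volume a b :=
      (cφ'.smul hp).intervalIntegrable _ _
    have i2 : IntervalIntegrable (fun x => φ x • p' x) volume a b :=
      (cφ.smul hp').intervalIntegrable _ _
    rw [← intervalIntegral.integral_add i1 i2]
    refine intervalIntegral.integral_eq_sub_of_hasDerivAt (f := fun x => φ x • p x) (fun x _ => ?_) (i1.add i2)
    have := (hφ.hasDerivAt x).smul (dp x)
    rwa [add_comm] at this
  have p1 := parts hf hf' df 0 (1/2)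
  have p2 := parts hg hg' dg (1/2) 1
  rw [hφ.eq_zero_of_notMem (x := 0) (fun h => lt_irrefl _ h.1)] at p1
  rw [hφ.eq_zero_of_notMem (x := 1) (fun h => lt_irrefl _ h.2)] at p2
  rw [zero_smul] at p1 p2
  rw [hfg] at p1
  linear_combination p1 + p2

theorem glueL2_mem_H10 {f g f' g' : ℝ → ℂ} (hf : Continuous f) (hg : Continuous g)
    (hf' : Continuous f') (hg' : Continuous g') (df : ∀ x, HasDerivAt f (f' x) x)
    (dg : ∀ x, HasDerivAt g (g' x) x) (hfg : f (1 / 2) = g (1 / 2)) (h0 : f 0 = 0) (h1 : g 1 = 0) :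
    glueL2 hf hg ∈ H10 1 := by
  refine ⟨⟨_, hasWeakDeriv_glueL2 hf hg hf' hg' df dg hfg⟩, glue f g, ?_, coeFn_glueL2 hf hg, ?_, ?_⟩
  · exact (Continuous.if_le hf hg continuous_id continuous_const
      (fun x hx => by rw [show x = 1 / 2 from hx, hfg])).continuousOn
  · simp [glue, h0]
  · norm_num [glue, h1]

/-! ### Second order equations with constant coefficients -/

theorem eq_of_hasDerivAt_zero_Ioo {K : ℝ → ℂ} {p q : ℝ} (hK : ContinuousOn K (Icc p q))
    (hd : ∀ x ∈ Ioo p q, HasDerivAt K 0 x) {x y : ℝ} (hx : x ∈ Icc p q) (hy : y ∈ Icc p q) :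
    K x = K y := by
  have aux : ∀ x ∈ Icc p q, ∀ y ∈ Icc p q, x ≤ y → K y - K x = 0 := by
    intro x hx y hy hxy
    rw [← intervalIntegral.integral_eq_sub_of_hasDerivAt_of_le (f' := fun _ => 0) hxy
      (hK.mono (Icc_subset_Icc hx.1 hy.2))
      (fun t ht => hd t ⟨hx.1.trans_lt ht.1, ht.2.trans_le hy.2⟩) (by simp)]
    simp
  rcases le_total x y with h | h
  · exact (sub_eq_zero.1 (aux x hx y hy h)).symm
  · exact sub_eq_zero.1 (aux y hy x hx h)

theorem hasDerivAt_ofReal_affine (r : ℂ) (x₀ x : ℝ) :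
    HasDerivAt (fun x : ℝ => r * ((x : ℂ) - x₀)) r x := by
  simpa using ((Complex.ofRealCLM.hasDerivAt (x := x)).sub_const (x₀ : ℂ)).const_mul r

theorem hasDerivAt_sinh_affine (r : ℂ) (x₀ x : ℝ) :
    HasDerivAt (fun x : ℝ => Complex.sinh (r * ((x : ℂ) - x₀)))
      (r * Complex.cosh (r * ((x : ℂ) - x₀))) x := by
  exact ((Complex.hasDerivAt_sinh _).comp x (hasDerivAt_ofReal_affine r x₀ x)).congr_deriv
    (mul_comm _ _)

theorem hasDerivAt_cosh_affine (r : ℂ) (x₀ x : ℝ) :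
    HasDerivAt (fun x : ℝ => Complex.cosh (r * ((x : ℂ) - x₀)))
      (r * Complex.sinh (r * ((x : ℂ) - x₀))) x := by
  exact ((Complex.hasDerivAt_cosh _).comp x (hasDerivAt_ofReal_affine r x₀ x)).congr_deriv
    (mul_comm _ _)

/-- Solutions of `w'' = r² w` on `[p, q]` vanishing at `x₀` are multiples of `sinh (r (x - x₀))`. -/
theorem exists_eq_sinh_of_ode {r : ℂ} (hr : r ≠ 0) {w D : ℝ → ℂ} {p q x₀ : ℝ}
    (hw : ContinuousOn w (Icc p q)) (hD : ContinuousOn D (Icc p q))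
    (dw : ∀ x ∈ Ioo p q, HasDerivAt w (D x) x)
    (dD : ∀ x ∈ Ioo p q, HasDerivAt D (r ^ 2 * w x) x) (hx₀ : x₀ ∈ Icc p q) (h0 : w x₀ = 0) :
    ∃ α : ℂ, ∀ x ∈ Icc p q, w x = α * Complex.sinh (r * ((x : ℂ) - x₀)) ∧
      D x = α * (r * Complex.cosh (r * ((x : ℂ) - x₀))) := by
  have cs : Continuous fun x : ℝ => Complex.sinh (r * ((x : ℂ) - x₀)) := by fun_prop
  have cc : Continuous fun x : ℝ => Complex.cosh (r * ((x : ℂ) - x₀)) := by fun_prop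
  refine ⟨D x₀ / r, fun x hx => ?_⟩
  -- The Wronskians of w with cosh and with sinh are constant. They form a linear system for w and D
  -- whose determinant is controlled by cosh² - sinh² = 1.
  have k1 := eq_of_hasDerivAt_zero_Ioo (K := fun x => D x * Complex.cosh (r * ((x : ℂ) - x₀))
      - r * w x * Complex.sinh (r * ((x : ℂ) - x₀)))
    ((hD.mul cc.continuousOn).sub ((continuousOn_const.mul hw).mul cs.continuousOn))
    (fun x hx => by
      refine (((dD x hx).mul (hasDerivAt_cosh_affine r x₀ x)).sub
        (((dw x hx).const_mul r).mul (hasDerivAt_sinh_affine r x₀ x))).congr_deriv ?_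
      ring) hx hx₀
  have k2 := eq_of_hasDerivAt_zero_Ioo (K := fun x => D x * Complex.sinh (r * ((x : ℂ) - x₀))
      - r * w x * Complex.cosh (r * ((x : ℂ) - x₀)))
    ((hD.mul cs.continuousOn).sub ((continuousOn_const.mul hw).mul cc.continuousOn))
    (fun x hx => by
      refine (((dD x hx).mul (hasDerivAt_sinh_affine r x₀ x)).sub
        (((dw x hx).const_mul r).mul (hasDerivAt_cosh_affine r x₀ x))).congr_deriv ?_
      ring) hx hx₀
  simp only [sub_self, mul_zero, Complex.sinh_zero, Complex.cosh_zero, h0, mul_one, sub_zero] at k1 k2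
  have id := Complex.cosh_sq_sub_sinh_sq (r * ((x : ℂ) - x₀))
  constructor
  · field_simp
    linear_combination Complex.sinh (r * ((x : ℂ) - x₀)) * k1
      - Complex.cosh (r * ((x : ℂ) - x₀)) * k2 - r * w x * id
  · field_simp
    linear_combination Complex.cosh (r * ((x : ℂ) - x₀)) * k1
      - Complex.sinh (r * ((x : ℂ) - x₀)) * k2 - D x * id

/-! ### The classical form of the spectral equation -/

theorem localDamping_left {x : ℝ} (hx : x ≤ 1 / 2) : localDamping x = 0 := by
  simp only [localDamping]
  exact indicator_of_notMem (fun h => absurd h.1 (not_lt.2 hx)) _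

theorem localDamping_right {x : ℝ} (hx : 1 / 2 < x) (hx' : x ≤ 1) : localDamping x = 1 := by
  simp only [localDamping]
  rw [indicator_of_mem (show x ∈ Ioc (1/2 : ℝ) 1 from ⟨hx, hx'⟩)]; rfl

theorem ae_restrict_Ioo_of_subset {p q : ℝ} (h : Ioo p q ⊆ Ioo 0 1) {P : ℝ → Prop}
    (hP : ∀ᵐ x ∂(intervalMeasure 1), P x) : ∀ᵐ x ∂(volume.restrict (Ioo p q)), x ∈ Ioo p q ∧ P x :=
  (ae_restrict_mem measurableSet_Ioo).and (ae_mono (Measure.restrict_mono h le_rfl) hP)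

/-- A pair `(V, W)` with `𝒜 V = μ V + W` and `W` in the form of a solution consists of classical
solutions of the differential equations on either side of the interface. -/
theorem IsGeneratorPair.exists_classical {c : ℝ} {μ : ℂ} (hμ : 1 + μ ≠ 0) {V W : EnergySpace 1}
    (hV : IsGeneratorPair 1 1 localDamping (fun _ => c) V (μ • V + W)) {f h Df : ℝ → ℂ} {fx : L2 1}
    (hf : ContinuousOn f (Icc 0 1)) (hh : ContinuousOn h (Icc 0 1))
    (ef : (W.1 : L2 1) =ᵐ[intervalMeasure 1] f) (eh : (W.2.2.1 : L2 1) =ᵐ[intervalMeasure 1] h)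
    (hW1 : W.2.1 = μ • (W.1 : L2 1)) (hW2 : W.2.2.2 = μ • (W.2.2.1 : L2 1))
    (hfx : HasWeakDeriv (W.1 : L2 1) fx)
    (eDf : ∀ᵐ x ∂(volume.restrict (Ioo (1 / 2) 1)), fx x = Df x)
    (hDf : ContinuousOn Df (Ioo (1 / 2) 1)) :
    ∃ u P y Y : ℝ → ℂ, (ContinuousOn u (Icc 0 1) ∧ ContinuousOn P (Icc 0 1) ∧
        ContinuousOn y (Icc 0 1) ∧ ContinuousOn Y (Icc 0 1)) ∧
      ((V.1 : L2 1) =ᵐ[intervalMeasure 1] u ∧ (V.2.2.1 : L2 1) =ᵐ[intervalMeasure 1] y ∧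
        V.2.1 = μ • (V.1 : L2 1) + W.1 ∧ V.2.2.2 = μ • (V.2.2.1 : L2 1) + W.2.2.1) ∧
      (u 0 = 0 ∧ u 1 = 0 ∧ y 0 = 0 ∧ y 1 = 0) ∧
      (∀ x ∈ Ioo 0 (1 / 2), HasDerivAt u (P x) x) ∧
      (∀ x ∈ Ioo (1 / 2) 1, HasDerivAt u ((P x - Df x) / (1 + μ)) x) ∧
      (∀ x ∈ Ioo 0 1, HasDerivAt P (μ ^ 2 * u x + c * μ * y x + (2 * μ * f x + c * h x)) x ∧
        HasDerivAt y (Y x) x ∧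
        HasDerivAt Y (μ ^ 2 * y x - c * μ * u x + (2 * μ * h x - c * f x)) x) ∧
      ∃ ux : L2 1, HasWeakDeriv (V.1 : L2 1) ux ∧
        ∀ᵐ x ∂(volume.restrict (Ioo (1 / 2) 1)), ux x = (P x - Df x) / (1 + μ) := by
  obtain ⟨u₀, v, y₀, z⟩ := V
  obtain ⟨f₀, g, h₀, k⟩ := W
  obtain ⟨-, ⟨e1, e2⟩, ⟨ux, vx, p, q, hu, hv, hp, hq, hF⟩, ⟨yx, r, hy, hr, hG⟩⟩ := hV
  dsimp only [Prod.smul_mk, Prod.mk_add_mk] at *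
  have ev : v = μ • (u₀ : L2 1) + f₀ := by simpa using e1.symm
  have ez : z = μ • (y₀ : L2 1) + h₀ := by simpa using e2.symm
  have hvx : vx = μ • ux + fx := by
    rw [ev] at hv
    exact hv.unique ((hu.smul μ).add hfx)
  obtain ⟨-, wu, cwu, ewu, wu0, wu1⟩ := u₀.2
  obtain ⟨-, wy, cwy, ewy, wy0, wy1⟩ := y₀.2
  obtain ⟨u, cu, eu, du⟩ := hu.exists_rep one_pos
  obtain ⟨P, cP, eP, dP⟩ := hq.exists_rep one_pos
  obtain ⟨y, cy, ey, dy⟩ := hy.exists_rep one_pos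
  obtain ⟨Y, cY, eY, dY⟩ := hr.exists_rep one_pos
  have euw := eqOn_Icc_of_ae_eq one_pos cu cwu (eu.symm.trans ewu)
  have eyw := eqOn_Icc_of_ae_eq one_pos cy cwy (ey.symm.trans ewy)
  have m0 : (0 : ℝ) ∈ Icc (0 : ℝ) 1 := by simp
  have m1 : (1 : ℝ) ∈ Icc (0 : ℝ) 1 := by simp
  have sv := (Lp.coeFn_add (μ • (u₀ : L2 1)) (f₀ : L2 1))
  have sz := (Lp.coeFn_add (μ • (y₀ : L2 1)) (h₀ : L2 1))
  have su := Lp.coeFn_smul μ (u₀ : L2 1)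
  have sy := Lp.coeFn_smul μ (y₀ : L2 1)
  have sf := Lp.coeFn_smul μ (f₀ : L2 1)
  have sh := Lp.coeFn_smul μ (h₀ : L2 1)
  have svF := Lp.coeFn_add (μ • v) g
  have szF := Lp.coeFn_add (μ • z) k
  have svm := Lp.coeFn_smul μ v
  have szm := Lp.coeFn_smul μ z
  have hl : Ioo (0:ℝ) (1/2) ⊆ Ioo 0 1 := Ioo_subset_Ioo_right (by norm_num)
  have hr' : Ioo (1/2:ℝ) 1 ⊆ Ioo 0 1 := Ioo_subset_Ioo_left (by norm_num)
  have svx := Lp.coeFn_add (μ • ux) fx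
  have sux := Lp.coeFn_smul μ ux
  -- On the damped side the flux is u_x + v_x with v_x = μ u_x + f_x, so it equals (1 + μ) u_x +
  -- f_x. Solving for u_x is where 1 + μ ≠ 0 is needed.
  have Eux : ∀ᵐ x ∂(volume.restrict (Ioo (1 / 2) 1)), ux x = (P x - Df x) / (1 + μ) := by
    filter_upwards [ae_restrict_Ioo_of_subset hr' (hp.and (eP.and (svx.and sux))), eDf]
      with x ⟨hx, h1, h2, h3, h4⟩ h5
    rw [hvx, h3, Pi.add_apply, h4, Pi.smul_apply, h5, localDamping_right hx.1 hx.2.le, h2] at h1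
    rw [eq_div_iff hμ, h1]
    simp only [smul_eq_mul]
    push_cast
    ring
  refine ⟨u, P, y, Y, ⟨cu, cP, cy, cY⟩, ⟨eu, ey, ev, ez⟩,
    ⟨(euw m0).trans wu0, (euw m1).trans wu1, (eyw m0).trans wy0, (eyw m1).trans wy1⟩,
    ?_, ?_, ?_, ux, hu, Eux⟩
  · refine du 0 (1/2) P hl (cP.mono (hl.trans Ioo_subset_Icc_self)) ?_
    filter_upwards [ae_restrict_Ioo_of_subset hl (hp.and eP)] with x ⟨hx, h1, h2⟩
    rw [h2, localDamping_left hx.2.le] at h1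
    rw [h1]; push_cast; ring
  · exact du (1/2) 1 _ hr' (((cP.mono (hr'.trans Ioo_subset_Icc_self)).sub hDf).div_const _) Eux
  · intro x hx
    refine ⟨dP 0 1 (fun x => μ ^ 2 * u x + c * μ * y x + (2 * μ * f x + c * h x)) subset_rfl (ContinuousOn.mono ?_ Ioo_subset_Icc_self) ?_ x hx,
      dy 0 1 Y subset_rfl (cY.mono Ioo_subset_Icc_self) eY x hx,
      dY 0 1 (fun x => μ ^ 2 * y x - c * μ * u x + (2 * μ * h x - c * f x)) subset_rfl (ContinuousOn.mono ?_ Ioo_subset_Icc_self) ?_ x hx⟩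
    · exact ((continuousOn_const.mul cu).add (continuousOn_const.mul cy)).add
        ((continuousOn_const.mul hf).add (continuousOn_const.mul hh))
    · filter_upwards [hF, svF, svm, sv, su, sf, sz, sy, eu, ey, ef, eh]
        with x a1 a2 a3 a4 a5 a6 a7 a8 a9 a10 a11 a12
      rw [a2, Pi.add_apply, a3, Pi.smul_apply, ev, ez, a4, a7, hW1, a6] at a1
      simp only [Pi.add_apply, Pi.smul_apply, a5, a8, a9, a10, a11, a12, smul_eq_mul] at a1
      linear_combination -a1
    · exact ((continuousOn_const.mul cy).sub (continuousOn_const.mul cu)).add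
        ((continuousOn_const.mul hh).sub (continuousOn_const.mul hf))
    · filter_upwards [hG, szF, szm, sv, su, sh, sz, sy, eu, ey, ef, eh]
        with x a1 a2 a3 a4 a5 a6 a7 a8 a9 a10 a11 a12
      rw [a2, Pi.add_apply, a3, Pi.smul_apply, ev, ez, a4, a7, hW2, a6] at a1
      simp only [Pi.add_apply, Pi.smul_apply, a5, a8, a9, a10, a11, a12, smul_eq_mul] at a1
      linear_combination -a1

/-! ### Modes on either side of the interface -/

/-- The function `sinh (r (x - x₀))`. -/
noncomputable def modeSinh (r : ℂ) (x₀ : ℝ) : ℝ → ℂ := fun x => Complex.sinh (r * ((x : ℂ) - x₀))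

/-- The function `cosh (r (x - x₀))`. -/
noncomputable def modeCosh (r : ℂ) (x₀ : ℝ) : ℝ → ℂ := fun x => Complex.cosh (r * ((x : ℂ) - x₀))

theorem continuous_modeSinh (r : ℂ) (x₀ : ℝ) : Continuous (modeSinh r x₀) := by
  unfold modeSinh; fun_prop

theorem continuous_modeCosh (r : ℂ) (x₀ : ℝ) : Continuous (modeCosh r x₀) := by
  unfold modeCosh; fun_prop

theorem hasDerivAt_modeSinh (r : ℂ) (x₀ x : ℝ) :
    HasDerivAt (modeSinh r x₀) (r * modeCosh r x₀ x) x := hasDerivAt_sinh_affine r x₀ x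

theorem hasDerivAt_modeCosh (r : ℂ) (x₀ x : ℝ) :
    HasDerivAt (modeCosh r x₀) (r * modeSinh r x₀ x) x := hasDerivAt_cosh_affine r x₀ x

theorem modeSinh_self (r : ℂ) (x₀ : ℝ) : modeSinh r x₀ x₀ = 0 := by simp [modeSinh]

theorem modeSinh_zero_half (r : ℂ) : modeSinh r 0 (1 / 2) = Complex.sinh (r / 2) := by
  simp [modeSinh, div_eq_mul_inv]

theorem modeCosh_zero_half (r : ℂ) : modeCosh r 0 (1 / 2) = Complex.cosh (r / 2) := by
  simp [modeCosh, div_eq_mul_inv]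

theorem modeSinh_one_half (r : ℂ) : modeSinh r 1 (1 / 2) = -Complex.sinh (r / 2) := by
  rw [modeSinh, ← Complex.sinh_neg]; congr 1; push_cast; ring

theorem modeCosh_one_half (r : ℂ) : modeCosh r 1 (1 / 2) = Complex.cosh (r / 2) := by
  rw [modeCosh, ← Complex.cosh_neg]; congr 1; push_cast; ring

/-- The derivative of `sinh (r (x - x₀))` in the parameter `r`. -/
noncomputable def modeVar (r : ℂ) (x₀ : ℝ) : ℝ → ℂ := fun x => ((x : ℂ) - x₀) * modeCosh r x₀ x

/-- The derivative in `x` of `modeVar r x₀`. -/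
noncomputable def modeVarDeriv (r : ℂ) (x₀ : ℝ) : ℝ → ℂ := fun x =>
  modeCosh r x₀ x + r * (((x : ℂ) - x₀) * modeSinh r x₀ x)

theorem continuous_modeVar (r : ℂ) (x₀ : ℝ) : Continuous (modeVar r x₀) := by
  have := continuous_modeCosh r x₀
  unfold modeVar; fun_prop

theorem continuous_modeVarDeriv (r : ℂ) (x₀ : ℝ) : Continuous (modeVarDeriv r x₀) := by
  have := continuous_modeCosh r x₀
  have := continuous_modeSinh r x₀
  unfold modeVarDeriv; fun_prop

theorem hasDerivAt_ofReal_sub (x₀ x : ℝ) : HasDerivAt (fun x : ℝ => (x : ℂ) - x₀) 1 x := by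
  simpa using hasDerivAt_ofReal_affine 1 x₀ x

theorem hasDerivAt_modeVar (r : ℂ) (x₀ x : ℝ) :
    HasDerivAt (modeVar r x₀) (modeVarDeriv r x₀ x) x := by
  refine ((hasDerivAt_ofReal_sub x₀ x).mul (hasDerivAt_modeCosh r x₀ x)).congr_deriv ?_
  simp only [modeVarDeriv]; ring

/-- This is the equation w'' = r² w differentiated in r: the variation of a mode solves the same
equation with source 2r times the mode. -/
theorem hasDerivAt_modeVarDeriv (r : ℂ) (x₀ x : ℝ) :
    HasDerivAt (modeVarDeriv r x₀) (r ^ 2 * modeVar r x₀ x + 2 * r * modeSinh r x₀ x) x := by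
  refine ((hasDerivAt_modeCosh r x₀ x).add (((hasDerivAt_ofReal_sub x₀ x).mul
    (hasDerivAt_modeSinh r x₀ x)).const_mul r)).congr_deriv ?_
  simp only [modeVar]; ring

theorem modeVar_self (r : ℂ) (x₀ : ℝ) : modeVar r x₀ x₀ = 0 := by simp [modeVar]

theorem modeVar_zero_half (r : ℂ) : modeVar r 0 (1 / 2) = Complex.cosh (r / 2) / 2 := by
  rw [modeVar, modeCosh_zero_half]; push_cast; ring

theorem modeVarDeriv_zero_half (r : ℂ) :
    modeVarDeriv r 0 (1 / 2) = Complex.cosh (r / 2) + r * Complex.sinh (r / 2) / 2 := by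
  rw [modeVarDeriv, modeCosh_zero_half, modeSinh_zero_half]; push_cast; ring

theorem modeVar_one_half (r : ℂ) : modeVar r 1 (1 / 2) = -(Complex.cosh (r / 2) / 2) := by
  rw [modeVar, modeCosh_one_half]; push_cast; ring

theorem modeVarDeriv_one_half (r : ℂ) :
    modeVarDeriv r 1 (1 / 2) = Complex.cosh (r / 2) + r * Complex.sinh (r / 2) / 2 := by
  rw [modeVarDeriv, modeCosh_one_half, modeSinh_one_half]; push_cast; ring

theorem exists_eq_mode_of_ode {r : ℂ} (hr : r ≠ 0) {w D : ℝ → ℂ} {p q x₀ : ℝ}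
    (hw : ContinuousOn w (Icc p q)) (hD : ContinuousOn D (Icc p q))
    (dw : ∀ x ∈ Ioo p q, HasDerivAt w (D x) x)
    (dD : ∀ x ∈ Ioo p q, HasDerivAt D (r ^ 2 * w x) x) (hx₀ : x₀ ∈ Icc p q) (h0 : w x₀ = 0) :
    ∃ α : ℂ, ∀ x ∈ Icc p q, w x = α * modeSinh r x₀ x ∧ D x = α * (r * modeCosh r x₀ x) :=
  exists_eq_sinh_of_ode hr hw hD dw dD hx₀ h0

/-! ### The interface determinant -/

/-- The interface coefficient of the oscillating mode on the right against a mode on the left. -/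
noncomputable def oscCoeff (a s σ ω : ℂ) : ℂ :=
  s * (1 + ω) * (Complex.sinh (a / 2) * Complex.cosh (s / 2)) +
    a * (1 + σ) * (Complex.cosh (a / 2) * Complex.sinh (s / 2))

/-- The interface coefficient of the boundary layer mode on the right against a mode on the
left. -/
noncomputable def layerCoeff (z a t σ ω : ℂ) : ℂ :=
  a * (1 - ω) * (Complex.cosh (a / 2) * Complex.sinh (t / 2)) +
    (1 + z) * (1 - σ) * t * (Complex.sinh (a / 2) * Complex.cosh (t / 2))

/-- The primed arguments are the derivatives of the parameters along an arbitrary curve. The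
explicit polynomial form allows a comparison by `ring` with the differentiated interface conditions.
-/
noncomputable def oscCoeffDeriv (a s σ ω a' s' σ' ω' : ℂ) : ℂ :=
  (s' * (1 + ω) + s * ω') * (Complex.sinh (a / 2) * Complex.cosh (s / 2)) +
    s * (1 + ω) * (a' / 2 * Complex.cosh (a / 2) * Complex.cosh (s / 2) +
      Complex.sinh (a / 2) * (s' / 2 * Complex.sinh (s / 2))) +
    ((a' * (1 + σ) + a * σ') * (Complex.cosh (a / 2) * Complex.sinh (s / 2)) +
    a * (1 + σ) * (a' / 2 * Complex.sinh (a / 2) * Complex.sinh (s / 2) +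
      Complex.cosh (a / 2) * (s' / 2 * Complex.cosh (s / 2))))

noncomputable def layerCoeffDeriv (z a t σ ω a' t' σ' ω' : ℂ) : ℂ :=
  (a' * (1 - ω) - a * ω') * (Complex.cosh (a / 2) * Complex.sinh (t / 2)) +
    a * (1 - ω) * (a' / 2 * Complex.sinh (a / 2) * Complex.sinh (t / 2) +
      Complex.cosh (a / 2) * (t' / 2 * Complex.cosh (t / 2))) +
    ((((1 - σ) - (1 + z) * σ') * t + (1 + z) * (1 - σ) * t') *
      (Complex.sinh (a / 2) * Complex.cosh (t / 2)) +
    (1 + z) * (1 - σ) * t * (a' / 2 * Complex.cosh (a / 2) * Complex.cosh (t / 2) +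
      Complex.sinh (a / 2) * (t' / 2 * Complex.sinh (t / 2))))

theorem hasDerivAt_sinh_half {a : ℂ → ℂ} {a' z : ℂ} (ha : HasDerivAt a a' z) :
    HasDerivAt (fun z => Complex.sinh (a z / 2)) (a' / 2 * Complex.cosh (a z / 2)) z :=
  ((Complex.hasDerivAt_sinh _).comp z (ha.div_const 2)).congr_deriv (mul_comm _ _)

theorem hasDerivAt_cosh_half {a : ℂ → ℂ} {a' z : ℂ} (ha : HasDerivAt a a' z) :
    HasDerivAt (fun z => Complex.cosh (a z / 2)) (a' / 2 * Complex.sinh (a z / 2)) z :=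
  ((Complex.hasDerivAt_cosh _).comp z (ha.div_const 2)).congr_deriv (mul_comm _ _)

theorem hasDerivAt_oscCoeff {a s σ ω : ℂ → ℂ} {a' s' σ' ω' z : ℂ} (ha : HasDerivAt a a' z)
    (hs : HasDerivAt s s' z) (hσ : HasDerivAt σ σ' z) (hω : HasDerivAt ω ω' z) :
    HasDerivAt (fun z => oscCoeff (a z) (s z) (σ z) (ω z))
      (oscCoeffDeriv (a z) (s z) (σ z) (ω z) a' s' σ' ω') z := by
  refine (((hs.mul (hω.const_add 1)).mul
    ((hasDerivAt_sinh_half ha).mul (hasDerivAt_cosh_half hs))).add ((ha.mul (hσ.const_add 1)).mul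
    ((hasDerivAt_cosh_half ha).mul (hasDerivAt_sinh_half hs)))).congr_deriv ?_
  simp only [oscCoeffDeriv, Pi.mul_apply]

theorem hasDerivAt_layerCoeff {a t σ ω : ℂ → ℂ} {a' t' σ' ω' z : ℂ} (ha : HasDerivAt a a' z)
    (ht : HasDerivAt t t' z) (hσ : HasDerivAt σ σ' z) (hω : HasDerivAt ω ω' z) :
    HasDerivAt (fun z => layerCoeff z (a z) (t z) (σ z) (ω z))
      (layerCoeffDeriv z (a z) (t z) (σ z) (ω z) a' t' σ' ω') z := by
  refine (((ha.mul (hω.const_sub 1)).mul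
    ((hasDerivAt_cosh_half ha).mul (hasDerivAt_sinh_half ht))).add
    (((((hasDerivAt_id z).const_add 1).mul (hσ.const_sub 1)).mul ht).mul
    ((hasDerivAt_sinh_half ha).mul (hasDerivAt_cosh_half ht)))).congr_deriv ?_
  simp only [layerCoeffDeriv, Pi.mul_apply, id]
  ring

/-- The mode parameters at `μ` and their derivatives with respect to the spectral parameter. -/
structure ModeData (c : ℝ) (μ : ℂ) where
  (a b s t σ ω a' b' s' t' σ' ω' : ℂ)
  ha : a ≠ 0
  hb : b ≠ 0
  hs : s ≠ 0
  ht : t ≠ 0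
  hμ : 1 + μ ≠ 0
  hωσ : 1 + ω * σ ≠ 0
  eω : ω = (1 + μ) * σ
  ea : a ^ 2 = μ ^ 2 + Complex.I * c * μ
  eb : b ^ 2 = μ ^ 2 - Complex.I * c * μ
  -- Each right mode has to satisfy two equations with one exponent. The oscillating mode has u =
  -- -iσy, with `es` from the equation of y and `es₂` from that of u. The layer mode has y = -iωu,
  -- with `et` from the equation of u and `et₂` from that of y.
  es : s ^ 2 = μ ^ 2 + Complex.I * c * μ * σ
  es₂ : (1 + μ) * σ * s ^ 2 = μ ^ 2 * σ + Complex.I * c * μ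
  et : (1 + μ) * t ^ 2 = μ ^ 2 - Complex.I * c * μ * ω
  et₂ : ω * t ^ 2 = ω * μ ^ 2 - Complex.I * c * μ
  eω' : ω' = σ + (1 + μ) * σ'
  ea' : 2 * a * a' = 2 * μ + Complex.I * c
  eb' : 2 * b * b' = 2 * μ - Complex.I * c
  es' : 2 * s * s' = 2 * μ + Complex.I * c * (σ + μ * σ')
  es₂' : σ * s ^ 2 + (1 + μ) * (σ' * s ^ 2 + σ * (2 * s * s')) =
    2 * μ * σ + μ ^ 2 * σ' + Complex.I * c
  et' : t ^ 2 + (1 + μ) * (2 * t * t') = 2 * μ - Complex.I * c * (ω + μ * ω')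
  et₂' : ω' * t ^ 2 + ω * (2 * t * t') = ω' * μ ^ 2 + 2 * μ * ω - Complex.I * c

/-! ### Solutions on the damped side and their variations in the spectral parameter -/

namespace ModeData
variable {c : ℝ} {μ : ℂ} (m : ModeData c μ)

/-- The entries of the interface matrix and their derivatives. -/
noncomputable def oscA : ℂ := oscCoeff m.a m.s m.σ m.ω
noncomputable def oscB : ℂ := oscCoeff m.b m.s (-m.σ) (-m.ω)
noncomputable def layerA : ℂ := layerCoeff μ m.a m.t m.σ m.ω
noncomputable def layerB : ℂ := layerCoeff μ m.b m.t (-m.σ) (-m.ω)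
noncomputable def oscA' : ℂ := oscCoeffDeriv m.a m.s m.σ m.ω m.a' m.s' m.σ' m.ω'
noncomputable def oscB' : ℂ := oscCoeffDeriv m.b m.s (-m.σ) (-m.ω) m.b' m.s' (-m.σ') (-m.ω')
noncomputable def layerA' : ℂ := layerCoeffDeriv μ m.a m.t m.σ m.ω m.a' m.t' m.σ' m.ω'
noncomputable def layerB' : ℂ := layerCoeffDeriv μ m.b m.t (-m.σ) (-m.ω) m.b' m.t' (-m.σ') (-m.ω')

/-- The solution `u` on the right with coefficients `β₁, β₂`, and its first derivative. -/
noncomputable def uR (β₁ β₂ : ℂ) : ℝ → ℂ := fun x =>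
  -Complex.I * m.σ * β₁ * modeSinh m.s 1 x + β₂ * modeSinh m.t 1 x
noncomputable def uRx (β₁ β₂ : ℂ) : ℝ → ℂ := fun x =>
  -Complex.I * m.σ * β₁ * (m.s * modeCosh m.s 1 x) + β₂ * (m.t * modeCosh m.t 1 x)
noncomputable def yR (β₁ β₂ : ℂ) : ℝ → ℂ := fun x =>
  β₁ * modeSinh m.s 1 x + -Complex.I * m.ω * β₂ * modeSinh m.t 1 x
noncomputable def yRx (β₁ β₂ : ℂ) : ℝ → ℂ := fun x =>
  β₁ * (m.s * modeCosh m.s 1 x) + -Complex.I * m.ω * β₂ * (m.t * modeCosh m.t 1 x)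

/-- The derivatives of `uR`, `uRx`, `yR`, `yRx` in the spectral parameter. -/
noncomputable def uRv (β₁ β₂ : ℂ) : ℝ → ℂ := fun x =>
  -Complex.I * β₁ * (m.σ' * modeSinh m.s 1 x + m.σ * (m.s' * modeVar m.s 1 x)) +
    β₂ * (m.t' * modeVar m.t 1 x)
noncomputable def uRvx (β₁ β₂ : ℂ) : ℝ → ℂ := fun x =>
  -Complex.I * β₁ * (m.σ' * (m.s * modeCosh m.s 1 x) + m.σ * (m.s' * modeVarDeriv m.s 1 x)) +
    β₂ * (m.t' * modeVarDeriv m.t 1 x)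
noncomputable def yRv (β₁ β₂ : ℂ) : ℝ → ℂ := fun x =>
  β₁ * (m.s' * modeVar m.s 1 x) +
    -Complex.I * β₂ * (m.ω' * modeSinh m.t 1 x + m.ω * (m.t' * modeVar m.t 1 x))
noncomputable def yRvx (β₁ β₂ : ℂ) : ℝ → ℂ := fun x =>
  β₁ * (m.s' * modeVarDeriv m.s 1 x) +
    -Complex.I * β₂ * (m.ω' * (m.t * modeCosh m.t 1 x) + m.ω * (m.t' * modeVarDeriv m.t 1 x))

theorem continuous_uRv (β₁ β₂ : ℂ) : Continuous (m.uRv β₁ β₂) := by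
  have := continuous_modeVar m.s 1; have := continuous_modeVar m.t 1
  have := continuous_modeSinh m.s 1
  unfold uRv; fun_prop

theorem continuous_yRv (β₁ β₂ : ℂ) : Continuous (m.yRv β₁ β₂) := by
  have := continuous_modeVar m.s 1; have := continuous_modeVar m.t 1
  have := continuous_modeSinh m.t 1
  unfold yRv; fun_prop

theorem continuous_uRx (β₁ β₂ : ℂ) : Continuous (m.uRx β₁ β₂) := by
  have := continuous_modeCosh m.s 1; have := continuous_modeCosh m.t 1
  unfold uRx; fun_prop

theorem continuous_yRx (β₁ β₂ : ℂ) : Continuous (m.yRx β₁ β₂) := by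
  have := continuous_modeCosh m.s 1; have := continuous_modeCosh m.t 1
  unfold yRx; fun_prop

theorem continuous_uR (β₁ β₂ : ℂ) : Continuous (m.uR β₁ β₂) := by
  have := continuous_modeSinh m.s 1; have := continuous_modeSinh m.t 1
  unfold uR; fun_prop

theorem continuous_yR (β₁ β₂ : ℂ) : Continuous (m.yR β₁ β₂) := by
  have := continuous_modeSinh m.s 1; have := continuous_modeSinh m.t 1
  unfold yR; fun_prop

theorem continuous_uRvx (β₁ β₂ : ℂ) : Continuous (m.uRvx β₁ β₂) := by
  have := continuous_modeVarDeriv m.s 1; have := continuous_modeVarDeriv m.t 1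
  have := continuous_modeCosh m.s 1
  unfold uRvx; fun_prop

theorem continuous_yRvx (β₁ β₂ : ℂ) : Continuous (m.yRvx β₁ β₂) := by
  have := continuous_modeVarDeriv m.s 1; have := continuous_modeVarDeriv m.t 1
  have := continuous_modeCosh m.t 1
  unfold yRvx; fun_prop

theorem hasDerivAt_uR (β₁ β₂ : ℂ) (x : ℝ) : HasDerivAt (m.uR β₁ β₂) (m.uRx β₁ β₂ x) x :=
  ((hasDerivAt_modeSinh m.s 1 x).const_mul _).add ((hasDerivAt_modeSinh m.t 1 x).const_mul _)

theorem hasDerivAt_yR (β₁ β₂ : ℂ) (x : ℝ) : HasDerivAt (m.yR β₁ β₂) (m.yRx β₁ β₂ x) x :=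
  ((hasDerivAt_modeSinh m.s 1 x).const_mul _).add ((hasDerivAt_modeSinh m.t 1 x).const_mul _)

theorem hasDerivAt_uRx (β₁ β₂ : ℂ) (x : ℝ) : HasDerivAt (fun x => (1 + μ) * m.uRx β₁ β₂ x)
    (μ ^ 2 * m.uR β₁ β₂ x + c * μ * m.yR β₁ β₂ x) x := by
  refine (((((hasDerivAt_modeCosh m.s 1 x).const_mul m.s).const_mul _).add
    (((hasDerivAt_modeCosh m.t 1 x).const_mul m.t).const_mul _)).const_mul (1 + μ)).congr_deriv ?_
  simp only [uR, yR]
  linear_combination (-Complex.I * β₁ * modeSinh m.s 1 x) * m.es₂ + β₂ * modeSinh m.t 1 x * m.et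
    - c * μ * β₁ * modeSinh m.s 1 x * Complex.I_sq

theorem hasDerivAt_yRx (β₁ β₂ : ℂ) (x : ℝ) : HasDerivAt (m.yRx β₁ β₂)
    (μ ^ 2 * m.yR β₁ β₂ x - c * μ * m.uR β₁ β₂ x) x := by
  refine ((((hasDerivAt_modeCosh m.s 1 x).const_mul m.s).const_mul _).add
    (((hasDerivAt_modeCosh m.t 1 x).const_mul m.t).const_mul _)).congr_deriv ?_
  simp only [uR, yR]
  linear_combination β₁ * modeSinh m.s 1 x * m.es
    + (-Complex.I * β₂ * modeSinh m.t 1 x) * m.et₂ + c * μ * β₂ * modeSinh m.t 1 x * Complex.I_sq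

theorem hasDerivAt_uRv (β₁ β₂ : ℂ) (x : ℝ) : HasDerivAt (m.uRv β₁ β₂) (m.uRvx β₁ β₂ x) x :=
  ((((hasDerivAt_modeSinh m.s 1 x).const_mul _).add
    (((hasDerivAt_modeVar m.s 1 x).const_mul _).const_mul _)).const_mul _).add
    (((hasDerivAt_modeVar m.t 1 x).const_mul _).const_mul _)

theorem hasDerivAt_yRv (β₁ β₂ : ℂ) (x : ℝ) : HasDerivAt (m.yRv β₁ β₂) (m.yRvx β₁ β₂ x) x :=
  (((hasDerivAt_modeVar m.s 1 x).const_mul _).const_mul _).add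
    ((((hasDerivAt_modeSinh m.t 1 x).const_mul _).add
    (((hasDerivAt_modeVar m.t 1 x).const_mul _).const_mul _)).const_mul _)

theorem hasDerivAt_uRvx (β₁ β₂ : ℂ) (x : ℝ) :
    HasDerivAt (fun x => m.uRx β₁ β₂ x + (1 + μ) * m.uRvx β₁ β₂ x)
      (μ ^ 2 * m.uRv β₁ β₂ x + c * μ * m.yRv β₁ β₂ x +
        (2 * μ * m.uR β₁ β₂ x + c * m.yR β₁ β₂ x)) x := by
  refine (((((hasDerivAt_modeCosh m.s 1 x).const_mul m.s).const_mul _).add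
    (((hasDerivAt_modeCosh m.t 1 x).const_mul m.t).const_mul _)).add
    (((((((hasDerivAt_modeCosh m.s 1 x).const_mul m.s).const_mul _).add
    (((hasDerivAt_modeVarDeriv m.s 1 x).const_mul _).const_mul _)).const_mul _).add
    (((hasDerivAt_modeVarDeriv m.t 1 x).const_mul _).const_mul _)).const_mul (1 + μ))).congr_deriv ?_
  simp only [uR, yR, uRv, yRv]
  linear_combination (-Complex.I * β₁ * modeSinh m.s 1 x) * m.es₂'
    + (-Complex.I * β₁ * m.s' * modeVar m.s 1 x) * m.es₂
    + β₂ * modeSinh m.t 1 x * m.et' + β₂ * m.t' * modeVar m.t 1 x * m.et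
    - c * β₁ * (modeSinh m.s 1 x + μ * m.s' * modeVar m.s 1 x) * Complex.I_sq

theorem hasDerivAt_yRvx (β₁ β₂ : ℂ) (x : ℝ) :
    HasDerivAt (m.yRvx β₁ β₂)
      (μ ^ 2 * m.yRv β₁ β₂ x - c * μ * m.uRv β₁ β₂ x +
        (2 * μ * m.yR β₁ β₂ x - c * m.uR β₁ β₂ x)) x := by
  refine ((((hasDerivAt_modeVarDeriv m.s 1 x).const_mul _).const_mul _).add
    (((((hasDerivAt_modeCosh m.t 1 x).const_mul m.t).const_mul _).add
    (((hasDerivAt_modeVarDeriv m.t 1 x).const_mul _).const_mul _)).const_mul _)).congr_deriv ?_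
  simp only [uR, yR, uRv, yRv]
  linear_combination β₁ * modeSinh m.s 1 x * m.es' + β₁ * m.s' * modeVar m.s 1 x * m.es
    + (-Complex.I * β₂ * modeSinh m.t 1 x) * m.et₂'
    + (-Complex.I * β₂ * m.t' * modeVar m.t 1 x) * m.et₂
    + c * β₂ * (modeSinh m.t 1 x + μ * m.t' * modeVar m.t 1 x) * Complex.I_sq

/-- Solutions of the homogeneous system on the right are combinations of the two modes. -/
theorem exists_right_form {u P y Y : ℝ → ℂ} (cu : ContinuousOn u (Icc (1 / 2) 1))
    (cP : ContinuousOn P (Icc (1 / 2) 1)) (cy : ContinuousOn y (Icc (1 / 2) 1))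
    (cY : ContinuousOn Y (Icc (1 / 2) 1))
    (du : ∀ x ∈ Ioo (1 / 2 : ℝ) 1, HasDerivAt u (P x / (1 + μ)) x)
    (dP : ∀ x ∈ Ioo (1 / 2 : ℝ) 1, HasDerivAt P (μ ^ 2 * u x + c * μ * y x) x)
    (dy : ∀ x ∈ Ioo (1 / 2 : ℝ) 1, HasDerivAt y (Y x) x)
    (dY : ∀ x ∈ Ioo (1 / 2 : ℝ) 1, HasDerivAt Y (μ ^ 2 * y x - c * μ * u x) x)
    (hu : u 1 = 0) (hy : y 1 = 0) :
    ∃ β₁ β₂ : ℂ, ∀ x ∈ Icc (1 / 2 : ℝ) 1, u x = m.uR β₁ β₂ x ∧ P x = (1 + μ) * m.uRx β₁ β₂ x ∧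
      y x = m.yR β₁ β₂ x ∧ Y x = m.yRx β₁ β₂ x := by
  have hμ := m.hμ
  have hωσ := m.hωσ
  have one_mem : (1 : ℝ) ∈ Icc (1 / 2 : ℝ) 1 := ⟨by norm_num, le_rfl⟩
  -- The combination y + iωu annihilates the layer mode, and u + iσy below annihilates the
  -- oscillating one, so each of them solves a scalar second order equation.
  obtain ⟨γ₁, h1⟩ := exists_eq_mode_of_ode m.hs (w := fun x => y x + Complex.I * m.ω * u x)
    (D := fun x => Y x + Complex.I * m.ω * (P x / (1 + μ)))
    (cy.add (continuousOn_const.mul cu)) (cY.add (continuousOn_const.mul (cP.div_const _)))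
    (fun x hx => (dy x hx).add ((du x hx).const_mul _))
    (fun x hx => by
      refine ((dY x hx).add (((dP x hx).div_const _).const_mul _)).congr_deriv ?_
      rw [m.eω]
      field_simp
      linear_combination -y x * m.es - Complex.I * u x * m.es₂ - c * μ * u x * Complex.I_sq)
    one_mem (by simp [hu, hy])
  obtain ⟨γ₂, h2⟩ := exists_eq_mode_of_ode m.ht (w := fun x => u x + Complex.I * m.σ * y x)
    (D := fun x => P x / (1 + μ) + Complex.I * m.σ * Y x)
    (cu.add (continuousOn_const.mul cy)) ((cP.div_const _).add (continuousOn_const.mul cY))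
    (fun x hx => (du x hx).add ((dy x hx).const_mul _))
    (fun x hx => by
      refine (((dP x hx).div_const _).add ((dY x hx).const_mul _)).congr_deriv ?_
      have e1 := m.et
      have e2 := m.et₂
      rw [m.eω] at e1 e2
      field_simp
      linear_combination -u x * e1 - Complex.I * y x * e2 + c * μ * y x * Complex.I_sq)
    one_mem (by simp [hu, hy])
  -- On its own mode each combination acts as multiplication by 1 + ωσ; as this is nonzero, the two
  -- scalar solutions determine u and y.
  obtain ⟨β₁, rfl⟩ : ∃ β, γ₁ = (1 + m.ω * m.σ) * β := ⟨_, (mul_div_cancel₀ γ₁ hωσ).symm⟩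
  obtain ⟨β₂, rfl⟩ : ∃ β, γ₂ = (1 + m.ω * m.σ) * β := ⟨_, (mul_div_cancel₀ γ₂ hωσ).symm⟩
  refine ⟨β₁, β₂, fun x hx => ?_⟩
  obtain ⟨a1, b1⟩ := h1 x hx
  obtain ⟨a2, b2⟩ := h2 x hx
  simp only [uR, uRx, yR, yRx]
  refine ⟨mul_left_cancel₀ hωσ ?_, ?_, mul_left_cancel₀ hωσ ?_, mul_left_cancel₀ hωσ ?_⟩
  · linear_combination a2 - Complex.I * m.σ * a1 + (m.ω * m.σ * u x) * Complex.I_sq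
  · rw [mul_comm, ← div_eq_iff hμ]
    refine mul_left_cancel₀ hωσ ?_
    linear_combination b2 - Complex.I * m.σ * b1 + (m.ω * m.σ * (P x / (1 + μ))) * Complex.I_sq
  · linear_combination a1 - Complex.I * m.ω * a2 + (m.ω * m.σ * y x) * Complex.I_sq
  · linear_combination b1 - Complex.I * m.ω * b2 + (m.ω * m.σ * Y x) * Complex.I_sq

end ModeData

/-! ### Transmission at the interface and construction of eigenvectors -/

namespace ModeData
variable {c : ℝ} {μ : ℂ} (m : ModeData c μ)

/-- The transmission conditions at `1/2` between the left modes with coefficients `α₁, α₂` and the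
right modes with coefficients `β₁, β₂`. -/
def Transmission (α₁ α₂ β₁ β₂ : ℂ) : Prop :=
  (α₁ * Complex.sinh (m.a / 2) = m.uR β₁ β₂ (1 / 2) - Complex.I * m.yR β₁ β₂ (1 / 2) ∧
    α₁ * (m.a * Complex.cosh (m.a / 2)) =
      (1 + μ) * m.uRx β₁ β₂ (1 / 2) - Complex.I * m.yRx β₁ β₂ (1 / 2)) ∧
  (α₂ * Complex.sinh (m.b / 2) = m.uR β₁ β₂ (1 / 2) + Complex.I * m.yR β₁ β₂ (1 / 2) ∧
    α₂ * (m.b * Complex.cosh (m.b / 2)) =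
      (1 + μ) * m.uRx β₁ β₂ (1 / 2) + Complex.I * m.yRx β₁ β₂ (1 / 2))

/-- The two transmission conditions for u - iy prescribe multiples, with one common factor α₁, of
sinh(a/2) and a cosh(a/2). Cross-multiplication eliminates α₁ and leaves one row of the 2 × 2
interface system; u + iy gives the other row. -/
theorem cross_a (β₁ β₂ : ℂ) :
    m.a * Complex.cosh (m.a / 2) * (m.uR β₁ β₂ (1 / 2) - Complex.I * m.yR β₁ β₂ (1 / 2)) -
      Complex.sinh (m.a / 2) * ((1 + μ) * m.uRx β₁ β₂ (1 / 2) - Complex.I * m.yRx β₁ β₂ (1 / 2))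
      = Complex.I * m.oscA * β₁ - m.layerA * β₂ := by
  simp only [uR, uRx, yR, yRx, modeSinh_one_half, modeCosh_one_half, oscA, layerA, oscCoeff,
    layerCoeff, m.eω]
  linear_combination (m.a * Complex.cosh (m.a / 2) * (-(1 + μ) * m.σ * β₂ * Complex.sinh (m.t / 2))
    - Complex.sinh (m.a / 2) * ((1 + μ) * m.σ * β₂ * (m.t * Complex.cosh (m.t / 2)))) * Complex.I_sq

theorem cross_b (β₁ β₂ : ℂ) :
    m.b * Complex.cosh (m.b / 2) * (m.uR β₁ β₂ (1 / 2) + Complex.I * m.yR β₁ β₂ (1 / 2)) -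
      Complex.sinh (m.b / 2) * ((1 + μ) * m.uRx β₁ β₂ (1 / 2) + Complex.I * m.yRx β₁ β₂ (1 / 2))
      = -(Complex.I * m.oscB * β₁) - m.layerB * β₂ := by
  simp only [uR, uRx, yR, yRx, modeSinh_one_half, modeCosh_one_half, oscB, layerB, oscCoeff,
    layerCoeff, m.eω]
  linear_combination (m.b * Complex.cosh (m.b / 2) * ((1 + μ) * m.σ * β₂ * Complex.sinh (m.t / 2))
    + Complex.sinh (m.b / 2) * ((1 + μ) * m.σ * β₂ * (m.t * Complex.cosh (m.t / 2)))) * Complex.I_sq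

theorem Transmission.kernel {m : ModeData c μ} {α₁ α₂ β₁ β₂ : ℂ}
    (h : m.Transmission α₁ α₂ β₁ β₂) :
    Complex.I * m.oscA * β₁ - m.layerA * β₂ = 0 ∧ Complex.I * m.oscB * β₁ + m.layerB * β₂ = 0 := by
  obtain ⟨⟨h1, h2⟩, h3, h4⟩ := h
  constructor
  · rw [← m.cross_a, ← h1, ← h2]; ring
  · have := m.cross_b β₁ β₂
    rw [← h3, ← h4] at this
    rw [show ∀ x y z : ℂ, x * (y * z) - z * (y * x) = 0 from fun _ _ _ => by ring] at this
    linear_combination this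

/-- Since sinh and cosh have no common zero, the vector (sinh(r/2), r cosh(r/2)) is nonzero, and a
vanishing cross product with it means proportionality. This recovers the left coefficient that was
eliminated. -/
theorem _root_.exists_coeff_of_cross_eq {r X Y : ℂ} (hr : r ≠ 0)
    (h : r * Complex.cosh (r / 2) * X - Complex.sinh (r / 2) * Y = 0) :
    ∃ α : ℂ, α * Complex.sinh (r / 2) = X ∧ α * (r * Complex.cosh (r / 2)) = Y := by
  by_cases hs : Complex.sinh (r / 2) = 0
  · have hc : Complex.cosh (r / 2) ≠ 0 := by
      intro hc
      have := Complex.cosh_sq_sub_sinh_sq (r / 2)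
      simp [hs, hc] at this
    refine ⟨Y / (r * Complex.cosh (r / 2)), ?_, by field_simp⟩
    rw [hs, zero_mul, sub_zero] at h
    rw [hs, mul_zero]
    rcases mul_eq_zero.1 h with h | h
    · exact absurd h (mul_ne_zero hr hc)
    · exact h.symm
  · refine ⟨X / Complex.sinh (r / 2), by field_simp, ?_⟩
    field_simp
    linear_combination h

theorem exists_transmission {β₁ β₂ : ℂ} (h1 : Complex.I * m.oscA * β₁ - m.layerA * β₂ = 0)
    (h2 : Complex.I * m.oscB * β₁ + m.layerB * β₂ = 0) :
    ∃ α₁ α₂, m.Transmission α₁ α₂ β₁ β₂ := by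
  obtain ⟨α₁, h3⟩ := exists_coeff_of_cross_eq m.ha ((m.cross_a β₁ β₂).trans h1)
  obtain ⟨α₂, h4⟩ := exists_coeff_of_cross_eq m.hb
    ((m.cross_b β₁ β₂).trans (by linear_combination -h2))
  exact ⟨α₁, α₂, h3, h4⟩

/-- The solution on the left. -/
noncomputable def uL (α₁ α₂ : ℂ) : ℝ → ℂ := fun x =>
  (α₁ * modeSinh m.a 0 x + α₂ * modeSinh m.b 0 x) / 2
noncomputable def uLx (α₁ α₂ : ℂ) : ℝ → ℂ := fun x =>
  (α₁ * (m.a * modeCosh m.a 0 x) + α₂ * (m.b * modeCosh m.b 0 x)) / 2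
noncomputable def yL (α₁ α₂ : ℂ) : ℝ → ℂ := fun x =>
  Complex.I * (α₁ * modeSinh m.a 0 x - α₂ * modeSinh m.b 0 x) / 2
noncomputable def yLx (α₁ α₂ : ℂ) : ℝ → ℂ := fun x =>
  Complex.I * (α₁ * (m.a * modeCosh m.a 0 x) - α₂ * (m.b * modeCosh m.b 0 x)) / 2

theorem continuous_uL (α₁ α₂ : ℂ) : Continuous (m.uL α₁ α₂) := by
  have := continuous_modeSinh m.a 0; have := continuous_modeSinh m.b 0
  unfold uL; fun_prop

theorem continuous_yL (α₁ α₂ : ℂ) : Continuous (m.yL α₁ α₂) := by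
  have := continuous_modeSinh m.a 0; have := continuous_modeSinh m.b 0
  unfold yL; fun_prop

theorem continuous_uLx (α₁ α₂ : ℂ) : Continuous (m.uLx α₁ α₂) := by
  have := continuous_modeCosh m.a 0; have := continuous_modeCosh m.b 0
  unfold uLx; fun_prop

theorem continuous_yLx (α₁ α₂ : ℂ) : Continuous (m.yLx α₁ α₂) := by
  have := continuous_modeCosh m.a 0; have := continuous_modeCosh m.b 0
  unfold yLx; fun_prop

theorem hasDerivAt_uL (α₁ α₂ : ℂ) (x : ℝ) : HasDerivAt (m.uL α₁ α₂) (m.uLx α₁ α₂ x) x :=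
  (((hasDerivAt_modeSinh m.a 0 x).const_mul _).add
    ((hasDerivAt_modeSinh m.b 0 x).const_mul _)).div_const _

theorem hasDerivAt_yL (α₁ α₂ : ℂ) (x : ℝ) : HasDerivAt (m.yL α₁ α₂) (m.yLx α₁ α₂ x) x :=
  ((((hasDerivAt_modeSinh m.a 0 x).const_mul _).sub
    ((hasDerivAt_modeSinh m.b 0 x).const_mul _)).const_mul _).div_const _

theorem hasDerivAt_uLx (α₁ α₂ : ℂ) (x : ℝ) : HasDerivAt (m.uLx α₁ α₂)
    (μ ^ 2 * m.uL α₁ α₂ x + c * μ * m.yL α₁ α₂ x) x := by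
  refine (((((hasDerivAt_modeCosh m.a 0 x).const_mul m.a).const_mul _).add
    (((hasDerivAt_modeCosh m.b 0 x).const_mul m.b).const_mul _)).div_const _).congr_deriv ?_
  simp only [uL, yL]
  linear_combination (α₁ * modeSinh m.a 0 x / 2) * m.ea + (α₂ * modeSinh m.b 0 x / 2) * m.eb

theorem hasDerivAt_yLx (α₁ α₂ : ℂ) (x : ℝ) : HasDerivAt (m.yLx α₁ α₂)
    (μ ^ 2 * m.yL α₁ α₂ x - c * μ * m.uL α₁ α₂ x) x := by
  refine ((((((hasDerivAt_modeCosh m.a 0 x).const_mul m.a).const_mul _).sub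
    (((hasDerivAt_modeCosh m.b 0 x).const_mul m.b).const_mul _)).const_mul _).div_const
    _).congr_deriv ?_
  simp only [uL, yL]
  linear_combination (Complex.I * α₁ * modeSinh m.a 0 x / 2) * m.ea
    - (Complex.I * α₂ * modeSinh m.b 0 x / 2) * m.eb
    + (c * μ * (α₁ * modeSinh m.a 0 x + α₂ * modeSinh m.b 0 x) / 2) * Complex.I_sq

/-- The solutions of the kernel equation in terms of the coefficients of the modes. -/
def Represents (α₁ α₂ β₁ β₂ : ℂ) (u P y Y : ℝ → ℂ) : Prop :=
  (∀ x ∈ Icc (0 : ℝ) (1 / 2), u x = m.uL α₁ α₂ x ∧ P x = m.uLx α₁ α₂ x ∧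
    y x = m.yL α₁ α₂ x ∧ Y x = m.yLx α₁ α₂ x) ∧
  ∀ x ∈ Icc (1 / 2 : ℝ) 1, u x = m.uR β₁ β₂ x ∧ P x = (1 + μ) * m.uRx β₁ β₂ x ∧
      y x = m.yR β₁ β₂ x ∧ Y x = m.yRx β₁ β₂ x

/-- Adding and subtracting the conditions for u - iy and u + iy separates u from y. On the right the
quantity matched with u_x is the flux (1 + μ) u_x. -/
theorem Transmission.match_half {m : ModeData c μ} {α₁ α₂ β₁ β₂ : ℂ}
    (h : m.Transmission α₁ α₂ β₁ β₂) :
    m.uL α₁ α₂ (1 / 2) = m.uR β₁ β₂ (1 / 2) ∧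
    m.uLx α₁ α₂ (1 / 2) = (1 + μ) * m.uRx β₁ β₂ (1 / 2) ∧
    m.yL α₁ α₂ (1 / 2) = m.yR β₁ β₂ (1 / 2) ∧ m.yLx α₁ α₂ (1 / 2) = m.yRx β₁ β₂ (1 / 2) := by
  obtain ⟨⟨h1, h2⟩, h3, h4⟩ := h
  simp only [uL, uLx, yL, yLx, modeSinh_zero_half, modeCosh_zero_half, h1, h2, h3, h4]
  refine ⟨by ring, by ring, ?_, ?_⟩ <;> ring_nf <;> simp

/-- Solutions of the homogeneous system on the left are combinations of the two modes. -/
theorem exists_left_form {u P y Y : ℝ → ℂ} (cu : ContinuousOn u (Icc 0 (1 / 2)))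
    (cP : ContinuousOn P (Icc 0 (1 / 2))) (cy : ContinuousOn y (Icc 0 (1 / 2)))
    (cY : ContinuousOn Y (Icc 0 (1 / 2)))
    (du : ∀ x ∈ Ioo (0 : ℝ) (1 / 2), HasDerivAt u (P x) x)
    (dP : ∀ x ∈ Ioo (0 : ℝ) (1 / 2), HasDerivAt P (μ ^ 2 * u x + c * μ * y x) x)
    (dy : ∀ x ∈ Ioo (0 : ℝ) (1 / 2), HasDerivAt y (Y x) x)
    (dY : ∀ x ∈ Ioo (0 : ℝ) (1 / 2), HasDerivAt Y (μ ^ 2 * y x - c * μ * u x) x)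
    (hu : u 0 = 0) (hy : y 0 = 0) :
    ∃ α₁ α₂ : ℂ, ∀ x ∈ Icc (0 : ℝ) (1 / 2), u x = m.uL α₁ α₂ x ∧ P x = m.uLx α₁ α₂ x ∧
      y x = m.yL α₁ α₂ x ∧ Y x = m.yLx α₁ α₂ x := by
  have z0 : (0:ℝ) ∈ Icc (0:ℝ) (1/2) := by constructor <;> norm_num
  -- Without damping the coupling is antisymmetric between u and y, so u - iy and u + iy diagonalize
  -- it, with squared exponents μ² + icμ and μ² - icμ.
  obtain ⟨α₁, hα₁⟩ := exists_eq_mode_of_ode m.ha (w := fun x => u x - Complex.I * y x)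
    (D := fun x => P x - Complex.I * Y x)
    (cu.sub (continuousOn_const.mul cy)) (cP.sub (continuousOn_const.mul cY))
    (fun x hx => (du x hx).sub ((dy x hx).const_mul _))
    (fun x hx => by
      refine ((dP x hx).sub ((dY x hx).const_mul _)).congr_deriv ?_
      linear_combination -(u x - Complex.I * y x) * m.ea + c * μ * y x * Complex.I_sq)
    z0 (by simp [hu, hy])
  obtain ⟨α₂, hα₂⟩ := exists_eq_mode_of_ode m.hb (w := fun x => u x + Complex.I * y x)
    (D := fun x => P x + Complex.I * Y x)
    (cu.add (continuousOn_const.mul cy)) (cP.add (continuousOn_const.mul cY))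
    (fun x hx => (du x hx).add ((dy x hx).const_mul _))
    (fun x hx => by
      refine ((dP x hx).add ((dY x hx).const_mul _)).congr_deriv ?_
      linear_combination -(u x + Complex.I * y x) * m.eb + c * μ * y x * Complex.I_sq)
    z0 (by simp [hu, hy])
  refine ⟨α₁, α₂, fun x hx => ?_⟩
  obtain ⟨a1, b1⟩ := hα₁ x hx
  obtain ⟨a2, b2⟩ := hα₂ x hx
  simp only [uL, uLx, yL, yLx, ← a1, ← a2, ← b1, ← b2]
  refine ⟨by ring, by ring, ?_, ?_⟩ <;> ring_nf <;> simp

theorem uL_sub_yL (α₁ α₂ : ℂ) : m.uL α₁ α₂ (1 / 2) - Complex.I * m.yL α₁ α₂ (1 / 2)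
    = α₁ * Complex.sinh (m.a / 2) := by
  simp only [uL, yL, modeSinh_zero_half]; ring_nf; simp; ring

theorem uL_add_yL (α₁ α₂ : ℂ) : m.uL α₁ α₂ (1 / 2) + Complex.I * m.yL α₁ α₂ (1 / 2)
    = α₂ * Complex.sinh (m.b / 2) := by
  simp only [uL, yL, modeSinh_zero_half]; ring_nf; simp; ring

theorem uLx_sub_yLx (α₁ α₂ : ℂ) : m.uLx α₁ α₂ (1 / 2) - Complex.I * m.yLx α₁ α₂ (1 / 2)
    = α₁ * (m.a * Complex.cosh (m.a / 2)) := by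
  simp only [uLx, yLx, modeCosh_zero_half]; ring_nf; simp; ring

theorem uLx_add_yLx (α₁ α₂ : ℂ) : m.uLx α₁ α₂ (1 / 2) + Complex.I * m.yLx α₁ α₂ (1 / 2)
    = α₂ * (m.b * Complex.cosh (m.b / 2)) := by
  simp only [uLx, yLx, modeCosh_zero_half]; ring_nf; simp; ring

theorem exists_represents {u P y Y : ℝ → ℂ} (cu : ContinuousOn u (Icc 0 1))
    (cP : ContinuousOn P (Icc 0 1)) (cy : ContinuousOn y (Icc 0 1)) (cY : ContinuousOn Y (Icc 0 1))
    (bc : u 0 = 0 ∧ u 1 = 0 ∧ y 0 = 0 ∧ y 1 = 0)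
    (du : ∀ x ∈ Ioo 0 (1 / 2), HasDerivAt u (P x) x)
    (du' : ∀ x ∈ Ioo (1 / 2) 1, HasDerivAt u (P x / (1 + μ)) x)
    (d : ∀ x ∈ Ioo 0 1, HasDerivAt P (μ ^ 2 * u x + c * μ * y x) x ∧
      HasDerivAt y (Y x) x ∧ HasDerivAt Y (μ ^ 2 * y x - c * μ * u x) x) :
    ∃ α₁ α₂ β₁ β₂, m.Represents α₁ α₂ β₁ β₂ u P y Y ∧ m.Transmission α₁ α₂ β₁ β₂ := by
  have sl : Icc (0:ℝ) (1/2) ⊆ Icc 0 1 := Icc_subset_Icc_right (by norm_num)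
  have sr : Icc (1/2:ℝ) 1 ⊆ Icc 0 1 := Icc_subset_Icc_left (by norm_num)
  have ol : Ioo (0:ℝ) (1/2) ⊆ Ioo 0 1 := Ioo_subset_Ioo_right (by norm_num)
  have or : Ioo (1/2:ℝ) 1 ⊆ Ioo 0 1 := Ioo_subset_Ioo_left (by norm_num)
  obtain ⟨u0, u1, y0, y1⟩ := bc
  obtain ⟨β₁, β₂, hβ⟩ := m.exists_right_form (cu.mono sr) (cP.mono sr) (cy.mono sr) (cY.mono sr) du'
    (fun x hx => (d x (or hx)).1) (fun x hx => (d x (or hx)).2.1) (fun x hx => (d x (or hx)).2.2)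
    u1 y1
  obtain ⟨α₁, α₂, hα⟩ := m.exists_left_form (cu.mono sl) (cP.mono sl) (cy.mono sl) (cY.mono sl) du
    (fun x hx => (d x (ol hx)).1) (fun x hx => (d x (ol hx)).2.1) (fun x hx => (d x (ol hx)).2.2)
    u0 y0
  refine ⟨α₁, α₂, β₁, β₂, ⟨hα, hβ⟩, ?_⟩
  obtain ⟨e1, e2, e3, e4⟩ := hβ (1/2) ⟨le_rfl, by norm_num⟩
  obtain ⟨f1, f2, f3, f4⟩ := hα (1/2) ⟨by norm_num, le_rfl⟩
  unfold Transmission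
  rw [← e1, ← e2, ← e3, ← e4, f1, f2, f3, f4, uL_sub_yL, uL_add_yL, uLx_sub_yLx, uLx_add_yLx]
  exact ⟨⟨rfl, rfl⟩, rfl, rfl⟩

/-- The eigenvector with given coefficients. -/
noncomputable def vec {α₁ α₂ β₁ β₂ : ℂ} (h : m.Transmission α₁ α₂ β₁ β₂) : EnergySpace 1 :=
  have hu := glueL2_mem_H10 (m.continuous_uL α₁ α₂) (m.continuous_uR β₁ β₂) (m.continuous_uLx α₁ α₂)
    (m.continuous_uRx β₁ β₂) (m.hasDerivAt_uL α₁ α₂) (m.hasDerivAt_uR β₁ β₂) h.match_half.1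
    (by simp [uL, modeSinh_self]) (by simp [uR, modeSinh_self])
  have hy := glueL2_mem_H10 (m.continuous_yL α₁ α₂) (m.continuous_yR β₁ β₂) (m.continuous_yLx α₁ α₂)
    (m.continuous_yRx β₁ β₂) (m.hasDerivAt_yL α₁ α₂) (m.hasDerivAt_yR β₁ β₂) h.match_half.2.2.1
    (by simp [yL, modeSinh_self]) (by simp [yR, modeSinh_self])
  (⟨_, hu⟩, μ • glueL2 (m.continuous_uL α₁ α₂) (m.continuous_uR β₁ β₂), ⟨_, hy⟩,
    μ • glueL2 (m.continuous_yL α₁ α₂) (m.continuous_yR β₁ β₂))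

/-- The four matching conditions at 1/2 are exactly what makes the piecewise derivatives of u, of
the flux, of y and of y_x weak derivatives on the whole interval. The equations then hold on each
side by the dispersion relations. -/
theorem isGeneratorPair_vec {α₁ α₂ β₁ β₂ : ℂ} (h : m.Transmission α₁ α₂ β₁ β₂) :
    IsGeneratorPair 1 1 localDamping (fun _ => c) (m.vec h) (μ • m.vec h) := by
  obtain ⟨e1, e2, e3, e4⟩ := h.match_half
  have cu := m.continuous_uL α₁ α₂
  have cy := m.continuous_yL α₁ α₂
  have cu' := m.continuous_uR β₁ β₂
  have cy' := m.continuous_yR β₁ β₂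
  have cux := m.continuous_uLx α₁ α₂
  have cux' := m.continuous_uRx β₁ β₂
  have cyx := m.continuous_yLx α₁ α₂
  have cyx' := m.continuous_yRx β₁ β₂
  have cp : Continuous fun x => (1 + μ) * m.uRx β₁ β₂ x := continuous_const.mul cux'
  have cq : Continuous fun x => μ ^ 2 * m.uL α₁ α₂ x + c * μ * m.yL α₁ α₂ x := by fun_prop
  have cq' : Continuous fun x => μ ^ 2 * m.uR β₁ β₂ x + c * μ * m.yR β₁ β₂ x := by fun_prop
  have cr : Continuous fun x => μ ^ 2 * m.yL α₁ α₂ x - c * μ * m.uL α₁ α₂ x := by fun_prop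
  have cr' : Continuous fun x => μ ^ 2 * m.yR β₁ β₂ x - c * μ * m.uR β₁ β₂ x := by fun_prop
  have hu : HasWeakDeriv (glueL2 cu cu') (glueL2 cux cux') :=
    hasWeakDeriv_glueL2 _ _ _ _ (m.hasDerivAt_uL _ _) (m.hasDerivAt_uR _ _) e1
  have hy : HasWeakDeriv (glueL2 cy cy') (glueL2 cyx cyx') :=
    hasWeakDeriv_glueL2 _ _ _ _ (m.hasDerivAt_yL _ _) (m.hasDerivAt_yR _ _) e3
  have hp : HasWeakDeriv (glueL2 cux cp) (glueL2 cq cq') :=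
    hasWeakDeriv_glueL2 _ _ _ _ (m.hasDerivAt_uLx _ _) (m.hasDerivAt_uRx _ _) e2
  have hr : HasWeakDeriv (glueL2 cyx cyx') (glueL2 cr cr') :=
    hasWeakDeriv_glueL2 _ _ _ _ (m.hasDerivAt_yLx _ _) (m.hasDerivAt_yRx _ _) e4
  have su := Lp.coeFn_smul μ (glueL2 cu cu')
  have sy := Lp.coeFn_smul μ (glueL2 cy cy')
  have ssu := Lp.coeFn_smul μ (μ • glueL2 cu cu')
  have ssy := Lp.coeFn_smul μ (μ • glueL2 cy cy')
  have sux := Lp.coeFn_smul μ (glueL2 cux cux')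
  refine ⟨⟨(H10 1).smul_mem μ (m.vec h).1.2, (H10 1).smul_mem μ (m.vec h).2.2.1.2⟩, ⟨rfl, rfl⟩,
    ⟨_, _, _, _, hu, hu.smul μ, ?_, hp, ?_⟩, ⟨_, _, hy, hr, ?_⟩⟩
  · filter_upwards [coeFn_glueL2 cux cp, coeFn_glueL2 cux cux', sux, ae_restrict_mem measurableSet_Ioo]
      with x h1 h2 h3 hx
    rw [h1, h3, Pi.smul_apply, h2]
    by_cases hx' : x ≤ 1 / 2
    · simp only [glue, if_pos hx', localDamping_left hx']; simp
    · simp only [glue, if_neg hx', localDamping_right (not_le.1 hx') hx.2.le, smul_eq_mul]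
      push_cast; ring
  · filter_upwards [coeFn_glueL2 cq cq', coeFn_glueL2 cu cu', coeFn_glueL2 cy cy', su, ssu, sy]
      with x h1 h2 h3 h4 h5 h6
    change (μ • (μ • glueL2 cu cu')) x = _ - _ * (μ • glueL2 cy cy') x
    rw [h1, h5, Pi.smul_apply, h4, h6, Pi.smul_apply, Pi.smul_apply, h2, h3]
    by_cases hx' : x ≤ 1 / 2
    · simp only [glue, if_pos hx', smul_eq_mul]; ring
    · simp only [glue, if_neg hx', smul_eq_mul]; ring
  · filter_upwards [coeFn_glueL2 cr cr', coeFn_glueL2 cu cu', coeFn_glueL2 cy cy', su, ssy, sy]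
      with x h1 h2 h3 h4 h5 h6
    change (μ • (μ • glueL2 cy cy')) x = _ + _ * (μ • glueL2 cu cu') x
    rw [h1, h5, Pi.smul_apply, h6, h4, Pi.smul_apply, Pi.smul_apply, h2, h3]
    by_cases hx' : x ≤ 1 / 2
    · simp only [glue, if_pos hx', smul_eq_mul]; ring
    · simp only [glue, if_neg hx', smul_eq_mul]; ring

end ModeData

/-! ### Jordan chains and algebraic multiplicity -/

namespace ModeData
variable {c : ℝ} {μ : ℂ} (m : ModeData c μ)

/-- The derivative of the interface determinant with respect to the spectral parameter. -/
noncomputable def detDeriv : ℂ :=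
  m.oscA' * m.layerB + m.oscA * m.layerB' + (m.oscB' * m.layerA + m.oscB * m.layerA')

/-- The derivatives of the left solutions in the spectral parameter. -/
noncomputable def uLv (α₁ α₂ : ℂ) : ℝ → ℂ := fun x =>
  (α₁ * (m.a' * modeVar m.a 0 x) + α₂ * (m.b' * modeVar m.b 0 x)) / 2
noncomputable def uLvx (α₁ α₂ : ℂ) : ℝ → ℂ := fun x =>
  (α₁ * (m.a' * modeVarDeriv m.a 0 x) + α₂ * (m.b' * modeVarDeriv m.b 0 x)) / 2
noncomputable def yLv (α₁ α₂ : ℂ) : ℝ → ℂ := fun x =>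
  Complex.I * (α₁ * (m.a' * modeVar m.a 0 x) - α₂ * (m.b' * modeVar m.b 0 x)) / 2
noncomputable def yLvx (α₁ α₂ : ℂ) : ℝ → ℂ := fun x =>
  Complex.I * (α₁ * (m.a' * modeVarDeriv m.a 0 x) - α₂ * (m.b' * modeVarDeriv m.b 0 x)) / 2

theorem continuous_uLv (α₁ α₂ : ℂ) : Continuous (m.uLv α₁ α₂) := by
  have := continuous_modeVar m.a 0; have := continuous_modeVar m.b 0
  unfold uLv; fun_prop

theorem continuous_yLv (α₁ α₂ : ℂ) : Continuous (m.yLv α₁ α₂) := by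
  have := continuous_modeVar m.a 0; have := continuous_modeVar m.b 0
  unfold yLv; fun_prop

theorem continuous_uLvx (α₁ α₂ : ℂ) : Continuous (m.uLvx α₁ α₂) := by
  have := continuous_modeVarDeriv m.a 0; have := continuous_modeVarDeriv m.b 0
  unfold uLvx; fun_prop

theorem continuous_yLvx (α₁ α₂ : ℂ) : Continuous (m.yLvx α₁ α₂) := by
  have := continuous_modeVarDeriv m.a 0; have := continuous_modeVarDeriv m.b 0
  unfold yLvx; fun_prop

theorem hasDerivAt_uLv (α₁ α₂ : ℂ) (x : ℝ) : HasDerivAt (m.uLv α₁ α₂) (m.uLvx α₁ α₂ x) x :=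
  ((((hasDerivAt_modeVar m.a 0 x).const_mul _).const_mul _).add
    (((hasDerivAt_modeVar m.b 0 x).const_mul _).const_mul _)).div_const _

theorem hasDerivAt_yLv (α₁ α₂ : ℂ) (x : ℝ) : HasDerivAt (m.yLv α₁ α₂) (m.yLvx α₁ α₂ x) x :=
  (((((hasDerivAt_modeVar m.a 0 x).const_mul _).const_mul _).sub
    (((hasDerivAt_modeVar m.b 0 x).const_mul _).const_mul _)).const_mul _).div_const _

theorem hasDerivAt_uLvx (α₁ α₂ : ℂ) (x : ℝ) : HasDerivAt (m.uLvx α₁ α₂)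
    (μ ^ 2 * m.uLv α₁ α₂ x + c * μ * m.yLv α₁ α₂ x +
      (2 * μ * m.uL α₁ α₂ x + c * m.yL α₁ α₂ x)) x := by
  refine (((((hasDerivAt_modeVarDeriv m.a 0 x).const_mul _).const_mul _).add
    (((hasDerivAt_modeVarDeriv m.b 0 x).const_mul _).const_mul _)).div_const _).congr_deriv ?_
  simp only [uL, yL, uLv, yLv]
  linear_combination (α₁ * m.a' * modeVar m.a 0 x / 2) * m.ea
    + (α₂ * m.b' * modeVar m.b 0 x / 2) * m.eb
    + (α₁ * modeSinh m.a 0 x / 2) * m.ea' + (α₂ * modeSinh m.b 0 x / 2) * m.eb'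

theorem hasDerivAt_yLvx (α₁ α₂ : ℂ) (x : ℝ) : HasDerivAt (m.yLvx α₁ α₂)
    (μ ^ 2 * m.yLv α₁ α₂ x - c * μ * m.uLv α₁ α₂ x +
      (2 * μ * m.yL α₁ α₂ x - c * m.uL α₁ α₂ x)) x := by
  refine ((((((hasDerivAt_modeVarDeriv m.a 0 x).const_mul _).const_mul _).sub
    (((hasDerivAt_modeVarDeriv m.b 0 x).const_mul _).const_mul _)).const_mul _).div_const
    _).congr_deriv ?_
  simp only [uL, yL, uLv, yLv]
  linear_combination (Complex.I * α₁ * m.a' * modeVar m.a 0 x / 2) * m.ea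
    - (Complex.I * α₂ * m.b' * modeVar m.b 0 x / 2) * m.eb
    + (Complex.I * α₁ * modeSinh m.a 0 x / 2) * m.ea'
    - (Complex.I * α₂ * modeSinh m.b 0 x / 2) * m.eb'
    + (c * (α₁ * modeSinh m.a 0 x + α₂ * modeSinh m.b 0 x) / 2 +
      c * μ * (α₁ * m.a' * modeVar m.a 0 x + α₂ * m.b' * modeVar m.b 0 x) / 2) * Complex.I_sq

/-- The derivative of `cross_a` along a family of coefficients. -/
theorem cross_a_deriv (β₁ β₂ β₁' β₂' : ℂ) :
    m.a * Complex.cosh (m.a / 2) * (m.uR β₁' β₂' (1 / 2) + m.uRv β₁ β₂ (1 / 2)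
        - Complex.I * (m.yR β₁' β₂' (1 / 2) + m.yRv β₁ β₂ (1 / 2))) -
      Complex.sinh (m.a / 2) * ((1 + μ) * m.uRx β₁' β₂' (1 / 2) +
        (m.uRx β₁ β₂ (1 / 2) + (1 + μ) * m.uRvx β₁ β₂ (1 / 2))
        - Complex.I * (m.yRx β₁' β₂' (1 / 2) + m.yRvx β₁ β₂ (1 / 2))) +
      (m.a' * Complex.cosh (m.a / 2) + m.a * (m.a' / 2 * Complex.sinh (m.a / 2))) *
        (m.uR β₁ β₂ (1 / 2) - Complex.I * m.yR β₁ β₂ (1 / 2)) -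
      m.a' / 2 * Complex.cosh (m.a / 2) *
        ((1 + μ) * m.uRx β₁ β₂ (1 / 2) - Complex.I * m.yRx β₁ β₂ (1 / 2))
      = Complex.I * (m.oscA * β₁' + m.oscA' * β₁) - (m.layerA * β₂' + m.layerA' * β₂) := by
  simp only [uR, uRx, yR, yRx, uRv, uRvx, yRv, yRvx, modeSinh_one_half, modeCosh_one_half,
    modeVar_one_half, modeVarDeriv_one_half, oscA, layerA, oscCoeff, layerCoeff, oscA', layerA',
    oscCoeffDeriv, layerCoeffDeriv, m.eω, m.eω']
  ring_nf
  simp only [Complex.I_sq]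
  ring

theorem cross_b_deriv (β₁ β₂ β₁' β₂' : ℂ) :
    m.b * Complex.cosh (m.b / 2) * (m.uR β₁' β₂' (1 / 2) + m.uRv β₁ β₂ (1 / 2)
        + Complex.I * (m.yR β₁' β₂' (1 / 2) + m.yRv β₁ β₂ (1 / 2))) -
      Complex.sinh (m.b / 2) * ((1 + μ) * m.uRx β₁' β₂' (1 / 2) +
        (m.uRx β₁ β₂ (1 / 2) + (1 + μ) * m.uRvx β₁ β₂ (1 / 2))
        + Complex.I * (m.yRx β₁' β₂' (1 / 2) + m.yRvx β₁ β₂ (1 / 2))) +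
      (m.b' * Complex.cosh (m.b / 2) + m.b * (m.b' / 2 * Complex.sinh (m.b / 2))) *
        (m.uR β₁ β₂ (1 / 2) + Complex.I * m.yR β₁ β₂ (1 / 2)) -
      m.b' / 2 * Complex.cosh (m.b / 2) *
        ((1 + μ) * m.uRx β₁ β₂ (1 / 2) + Complex.I * m.yRx β₁ β₂ (1 / 2))
      = -(Complex.I * (m.oscB * β₁' + m.oscB' * β₁)) - (m.layerB * β₂' + m.layerB' * β₂) := by
  simp only [uR, uRx, yR, yRx, uRv, uRvx, yRv, yRvx, modeSinh_one_half, modeCosh_one_half,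
    modeVar_one_half, modeVarDeriv_one_half, oscB, layerB, oscCoeff, layerCoeff, oscB', layerB',
    oscCoeffDeriv, layerCoeffDeriv, m.eω, m.eω']
  ring_nf
  simp only [Complex.I_sq]
  ring

/-- If the determinant has a simple zero, the kernel vectors of the interface matrix are not the
beginning of a Jordan chain. -/
theorem eq_zero_of_chain (hG : m.oscA * m.layerB + m.oscB * m.layerA = 0) (hG' : m.detDeriv ≠ 0)
    {β₁ β₂ β₁' β₂' : ℂ}
    (h1 : Complex.I * m.oscA * β₁ - m.layerA * β₂ = 0)
    (h2 : Complex.I * m.oscB * β₁ + m.layerB * β₂ = 0)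
    (h3 : Complex.I * (m.oscA * β₁' + m.oscA' * β₁) - (m.layerA * β₂' + m.layerA' * β₂) = 0)
    (h4 : Complex.I * (m.oscB * β₁' + m.oscB' * β₁) + (m.layerB * β₂' + m.layerB' * β₂) = 0) :
    β₁ = 0 ∧ β₂ = 0 := by
  -- The differentiated system is multiplied by the adjugate of the interface matrix. The terms in
  -- β' vanish with the determinant, and the kernel equations complete the remaining ones to the
  -- derivative of the determinant times β.
  have e1 : Complex.I * (m.detDeriv * β₁) = 0 := by
    simp only [detDeriv]
    linear_combination m.layerB * h3 + m.layerA * h4 + m.layerB' * h1 + m.layerA' * h2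
      - Complex.I * β₁' * hG
  have e2 : m.detDeriv * β₂ = 0 := by
    simp only [detDeriv]
    linear_combination -m.oscB * h3 + m.oscA * h4 - m.oscB' * h1 + m.oscA' * h2 - β₂' * hG
  exact ⟨by simpa [hG'] using e1, by simpa [hG'] using e2⟩

/-- A matrix with zero determinant whose determinant has nonzero derivative cannot vanish entirely,
since the product rule would make that derivative zero. It has rank one, and its kernel is spanned
by a vector read off from a nonzero row. -/
theorem exists_kernel (hG : m.oscA * m.layerB + m.oscB * m.layerA = 0) (hG' : m.detDeriv ≠ 0) :
    ∃ β₁ β₂ : ℂ, (β₁ ≠ 0 ∨ β₂ ≠ 0) ∧ Complex.I * m.oscA * β₁ - m.layerA * β₂ = 0 ∧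
      Complex.I * m.oscB * β₁ + m.layerB * β₂ = 0 ∧
      ∀ γ₁ γ₂ : ℂ, Complex.I * m.oscA * γ₁ - m.layerA * γ₂ = 0 →
        Complex.I * m.oscB * γ₁ + m.layerB * γ₂ = 0 → ∃ k, γ₁ = k * β₁ ∧ γ₂ = k * β₂ := by
  have prop : ∀ p q : ℂ, (p ≠ 0 ∨ q ≠ 0) → ∀ γ₁ γ₂ : ℂ, Complex.I * p * γ₁ - q * γ₂ = 0 →
      ∃ k, γ₁ = k * q ∧ γ₂ = k * (Complex.I * p) := by
    intro p q hpq γ₁ γ₂ h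
    by_cases hq : q = 0
    · have hp : p ≠ 0 := by simpa [hq] using hpq
      have : γ₁ = 0 := by simpa [hq, hp] using h
      exact ⟨γ₂ / (Complex.I * p), by simp [this, hq], by
        have := Complex.I_ne_zero; field_simp⟩
    · refine ⟨γ₁ / q, by field_simp, ?_⟩
      field_simp
      linear_combination -h
  by_cases hA : m.oscA ≠ 0 ∨ m.layerA ≠ 0
  · refine ⟨m.layerA, Complex.I * m.oscA, ?_, by ring, by linear_combination Complex.I * hG,
      fun γ₁ γ₂ h _ => prop _ _ hA _ _ h⟩
    rcases hA with h | h
    · exact Or.inr (mul_ne_zero Complex.I_ne_zero h)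
    · exact Or.inl h
  · push Not at hA
    have hB : m.oscB ≠ 0 ∨ -m.layerB ≠ 0 := by
      by_contra hB
      push Not at hB
      refine hG' ?_
      simp [detDeriv, hA.1, hA.2, hB.1, neg_eq_zero.1 hB.2]
    refine ⟨-m.layerB, Complex.I * m.oscB, ?_, by simp [hA.1, hA.2], by ring,
      fun γ₁ γ₂ _ h => prop _ _ hB _ _ (by linear_combination h)⟩
    rcases hB with h | h
    · exact Or.inr (mul_ne_zero Complex.I_ne_zero h)
    · exact Or.inl h

theorem _root_.eq_of_mul_sinh_cosh {r α α' : ℂ} (hr : r ≠ 0)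
    (h1 : α * Complex.sinh (r / 2) = α' * Complex.sinh (r / 2))
    (h2 : α * (r * Complex.cosh (r / 2)) = α' * (r * Complex.cosh (r / 2))) : α = α' := by
  have id := Complex.cosh_sq_sub_sinh_sq (r / 2)
  refine mul_left_cancel₀ hr ?_
  linear_combination -(r * (α - α')) * id + Complex.cosh (r / 2) * h2
    - r * Complex.sinh (r / 2) * h1

theorem Transmission.eq_smul {m : ModeData c μ} {α₁ α₂ α₁' α₂' β₁ β₂ k : ℂ}
    (h : m.Transmission α₁ α₂ β₁ β₂) (h' : m.Transmission α₁' α₂' (k * β₁) (k * β₂)) :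
    α₁' = k * α₁ ∧ α₂' = k * α₂ := by
  obtain ⟨⟨h1, h2⟩, h3, h4⟩ := h
  obtain ⟨⟨g1, g2⟩, g3, g4⟩ := h'
  simp only [uR, uRx, yR, yRx] at *
  exact ⟨eq_of_mul_sinh_cosh m.ha (by linear_combination g1 - k * h1)
    (by linear_combination g2 - k * h2), eq_of_mul_sinh_cosh m.hb
    (by linear_combination g3 - k * h3) (by linear_combination g4 - k * h4)⟩

/-- The coefficients of a generalized eigenvector over the solution with coefficients
`α₁, α₂, β₁, β₂`. -/
theorem exists_chain {α₁ α₂ β₁ β₂ : ℂ} (hT : m.Transmission α₁ α₂ β₁ β₂)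
    {f Pf h Yh u P y Y : ℝ → ℂ} (hf : m.Represents α₁ α₂ β₁ β₂ f Pf h Yh)
    (cu : ContinuousOn u (Icc 0 1))
    (cP : ContinuousOn P (Icc 0 1)) (cy : ContinuousOn y (Icc 0 1)) (cY : ContinuousOn Y (Icc 0 1))
    (bc : u 0 = 0 ∧ u 1 = 0 ∧ y 0 = 0 ∧ y 1 = 0)
    (du : ∀ x ∈ Ioo 0 (1 / 2), HasDerivAt u (P x) x)
    (du' : ∀ x ∈ Ioo (1 / 2) 1, HasDerivAt u ((P x - Pf x / (1 + μ)) / (1 + μ)) x)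
    (d : ∀ x ∈ Ioo 0 1,
      HasDerivAt P (μ ^ 2 * u x + c * μ * y x + (2 * μ * f x + c * h x)) x ∧
      HasDerivAt y (Y x) x ∧
      HasDerivAt Y (μ ^ 2 * y x - c * μ * u x + (2 * μ * h x - c * f x)) x) :
    ∃ β₁' β₂' : ℂ,
      Complex.I * (m.oscA * β₁' + m.oscA' * β₁) - (m.layerA * β₂' + m.layerA' * β₂) = 0 ∧
      Complex.I * (m.oscB * β₁' + m.oscB' * β₁) + (m.layerB * β₂' + m.layerB' * β₂) = 0 := by
  have hμ := m.hμ
  have sl : Icc (0:ℝ) (1/2) ⊆ Icc 0 1 := Icc_subset_Icc_right (by norm_num)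
  have sr : Icc (1/2:ℝ) 1 ⊆ Icc 0 1 := Icc_subset_Icc_left (by norm_num)
  have ol : Ioo (0:ℝ) (1/2) ⊆ Ioo 0 1 := Ioo_subset_Ioo_right (by norm_num)
  have or : Ioo (1/2:ℝ) 1 ⊆ Ioo 0 1 := Ioo_subset_Ioo_left (by norm_num)
  obtain ⟨u0, u1, y0, y1⟩ := bc
  -- The spectral derivative of the modes of W solves the inhomogeneous equations of the chain. The
  -- difference with V is homogeneous and again a combination of modes, with new coefficients β'.
  obtain ⟨β₁', β₂', hβ⟩ := m.exists_right_form
    (u := fun x => u x - m.uRv β₁ β₂ x)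
    (P := fun x => P x - (m.uRx β₁ β₂ x + (1 + μ) * m.uRvx β₁ β₂ x))
    (y := fun x => y x - m.yRv β₁ β₂ x) (Y := fun x => Y x - m.yRvx β₁ β₂ x)
    ((cu.mono sr).sub (m.continuous_uRv _ _).continuousOn)
    ((cP.mono sr).sub ((m.continuous_uRx _ _).add
      (continuous_const.mul (m.continuous_uRvx _ _))).continuousOn)
    ((cy.mono sr).sub (m.continuous_yRv _ _).continuousOn)
    ((cY.mono sr).sub (m.continuous_yRvx _ _).continuousOn)
    (fun x hx => by
      refine ((du' x hx).sub (m.hasDerivAt_uRv β₁ β₂ x)).congr_deriv ?_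
      rw [(hf.2 x (Ioo_subset_Icc_self hx)).2.1]
      field_simp; ring)
    (fun x hx => by
      refine ((d x (or hx)).1.sub (m.hasDerivAt_uRvx β₁ β₂ x)).congr_deriv ?_
      obtain ⟨e1, -, e3, -⟩ := hf.2 x (Ioo_subset_Icc_self hx)
      rw [e1, e3]; ring)
    (fun x hx => (d x (or hx)).2.1.sub (m.hasDerivAt_yRv β₁ β₂ x))
    (fun x hx => by
      refine ((d x (or hx)).2.2.sub (m.hasDerivAt_yRvx β₁ β₂ x)).congr_deriv ?_
      obtain ⟨e1, -, e3, -⟩ := hf.2 x (Ioo_subset_Icc_self hx)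
      rw [e1, e3]; ring)
    (by simp [u1, uRv, modeSinh_self, modeVar_self])
    (by simp [y1, yRv, modeSinh_self, modeVar_self])
  obtain ⟨α₁', α₂', hα⟩ := m.exists_left_form
    (u := fun x => u x - m.uLv α₁ α₂ x) (P := fun x => P x - m.uLvx α₁ α₂ x)
    (y := fun x => y x - m.yLv α₁ α₂ x) (Y := fun x => Y x - m.yLvx α₁ α₂ x)
    ((cu.mono sl).sub (m.continuous_uLv _ _).continuousOn)
    ((cP.mono sl).sub (m.continuous_uLvx _ _).continuousOn)
    ((cy.mono sl).sub (m.continuous_yLv _ _).continuousOn)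
    ((cY.mono sl).sub (m.continuous_yLvx _ _).continuousOn)
    (fun x hx => (du x hx).sub (m.hasDerivAt_uLv α₁ α₂ x))
    (fun x hx => by
      refine ((d x (ol hx)).1.sub (m.hasDerivAt_uLvx α₁ α₂ x)).congr_deriv ?_
      obtain ⟨e1, -, e3, -⟩ := hf.1 x (Ioo_subset_Icc_self hx)
      rw [e1, e3]; ring)
    (fun x hx => (d x (ol hx)).2.1.sub (m.hasDerivAt_yLv α₁ α₂ x))
    (fun x hx => by
      refine ((d x (ol hx)).2.2.sub (m.hasDerivAt_yLvx α₁ α₂ x)).congr_deriv ?_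
      obtain ⟨e1, -, e3, -⟩ := hf.1 x (Ioo_subset_Icc_self hx)
      rw [e1, e3]; ring)
    (by simp [u0, uLv, modeVar_self])
    (by simp [y0, yLv, modeVar_self])
  refine ⟨β₁', β₂', ?_, ?_⟩
  all_goals
    obtain ⟨e1, e2, e3, e4⟩ := hβ (1/2) ⟨le_rfl, by norm_num⟩
    obtain ⟨f1, f2, f3, f4⟩ := hα (1/2) ⟨by norm_num, le_rfl⟩
    have l1 := m.uL_sub_yL α₁' α₂'
    have l2 := m.uL_add_yL α₁' α₂'
    have l3 := m.uLx_sub_yLx α₁' α₂'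
    have l4 := m.uLx_add_yLx α₁' α₂'
    rw [← f1, ← f3] at l1 l2
    rw [← f2, ← f4] at l3 l4
    rw [sub_eq_iff_eq_add] at e1 e2 e3 e4
    simp only [uLv, uLvx, yLv, yLvx, modeVar_zero_half, modeVarDeriv_zero_half] at l1 l2 l3 l4
    obtain ⟨⟨t1, t2⟩, t3, t4⟩ := hT
  -- Continuity of u, P, y and Y at 1/2 identifies the right expression with the left one, and there
  -- the coefficients α₁ and α₁' cancel in the differentiated cross product.
  · rw [← m.cross_a_deriv, ← e1, ← e2, ← e3, ← e4, ← t1, ← t2]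
    have l1' : u (1 / 2) - Complex.I * y (1 / 2) = α₁' * Complex.sinh (m.a / 2) +
        α₁ * (m.a' * (Complex.cosh (m.a / 2) / 2)) := by
      linear_combination l1 - (α₁ * (m.a' * (Complex.cosh (m.a / 2) / 2)) -
        α₂ * (m.b' * (Complex.cosh (m.b / 2) / 2))) / 2 * Complex.I_sq
    have l3' : P (1 / 2) - Complex.I * Y (1 / 2) = α₁' * (m.a * Complex.cosh (m.a / 2)) +
        α₁ * (m.a' * (Complex.cosh (m.a / 2) + m.a * Complex.sinh (m.a / 2) / 2)) := by
      linear_combination l3 - (α₁ * (m.a' * (Complex.cosh (m.a / 2) + m.a *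
        Complex.sinh (m.a / 2) / 2)) - α₂ * (m.b' * (Complex.cosh (m.b / 2) + m.b *
        Complex.sinh (m.b / 2) / 2))) / 2 * Complex.I_sq
    linear_combination m.a * Complex.cosh (m.a / 2) * l1' - Complex.sinh (m.a / 2) * l3'
  · have := m.cross_b_deriv β₁ β₂ β₁' β₂'
    rw [← e1, ← e2, ← e3, ← e4, ← t3, ← t4] at this
    have l2' : u (1 / 2) + Complex.I * y (1 / 2) = α₂' * Complex.sinh (m.b / 2) +
        α₂ * (m.b' * (Complex.cosh (m.b / 2) / 2)) := by
      linear_combination l2 + (α₁ * (m.a' * (Complex.cosh (m.a / 2) / 2)) -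
        α₂ * (m.b' * (Complex.cosh (m.b / 2) / 2))) / 2 * Complex.I_sq
    have l4' : P (1 / 2) + Complex.I * Y (1 / 2) = α₂' * (m.b * Complex.cosh (m.b / 2)) +
        α₂ * (m.b' * (Complex.cosh (m.b / 2) + m.b * Complex.sinh (m.b / 2) / 2)) := by
      linear_combination l4 + (α₁ * (m.a' * (Complex.cosh (m.a / 2) + m.a *
        Complex.sinh (m.a / 2) / 2)) - α₂ * (m.b' * (Complex.cosh (m.b / 2) + m.b *
        Complex.sinh (m.b / 2) / 2))) / 2 * Complex.I_sq
    linear_combination this - m.b * Complex.cosh (m.b / 2) * l2' + Complex.sinh (m.b / 2) * l4'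

/-- The right half suffices: y + iωu and u + iσy isolate the two modes up to the nonzero factor 1 +
ωσ, and a mode vanishing on an interval has zero coefficient. -/
theorem vec_ne_zero {α₁ α₂ β₁ β₂ : ℂ} (hT : m.Transmission α₁ α₂ β₁ β₂) (hβ : β₁ ≠ 0 ∨ β₂ ≠ 0) :
    m.vec hT ≠ 0 := by
  intro h0
  have hu : glueL2 (m.continuous_uL α₁ α₂) (m.continuous_uR β₁ β₂) = 0 :=
    congrArg (fun U : EnergySpace 1 => (U.1 : L2 1)) h0
  have hy : glueL2 (m.continuous_yL α₁ α₂) (m.continuous_yR β₁ β₂) = 0 :=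
    congrArg (fun U : EnergySpace 1 => (U.2.2.1 : L2 1)) h0
  have zero_of : ∀ {f g : ℝ → ℂ} (hf : Continuous f) (hg : Continuous g), f (1 / 2) = g (1 / 2) →
      glueL2 hf hg = 0 → ∀ x ∈ Ioo (1 / 2 : ℝ) 1, g x = 0 := by
    intro f g hf hg hfg h x hx
    have e := eqOn_Icc_of_ae_eq one_pos (v := glue f g) (w := fun _ => 0)
      (Continuous.if_le hf hg continuous_id continuous_const
        (fun x hx => by rw [show x = 1 / 2 from hx, hfg])).continuousOn continuousOn_const
      ((coeFn_glueL2 hf hg).symm.trans (by rw [h]; exact Lp.coeFn_zero _ _ _))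
      (show x ∈ Icc (0:ℝ) 1 from ⟨by linarith [hx.1], hx.2.le⟩)
    simpa only [glue, if_neg (not_le.2 hx.1)] using e
  have zu := zero_of _ _ hT.match_half.1 hu
  have zy := zero_of _ _ hT.match_half.2.2.1 hy
  -- both modes vanish on the right, together with their derivatives
  have key : ∀ (δ r : ℂ), r ≠ 0 → (∀ x ∈ Ioo (1 / 2 : ℝ) 1, δ * modeSinh r 1 x = 0) → δ = 0 := by
    intro δ r hr h
    have hx : (3 / 4 : ℝ) ∈ Ioo (1 / 2 : ℝ) 1 := by constructor <;> norm_num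
    have hd : HasDerivAt (fun x => δ * modeSinh r 1 x) 0 (3 / 4) :=
      (hasDerivAt_const (3 / 4 : ℝ) (0 : ℂ)).congr_of_eventuallyEq
        (by filter_upwards [isOpen_Ioo.mem_nhds hx] with x hx using h x hx)
    have e1 := hd.unique ((hasDerivAt_modeSinh r 1 (3 / 4)).const_mul δ)
    have e2 := h _ hx
    have id := Complex.cosh_sq_sub_sinh_sq (r * (((3 / 4 : ℝ) : ℂ) - (1 : ℝ)))
    simp only [modeSinh, modeCosh] at e1 e2
    refine mul_left_cancel₀ hr ?_
    linear_combination -(r * δ) * id - Complex.cosh (r * (((3 / 4 : ℝ) : ℂ) - (1 : ℝ))) * e1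
      - r * Complex.sinh (r * (((3 / 4 : ℝ) : ℂ) - (1 : ℝ))) * e2
  have h1 : (1 + m.ω * m.σ) * β₁ = 0 := key _ _ m.hs fun x hx => by
    have e1 := zu x hx
    have e2 := zy x hx
    simp only [uR, yR] at e1 e2
    linear_combination e2 + Complex.I * m.ω * e1
      + m.ω * m.σ * β₁ * modeSinh m.s 1 x * Complex.I_sq
  have h2 : (1 + m.ω * m.σ) * β₂ = 0 := key _ _ m.ht fun x hx => by
    have e1 := zu x hx
    have e2 := zy x hx
    simp only [uR, yR] at e1 e2
    linear_combination e1 + Complex.I * m.σ * e2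
      + m.ω * m.σ * β₂ * modeSinh m.t 1 x * Complex.I_sq
  rcases hβ with h | h
  · exact h (by simpa [m.hωσ] using h1)
  · exact h (by simpa [m.hωσ] using h2)

/-- A simple zero of the interface determinant is an eigenvalue of algebraic multiplicity one. -/
theorem isSimpleEigenvalue (hG : m.oscA * m.layerB + m.oscB * m.layerA = 0)
    (hG' : m.detDeriv ≠ 0) : IsSimpleEigenvalue (localGenerator c) μ := by
  obtain ⟨β₁, β₂, hβ, k1, k2, huniq⟩ := m.exists_kernel hG hG'
  obtain ⟨α₁, α₂, hT⟩ := m.exists_transmission k1 k2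
  obtain ⟨U, hU, hAU⟩ := (LinearPMap.mem_graph_iff _).1
    (mem_graph_generator.2 (m.isGeneratorPair_vec hT))
  dsimp only at hU hAU
  -- the kernel
  have kernel : ∀ W : (localGenerator c).domain,
      localGenerator c W - μ • (W : EnergySpace 1) = 0 →
      ∃ (a₁ a₂ b₁ b₂ : ℂ) (f Pf h Yh : ℝ → ℂ), m.Transmission a₁ a₂ b₁ b₂ ∧
        m.Represents a₁ a₂ b₁ b₂ f Pf h Yh ∧ ContinuousOn f (Icc 0 1) ∧ ContinuousOn Pf (Icc 0 1) ∧
        ContinuousOn h (Icc 0 1) ∧ (W.1.1 : L2 1) =ᵐ[intervalMeasure 1] f ∧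
        (W.1.2.2.1 : L2 1) =ᵐ[intervalMeasure 1] h ∧ W.1.2.1 = μ • (W.1.1 : L2 1) ∧
        W.1.2.2.2 = μ • (W.1.2.2.1 : L2 1) ∧ ∃ fx : L2 1, HasWeakDeriv (W.1.1 : L2 1) fx ∧
          ∀ᵐ x ∂(volume.restrict (Ioo (1 / 2) 1)), fx x = Pf x / (1 + μ) := by
    intro W hW
    have hp : IsGeneratorPair 1 1 localDamping (fun _ => c) W.1 (μ • W.1 + 0) := by
      rw [add_zero, ← sub_eq_zero.1 hW]
      exact mem_graph_generator.1 (LinearPMap.mem_graph _ W)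
    -- The eigenvalue equation is the chain equation with zero right-hand side.
    obtain ⟨f, Pf, h, Yh, ⟨c1, c2, c3, c4⟩, ⟨e1, e2, e3, e4⟩, bc, d1, d2, d3, fx, hfx, efx⟩ :=
      hp.exists_classical m.hμ (f := 0) (h := 0) (Df := 0) (fx := 0)
      continuousOn_const continuousOn_const (Lp.coeFn_zero _ _ _) (Lp.coeFn_zero _ _ _)
      (by simp) (by simp) HasWeakDeriv.zero
      (ae_mono (Measure.restrict_mono (Ioo_subset_Ioo_left (by norm_num)) le_rfl)
        (Lp.coeFn_zero ℂ 2 (intervalMeasure 1))) continuousOn_const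
    simp only [Pi.zero_apply, sub_zero, mul_zero, add_zero] at d2 d3 efx
    obtain ⟨a₁, a₂, b₁, b₂, hrep, htr⟩ := m.exists_represents c1 c2 c3 c4 bc d1 d2 d3
    exact ⟨a₁, a₂, b₁, b₂, f, Pf, h, Yh, htr, hrep, c1, c2, c3, e1, e2, by simpa using e3,
      by simpa using e4, fx, hfx, efx⟩
  refine ⟨U, by rw [hU]; exact m.vec_ne_zero hT hβ, hAU.trans (by rw [hU]), ?_⟩
  intro V W hVW hW
  obtain ⟨a₁, a₂, b₁, b₂, f, Pf, h, Yh, htr, hrep, cf, cPf, ch, ef, eh, ew1, ew2, fx, hfx, efx⟩ :=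
    kernel W hW
  have hp : IsGeneratorPair 1 1 localDamping (fun _ => c) V.1 (μ • V.1 + W.1) := by
    rw [← hVW, add_sub_cancel]
    exact mem_graph_generator.1 (LinearPMap.mem_graph _ V)
  obtain ⟨u, P, y, Y, ⟨c1, c2, c3, c4⟩, -, bc, d1, d2, d3, -⟩ :=
    hp.exists_classical m.hμ cf ch ef eh ew1 ew2 hfx efx
      ((cPf.mono (Ioo_subset_Icc_self.trans (Icc_subset_Icc_left (by norm_num)))).div_const _)
  obtain ⟨b₁', b₂', g1, g2⟩ := m.exists_chain htr hrep c1 c2 c3 c4 bc d1 d2 d3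
  obtain ⟨rfl, rfl⟩ := m.eq_zero_of_chain hG hG' htr.kernel.1 htr.kernel.2 g1 g2
  -- The right coefficients of W vanish, hence are 0 times those of the eigenvector, and the left
  -- coefficients are then 0 times theirs.
  have ha := hT.eq_smul (k := 0) (by simpa using htr)
  rw [zero_mul, zero_mul] at ha
  obtain ⟨rfl, rfl⟩ := ha
  -- the generalized kernel coincides with the kernel
  have W0 : (W : EnergySpace 1) = 0 := by
    have z : ∀ x ∈ Icc (0:ℝ) 1, f x = 0 ∧ h x = 0 := by
      intro x hx
      rcases le_total x (1 / 2) with hx' | hx'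
      · obtain ⟨q1, -, q3, -⟩ := hrep.1 x ⟨hx.1, hx'⟩
        rw [q1, q3]; simp [uL, yL]
      · obtain ⟨q1, -, q3, -⟩ := hrep.2 x ⟨hx', hx.2⟩
        rw [q1, q3]; simp [uR, yR]
    have w1 : (W.1.1 : L2 1) = 0 := by
      rw [Lp.eq_zero_iff_ae_eq_zero]
      filter_upwards [ef, ae_restrict_mem measurableSet_Ioo] with x hx hx'
      rw [hx, (z x (Ioo_subset_Icc_self hx')).1]; rfl
    have w2 : (W.1.2.2.1 : L2 1) = 0 := by
      rw [Lp.eq_zero_iff_ae_eq_zero]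
      filter_upwards [eh, ae_restrict_mem measurableSet_Ioo] with x hx hx'
      rw [hx, (z x (Ioo_subset_Icc_self hx')).2]; rfl
    refine Prod.ext (Subtype.ext w1) (Prod.ext ?_ (Prod.ext (Subtype.ext w2) ?_))
    · rw [ew1, w1, smul_zero]; rfl
    · rw [ew2, w2, smul_zero]; rfl
  rw [W0] at hVW
  obtain ⟨a₁, a₂, b₁, b₂, f, Pf, h, Yh, htr, hrep, cf, cPf, ch, ef, eh, ew1, ew2, -⟩ :=
    kernel V hVW
  obtain ⟨k, rfl, rfl⟩ := huniq b₁ b₂ htr.kernel.1 htr.kernel.2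
  obtain ⟨rfl, rfl⟩ := hT.eq_smul htr
  refine ⟨k, ?_⟩
  rw [hU]
  have v1 : (V.1.1 : L2 1) = k • ((m.vec hT).1 : L2 1) := by
    refine Lp.ext ?_
    filter_upwards [ef, Lp.coeFn_smul k ((m.vec hT).1 : L2 1),
      coeFn_glueL2 (m.continuous_uL α₁ α₂) (m.continuous_uR β₁ β₂),
      ae_restrict_mem measurableSet_Ioo] with x q1 q2 q3 hx
    rw [q1, q2, Pi.smul_apply]
    change f x = k • glueL2 (m.continuous_uL α₁ α₂) (m.continuous_uR β₁ β₂) x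
    rw [q3]
    by_cases hx' : x ≤ 1 / 2
    · rw [(hrep.1 x ⟨hx.1.le, hx'⟩).1]
      simp only [glue, if_pos hx', uL, smul_eq_mul]; ring
    · rw [(hrep.2 x ⟨(not_le.1 hx').le, hx.2.le⟩).1]
      simp only [glue, if_neg hx', uR, smul_eq_mul]; ring
  have v2 : (V.1.2.2.1 : L2 1) = k • ((m.vec hT).2.2.1 : L2 1) := by
    refine Lp.ext ?_
    filter_upwards [eh, Lp.coeFn_smul k ((m.vec hT).2.2.1 : L2 1),
      coeFn_glueL2 (m.continuous_yL α₁ α₂) (m.continuous_yR β₁ β₂),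
      ae_restrict_mem measurableSet_Ioo] with x q1 q2 q3 hx
    rw [q1, q2, Pi.smul_apply]
    change h x = k • glueL2 (m.continuous_yL α₁ α₂) (m.continuous_yR β₁ β₂) x
    rw [q3]
    by_cases hx' : x ≤ 1 / 2
    · rw [(hrep.1 x ⟨hx.1.le, hx'⟩).2.2.1]
      simp only [glue, if_pos hx', yL, smul_eq_mul]; ring
    · rw [(hrep.2 x ⟨(not_le.1 hx').le, hx.2.le⟩).2.2.1]
      simp only [glue, if_neg hx', yR, smul_eq_mul]; ring
  refine Prod.ext (Subtype.ext v1) (Prod.ext ?_ (Prod.ext (Subtype.ext v2) ?_))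
  · rw [ew1, v1, smul_comm]; rfl
  · rw [ew2, v2, smul_comm]; rfl

end ModeData

open Filter Asymptotics Topology

/-! ### The principal square root -/

theorem csqrt_sq (z : ℂ) : csqrt z ^ 2 = z := by
  rw [csqrt, ← Complex.cpow_nat_mul]; norm_num

theorem csqrt_one : csqrt 1 = 1 := by simp [csqrt]

theorem csqrt_ne_zero {z : ℂ} (hz : z ≠ 0) : csqrt z ≠ 0 := fun h => hz (by
  rw [← csqrt_sq z, h]; simp)

theorem differentiableAt_csqrt {z : ℂ} (hz : z ∈ Complex.slitPlane) :
    DifferentiableAt ℂ csqrt z := by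
  unfold csqrt
  exact differentiableAt_id.cpow_const hz

theorem DifferentiableAt.csqrt {f : ℂ → ℂ} {z : ℂ} (hf : DifferentiableAt ℂ f z)
    (hz : f z ∈ Complex.slitPlane) : DifferentiableAt ℂ (fun z => csqrt (f z)) z :=
  (differentiableAt_csqrt hz).comp z hf

theorem csqrt_re_nonneg (z : ℂ) : 0 ≤ (csqrt z).re := by
  by_cases hz : z = 0
  · simp [csqrt, hz]
  · rw [csqrt, Complex.cpow_def_of_ne_zero hz, Complex.exp_re]
    refine mul_nonneg (Real.exp_pos _).le (Real.cos_nonneg_of_mem_Icc ?_)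
    have h : (Complex.log z * (1 / 2)).im = z.arg / 2 := by
      rw [show (1 / 2 : ℂ) = ((1 / 2 : ℝ) : ℂ) by push_cast; rfl, Complex.im_mul_ofReal,
        Complex.log_im]
      ring
    rw [h]
    constructor
    · linarith [Complex.neg_pi_lt_arg z]
    · linarith [Complex.arg_le_pi z]

theorem norm_csqrt_sq (z : ℂ) : ‖csqrt z‖ ^ 2 = ‖z‖ := by
  rw [← norm_pow, csqrt_sq]

/-- `(Re √z)² = (|z| + Re z) / 2`. -/
theorem csqrt_re_sq (z : ℂ) : (csqrt z).re ^ 2 = (‖z‖ + z.re) / 2 := by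
  have h1 := norm_csqrt_sq z
  rw [Complex.sq_norm, Complex.normSq_apply] at h1
  have h2 := congrArg Complex.re (csqrt_sq z)
  rw [pow_two, Complex.mul_re] at h2
  linarith

theorem tendsto_csqrt_one {l : Filter ℂ} {f : ℂ → ℂ} (hf : Tendsto f l (𝓝 1)) :
    Tendsto (fun z => csqrt (f z)) l (𝓝 1) := by
  have := ((differentiableAt_csqrt (z := 1) (by simp)).continuousAt.tendsto).comp hf
  rwa [csqrt_one] at this

theorem eventually_mem_slitPlane {l : Filter ℂ} {f : ℂ → ℂ} (hf : Tendsto f l (𝓝 1)) :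
    ∀ᶠ z in l, f z ∈ Complex.slitPlane :=
  hf.eventually (Complex.isOpen_slitPlane.mem_nhds (by simp))

/-! ### Vertical strips -/

/-- The filter of `|Im z| → ∞` in the strip `|Re z| ≤ r`. -/
def stripFilter (r : ℝ) : Filter ℂ := comap (fun z : ℂ => |z.im|) atTop ⊓ 𝓟 {z | |z.re| ≤ r}

theorem eventually_stripFilter {r : ℝ} {P : ℂ → Prop} :
    (∀ᶠ z in stripFilter r, P z) ↔ ∃ R : ℝ, ∀ z : ℂ, R ≤ |z.im| → |z.re| ≤ r → P z := by
  rw [stripFilter, eventually_inf_principal, eventually_comap, eventually_atTop]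
  constructor
  · rintro ⟨R, h⟩
    exact ⟨R, fun z h1 h2 => h _ h1 z rfl h2⟩
  · rintro ⟨R, h⟩
    exact ⟨R, fun b hb z hz h2 => h z (by rw [hz]; exact hb) h2⟩

/-- Eventual statements in a strip hold uniformly near the points of a smaller strip. -/
theorem eventually_stripFilter_forall_closedBall {r d : ℝ} {P : ℂ → Prop}
    (h : ∀ᶠ z in stripFilter (r + d), P z) :
    ∀ᶠ z in stripFilter r, ∀ w ∈ Metric.closedBall z d, P w := by
  obtain ⟨R, hR⟩ := eventually_stripFilter.1 h
  refine eventually_stripFilter.2 ⟨R + d, fun z h1 h2 w hw => ?_⟩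
  have hwz : ‖w - z‖ ≤ d := by rwa [← dist_eq_norm]
  have i1 : |w.im - z.im| ≤ d := (Complex.abs_im_le_norm (w - z)).trans hwz
  have i2 : |w.re - z.re| ≤ d := (Complex.abs_re_le_norm (w - z)).trans hwz
  refine hR w ?_ ?_
  · have := abs_sub_abs_le_abs_sub z.im w.im
    rw [abs_sub_comm] at this
    linarith
  · have := abs_sub_abs_le_abs_sub w.re z.re
    linarith

theorem tendsto_norm_stripFilter (r : ℝ) : Tendsto (fun z : ℂ => ‖z‖) (stripFilter r) atTop := by
  refine tendsto_atTop.2 fun b => eventually_stripFilter.2 ⟨b, fun z h _ => h.trans ?_⟩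
  exact Complex.abs_im_le_norm z

theorem eventually_ne_zero_strip (r : ℝ) : ∀ᶠ z in stripFilter r, z ≠ 0 := by
  filter_upwards [(tendsto_norm_stripFilter r).eventually_gt_atTop 0] with z hz
  exact norm_pos_iff.1 hz

theorem eventually_slitPlane_strip (r : ℝ) : ∀ᶠ z in stripFilter r, z ∈ Complex.slitPlane := by
  refine eventually_stripFilter.2 ⟨1, fun z h _ => Or.inr ?_⟩
  intro h0
  rw [h0, abs_zero] at h
  linarith

/-! ### Expansions in powers of `1 / √z` -/

/-- The inverse of the principal square root. -/
noncomputable def invSqrt (z : ℂ) : ℂ := (csqrt z)⁻¹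

theorem invSqrt_sq (z : ℂ) : invSqrt z ^ 2 = z⁻¹ := by rw [invSqrt, inv_pow, csqrt_sq]

theorem tendsto_invSqrt (r : ℝ) : Tendsto invSqrt (stripFilter r) (𝓝 0) := by
  rw [tendsto_zero_iff_norm_tendsto_zero]
  have : Tendsto (fun z : ℂ => √‖z‖) (stripFilter r) atTop :=
    Real.tendsto_sqrt_atTop.comp (tendsto_norm_stripFilter r)
  refine this.inv_tendsto_atTop.congr fun z => ?_
  rw [invSqrt, norm_inv, Pi.inv_apply, ← norm_csqrt_sq, Real.sqrt_sq (norm_nonneg _)]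

theorem invSqrt_isBigO_one (r : ℝ) : invSqrt =O[stripFilter r] (fun _ => (1 : ℂ)) :=
  (tendsto_invSqrt r).isBigO_one ℂ

/-- `f = g + O(z^{-k/2})` along a strip, both functions being bounded. -/
structure StripApprox (r : ℝ) (k : ℕ) (f g : ℂ → ℂ) : Prop where
  sub : (fun z => f z - g z) =O[stripFilter r] fun z => invSqrt z ^ k
  left : f =O[stripFilter r] fun _ => (1 : ℂ)

theorem invSqrt_pow_isBigO {r : ℝ} {m n : ℕ} (h : m ≤ n) :
    (fun z => invSqrt z ^ n) =O[stripFilter r] fun z => invSqrt z ^ m := by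
  obtain ⟨k, rfl⟩ := Nat.exists_eq_add_of_le h
  have := (isBigO_refl (fun z => invSqrt z ^ m) (stripFilter r)).mul
    ((invSqrt_isBigO_one r).pow k)
  simpa [pow_add] using this

namespace StripApprox
variable {r : ℝ} {k : ℕ} {f g f₁ g₁ f₂ g₂ : ℂ → ℂ}

theorem right (h : StripApprox r k f g) : g =O[stripFilter r] fun _ => (1 : ℂ) := by
  have := h.left.sub (h.sub.trans ((invSqrt_pow_isBigO (Nat.zero_le k)).trans (by simp [isBigO_refl])))
  simpa using this

theorem refl (h : f =O[stripFilter r] fun _ => (1 : ℂ)) : StripApprox r k f f :=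
  ⟨by simpa using isBigO_zero _ _, h⟩

theorem const (a : ℂ) : StripApprox r k (fun _ => a) fun _ => a :=
  refl (isBigO_const_const _ one_ne_zero _)

theorem add (h₁ : StripApprox r k f₁ g₁) (h₂ : StripApprox r k f₂ g₂) :
    StripApprox r k (fun z => f₁ z + f₂ z) fun z => g₁ z + g₂ z :=
  ⟨(h₁.sub.add h₂.sub).congr_left fun z => by ring, h₁.left.add h₂.left⟩

theorem neg (h₁ : StripApprox r k f₁ g₁) : StripApprox r k (fun z => -f₁ z) fun z => -g₁ z :=
  ⟨h₁.sub.neg_left.congr_left fun z => by ring, h₁.left.neg_left⟩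

theorem mul (h₁ : StripApprox r k f₁ g₁) (h₂ : StripApprox r k f₂ g₂) :
    StripApprox r k (fun z => f₁ z * f₂ z) fun z => g₁ z * g₂ z := by
  refine ⟨?_, by simpa using h₁.left.mul h₂.left⟩
  have e1 := h₁.left.mul h₂.sub
  have e2 := h₁.sub.mul h₂.right
  simp only [one_mul, mul_one] at e1 e2
  exact (e1.add e2).congr_left fun z => by ring

theorem of_sub (h : (fun z => f z - g z) =O[stripFilter r] fun z => invSqrt z ^ k)
    (hg : g =O[stripFilter r] fun _ => (1 : ℂ)) : StripApprox r k f g :=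
  ⟨h, by
    have := (h.trans ((invSqrt_pow_isBigO (Nat.zero_le k)).trans (by simp [isBigO_refl]))).add hg
    simpa using this⟩

theorem congr (h : StripApprox r k f g) (hf : f =ᶠ[stripFilter r] f₁)
    (hg : g =ᶠ[stripFilter r] g₁) : StripApprox r k f₁ g₁ :=
  ⟨h.sub.congr' (hf.sub hg) EventuallyEq.rfl, h.left.congr' hf EventuallyEq.rfl⟩

end StripApprox

theorem tendsto_of_sub_isBigO {r : ℝ} {k : ℕ} {f g : ℂ → ℂ} {a : ℂ} (hk : k ≠ 0)
    (h : (fun z => f z - g z) =O[stripFilter r] fun z => invSqrt z ^ k)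
    (hg : Tendsto g (stripFilter r) (𝓝 a)) : Tendsto f (stripFilter r) (𝓝 a) := by
  have h0 : Tendsto (fun z => invSqrt z ^ k) (stripFilter r) (𝓝 0) := by
    simpa [hk] using (tendsto_invSqrt r).pow k
  simpa using (h.trans_tendsto h0).add hg

/-- Two functions tending to `1` are as close as their squares. -/
theorem isBigO_sub_of_sq {l : Filter ℂ} {x y g : ℂ → ℂ} (hx : Tendsto x l (𝓝 1))
    (hy : Tendsto y l (𝓝 1)) (h : (fun z => x z ^ 2 - y z ^ 2) =O[l] g) :
    (fun z => x z - y z) =O[l] g := by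
  have hs : Tendsto (fun z => (x z + y z)⁻¹) l (𝓝 (1 + 1)⁻¹) :=
    (hx.add hy).inv₀ (by norm_num)
  have h1 := h.mul (hs.isBigO_one ℂ)
  simp only [mul_one] at h1
  refine h1.congr' ?_ EventuallyEq.rfl
  have hne : ∀ᶠ z in l, x z + y z ≠ 0 := (hx.add hy).eventually_ne (by norm_num)
  filter_upwards [hne] with z hz
  field_simp
  ring

theorem tendsto_inv_strip (r : ℝ) : Tendsto (fun z : ℂ => z⁻¹) (stripFilter r) (𝓝 0) := by
  have := (tendsto_invSqrt r).pow 2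
  simpa [invSqrt_sq] using this

/-- A bound for functions `C z^{-k/2}` times bounded functions. -/
theorem isBigO_mul_invSqrt {r : ℝ} (k : ℕ) {f : ℂ → ℂ} (hf : f =O[stripFilter r] fun _ => (1 : ℂ)) :
    (fun z => f z * invSqrt z ^ k) =O[stripFilter r] fun z => invSqrt z ^ k := by
  simpa using hf.mul (isBigO_refl (fun z => invSqrt z ^ k) (stripFilter r))

/-! ### Expansions of the mode parameters -/

/-- The small root σ of ic(1 + z)σ² + z²σ = ic, in rationalized form: there is no division by c and
no cancellation in 1 + Δ, so it stays meaningful for c = 0. -/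
noncomputable def charSigma (c : ℝ) (z : ℂ) : ℂ := 2 * Complex.I * c / (z ^ 2 * (1 + charDelta c z))

noncomputable def charOmega (c : ℝ) (z : ℂ) : ℂ := (1 + z) * charSigma c z

/-- The square root in `charR₁`. -/
noncomputable def rootA (c : ℝ) (z : ℂ) : ℂ := csqrt (1 + Complex.I * c / z)

/-- The square root in `charS₁`. -/
noncomputable def rootS (c : ℝ) (z : ℂ) : ℂ :=
  csqrt ((1 + 2 / z + charDelta c z) / (2 * (1 + 1 / z)))

/-- The second square root in `charS₂`. -/
noncomputable def rootT (c : ℝ) (z : ℂ) : ℂ :=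
  csqrt ((z + 2 - z * charDelta c z) / (2 * (1 + 1 / z)))

theorem charR₁_eq (c : ℝ) (z : ℂ) : charR₁ c z = z * rootA c z := rfl
theorem charS₁_eq (c : ℝ) (z : ℂ) : charS₁ c z = z * rootS c z := rfl
theorem charS₂_eq (c : ℝ) (z : ℂ) : charS₂ c z = csqrt z * rootT c z := rfl

/-- Exchanging u - iy and u + iy amounts to c ↦ -c. Every estimate for the second left mode follows
from the first by this symmetry, under which s₁ and s₂ are even while σ and ω are odd. -/
theorem charR₂_eq (c : ℝ) (z : ℂ) : charR₂ c z = charR₁ (-c) z := by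
  simp [charR₂, charR₁, sub_eq_add_neg, neg_div]

theorem charDelta_neg (c : ℝ) (z : ℂ) : charDelta (-c) z = charDelta c z := by simp [charDelta]
theorem charS₁_neg (c : ℝ) (z : ℂ) : charS₁ (-c) z = charS₁ c z := by
  simp [charS₁, charDelta_neg]
theorem charS₂_neg (c : ℝ) (z : ℂ) : charS₂ (-c) z = charS₂ c z := by
  simp [charS₂, charDelta_neg]
theorem charSigma_neg (c : ℝ) (z : ℂ) : charSigma (-c) z = -charSigma c z := by
  simp [charSigma, charDelta_neg, neg_div]
theorem charOmega_neg (c : ℝ) (z : ℂ) : charOmega (-c) z = -charOmega c z := by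
  simp [charOmega, charSigma_neg]

theorem charDelta_sq (c : ℝ) (z : ℂ) :
    charDelta c z ^ 2 = 1 - 4 * c ^ 2 / z ^ 3 - 4 * c ^ 2 / z ^ 4 := csqrt_sq _

section Expansion
variable (c : ℝ) (r : ℝ)

theorem charDelta_arg_isBigO :
    (fun z : ℂ => (1 - 4 * c ^ 2 / z ^ 3 - 4 * c ^ 2 / z ^ 4) - 1 ^ 2)
      =O[stripFilter r] fun z => invSqrt z ^ 6 := by
  have h : (fun z : ℂ => -(4 * (c:ℂ) ^ 2) * (1 + invSqrt z ^ 2)) =O[stripFilter r]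
      fun _ => (1 : ℂ) := by
    have := ((tendsto_invSqrt r).pow 2).const_add 1 |>.const_mul (-(4 * (c:ℂ) ^ 2))
    exact this.isBigO_one ℂ
  refine (isBigO_mul_invSqrt 6 h).congr_left fun z => ?_
  rw [show invSqrt z ^ 6 = (invSqrt z ^ 2) ^ 3 by ring, invSqrt_sq]
  simp only [div_eq_mul_inv]
  rw [← inv_pow, ← inv_pow]
  ring

theorem tendsto_charDelta : Tendsto (charDelta c) (stripFilter r) (𝓝 1) :=
  tendsto_csqrt_one (tendsto_of_sub_isBigO (by norm_num)
    ((charDelta_arg_isBigO c r).congr_left fun z => by rw [one_pow]) tendsto_const_nhds)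

theorem charDelta_sub_one : (fun z => charDelta c z - 1) =O[stripFilter r] fun z => invSqrt z ^ 6 :=
  isBigO_sub_of_sq (tendsto_charDelta c r) tendsto_const_nhds
    ((charDelta_arg_isBigO c r).congr_left fun z => by rw [charDelta_sq])

theorem eventually_one_add_charDelta : ∀ᶠ z in stripFilter r, 1 + charDelta c z ≠ 0 :=
  ((tendsto_charDelta c r).const_add 1).eventually_ne (by norm_num)

theorem charSigma_sub : (fun z => charSigma c z - Complex.I * c * invSqrt z ^ 4)
    =O[stripFilter r] fun z => invSqrt z ^ 10 := by
  have h1 : Tendsto (fun z => (1 + charDelta c z)⁻¹) (stripFilter r) (𝓝 (1 + 1)⁻¹) :=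
    ((tendsto_charDelta c r).const_add 1).inv₀ (by norm_num)
  have h2 := ((((charDelta_sub_one c r).mul (h1.isBigO_one ℂ)).mul
    (isBigO_refl (fun z => invSqrt z ^ 4) _)).const_mul_left (-(Complex.I * c)))
  refine h2.congr' ?_ (Eventually.of_forall fun z => by ring)
  filter_upwards [eventually_one_add_charDelta c r, eventually_ne_zero_strip r] with z hz hz0
  rw [charSigma, show invSqrt z ^ 4 = (invSqrt z ^ 2) ^ 2 by ring, invSqrt_sq]
  field_simp
  ring

theorem charOmega_sub : (fun z => charOmega c z - Complex.I * c * invSqrt z ^ 2)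
    =O[stripFilter r] fun z => invSqrt z ^ 4 := by
  have h1 : (fun z : ℂ => Complex.I * c * invSqrt z ^ 4) =O[stripFilter r]
      fun z => invSqrt z ^ 4 := (isBigO_refl _ _).const_mul_left _
  have h2 : (fun z : ℂ => (invSqrt z ^ 2 + 1) * invSqrt z ^ 8) =O[stripFilter r]
      fun z => invSqrt z ^ 8 :=
    isBigO_mul_invSqrt 8 ((((tendsto_invSqrt r).pow 2).add_const 1).isBigO_one ℂ)
  have h3 : (fun z => (charSigma c z - Complex.I * c * invSqrt z ^ 4) * (1 + z)) =O[stripFilter r]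
      fun z => invSqrt z ^ 8 := by
    have := (charSigma_sub c r).mul (isBigO_refl (fun z : ℂ => 1 + z) (stripFilter r))
    refine this.trans (h2.congr' ?_ EventuallyEq.rfl)
    filter_upwards [eventually_ne_zero_strip r] with z hz
    rw [show invSqrt z ^ 8 = (invSqrt z ^ 2) ^ 4 by ring,
      show invSqrt z ^ 10 = (invSqrt z ^ 2) ^ 5 by ring, invSqrt_sq]
    field_simp
  refine ((h3.trans (invSqrt_pow_isBigO (by norm_num))).add h1).congr' ?_ EventuallyEq.rfl
  filter_upwards [eventually_ne_zero_strip r] with z hz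
  rw [charOmega, show invSqrt z ^ 4 = (invSqrt z ^ 2) ^ 2 by ring, invSqrt_sq]
  field_simp
  ring

/-- The Taylor polynomial of the square root. -/
noncomputable def rootPoly (w : ℂ) : ℂ := 1 + w / 2 - w ^ 2 / 8 + w ^ 3 / 16

theorem tendsto_rootA : Tendsto (rootA c) (stripFilter r) (𝓝 1) := by
  refine tendsto_csqrt_one ?_
  simpa [div_eq_mul_inv] using ((tendsto_inv_strip r).const_mul (Complex.I * c)).const_add 1

theorem rootA_sub : (fun z => rootA c z - rootPoly (Complex.I * c * invSqrt z ^ 2))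
    =O[stripFilter r] fun z => invSqrt z ^ 8 := by
  have hp : Tendsto (fun z => Complex.I * c * invSqrt z ^ 2) (stripFilter r) (𝓝 0) := by
    simpa using ((tendsto_invSqrt r).pow 2).const_mul (Complex.I * c)
  have hq : ∀ f : ℂ → ℂ, Continuous f → Tendsto (fun z => f (Complex.I * c * invSqrt z ^ 2))
      (stripFilter r) (𝓝 (f 0)) := fun f hf => (hf.tendsto 0).comp hp
  refine isBigO_sub_of_sq (tendsto_rootA c r) ?_ ?_
  · have := hq rootPoly (by unfold rootPoly; fun_prop)
    simpa [rootPoly] using this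
  -- The square of the Taylor polynomial is 1 + w + w⁴(5/64 - w/64 + w²/256); with w = ic/z the
  -- remainder has order z^(-4).
  · have h := (hq (fun w => -(Complex.I * c) ^ 4 * (5 / 64 - w / 64 + w ^ 2 / 256))
      (by fun_prop)).isBigO_one ℂ
    refine (isBigO_mul_invSqrt 8 h).congr_left fun z => ?_
    rw [rootA, csqrt_sq, div_eq_mul_inv _ z, ← invSqrt_sq z]
    simp only [rootPoly]
    ring

end Expansion

/-- The algebraic conditions on `z` under which the mode parameters are analytic. -/
structure CharGood (c : ℝ) (z : ℂ) : Prop where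
  ne_zero : z ≠ 0
  one_add : 1 + z ≠ 0
  slit : z ∈ Complex.slitPlane
  delta : 1 - 4 * (c:ℂ) ^ 2 / z ^ 3 - 4 * c ^ 2 / z ^ 4 ∈ Complex.slitPlane
  one_add_delta : 1 + charDelta c z ≠ 0
  argA : 1 + Complex.I * c / z ∈ Complex.slitPlane
  argB : 1 - Complex.I * c / z ∈ Complex.slitPlane
  argS : (1 + 2 / z + charDelta c z) / (2 * (1 + 1 / z)) ∈ Complex.slitPlane
  argT : (z + 2 - z * charDelta c z) / (2 * (1 + 1 / z)) ∈ Complex.slitPlane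
  cosh_ne : Complex.cosh (charS₂ c z / 2) ≠ 0
  det_ne : 1 + charOmega c z * charSigma c z ≠ 0

/-! ### Dispersion relations and analyticity of the closed formulas -/

section Relations
variable {c : ℝ} {z : ℂ}

theorem CharGood.delta_rel (h : CharGood c z) :
    z ^ 4 * (1 - charDelta c z ^ 2) = 4 * c ^ 2 * (1 + z) := by
  rw [charDelta_sq]
  have := h.ne_zero
  field_simp
  ring

theorem CharGood.sigma_rel (h : CharGood c z) :
    z ^ 2 * (1 + charDelta c z) * charSigma c z = 2 * Complex.I * c := by
  have h1 := h.ne_zero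
  have h2 := h.one_add_delta
  rw [charSigma]
  field_simp

/-- Eliminating the exponent from the two equations of the oscillating mode leaves this quadratic
equation for σ; the square of Δ is its discriminant divided by z⁴. -/
theorem CharGood.quadratic (h : CharGood c z) :
    Complex.I * c * charSigma c z * charOmega c z + z ^ 2 * charSigma c z = Complex.I * c := by
  have h1 := h.ne_zero
  have h2 := h.one_add_delta
  have h3 := h.delta_rel
  have h4 := h.sigma_rel
  rw [charOmega]
  have hk : z ^ 4 * (1 + charDelta c z) ^ 2 ≠ 0 := by positivity
  refine mul_left_cancel₀ hk ?_
  linear_combination (Complex.I * c * (1 + z) * (z ^ 2 * (1 + charDelta c z) * charSigma c z +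
    2 * Complex.I * c) + z ^ 4 * (1 + charDelta c z)) * h4 +
    Complex.I * c * h3 + 4 * c ^ 3 * Complex.I * (1 + z) * Complex.I_sq

theorem CharGood.inv_one_add (h : CharGood c z) : 1 + 1 / z ≠ 0 := by
  have h1 := h.ne_zero
  have h2 := h.one_add
  rw [show 1 + 1 / z = (1 + z) / z by field_simp; ring]
  exact div_ne_zero h2 h1

/-- This trades Δ for σ, so that the closed formula for s₁ becomes the dispersion relation of the
oscillating mode. The same is done for s₂ in `CharGood.rootT_sq`. -/
theorem CharGood.rootS_sq (h : CharGood c z) :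
    rootS c z ^ 2 = 1 + Complex.I * c * charSigma c z / z := by
  rw [rootS, csqrt_sq]
  have h1 := h.ne_zero
  have h2 := h.one_add_delta
  have h3 := h.delta_rel
  have h4 := h.sigma_rel
  have h5 := h.inv_one_add
  have h6 := h.one_add
  rw [show 1 + 1 / z = (1 + z) / z by field_simp; ring]
  field_simp
  refine mul_left_cancel₀ (mul_ne_zero (pow_ne_zero 3 h1) h2) ?_
  linear_combination (-2 * Complex.I * c * z * (1 + z)) * h4 - z * h3
    - 4 * c ^ 2 * z * (1 + z) * Complex.I_sq

theorem CharGood.rootT_sq (h : CharGood c z) :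
    rootT c z ^ 2 * (1 + z) = z - Complex.I * c * charOmega c z := by
  rw [rootT, csqrt_sq, charOmega]
  have h1 := h.ne_zero
  have h2 := h.one_add_delta
  have h3 := h.delta_rel
  have h4 := h.sigma_rel
  have h6 := h.one_add
  rw [show 1 + 1 / z = (1 + z) / z by field_simp; ring]
  field_simp
  refine mul_left_cancel₀ (mul_ne_zero (pow_ne_zero 2 h1) h2) ?_
  linear_combination (2 * Complex.I * c * (1 + z)) * h4 + h3
    + 4 * c ^ 2 * (1 + z) * Complex.I_sq

theorem CharGood.ea (h : CharGood c z) : charR₁ c z ^ 2 = z ^ 2 + Complex.I * c * z := by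
  have h1 := h.ne_zero
  rw [charR₁_eq, mul_pow, rootA, csqrt_sq]
  field_simp

theorem CharGood.eb (h : CharGood c z) : charR₁ (-c) z ^ 2 = z ^ 2 - Complex.I * c * z := by
  have h1 := h.ne_zero
  rw [charR₁_eq, mul_pow, rootA, csqrt_sq]
  push_cast
  field_simp
  ring

theorem CharGood.es (h : CharGood c z) :
    charS₁ c z ^ 2 = z ^ 2 + Complex.I * c * z * charSigma c z := by
  have h1 := h.ne_zero
  rw [charS₁_eq, mul_pow, h.rootS_sq]
  field_simp

theorem CharGood.es₂ (h : CharGood c z) :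
    (1 + z) * charSigma c z * charS₁ c z ^ 2 = z ^ 2 * charSigma c z + Complex.I * c * z := by
  have h1 := h.quadratic
  rw [charOmega] at h1
  rw [h.es]
  linear_combination z * h1

theorem CharGood.et (h : CharGood c z) :
    (1 + z) * charS₂ c z ^ 2 = z ^ 2 - Complex.I * c * z * charOmega c z := by
  rw [charS₂_eq, mul_pow, csqrt_sq]
  linear_combination z * h.rootT_sq

theorem CharGood.et₂ (h : CharGood c z) :
    charOmega c z * charS₂ c z ^ 2 = charOmega c z * z ^ 2 - Complex.I * c * z := by
  have h1 := h.quadratic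
  have h2 := h.et
  have h3 : charOmega c z * charS₂ c z ^ 2 =
      charSigma c z * ((1 + z) * charS₂ c z ^ 2) := by rw [charOmega]; ring
  rw [h3, h2]
  have h4 : charOmega c z * z ^ 2 = (1 + z) * charSigma c z * z ^ 2 := by rw [charOmega]
  rw [h4]
  linear_combination -z * h1

theorem CharGood.hb (h : CharGood c z) : charR₁ (-c) z ≠ 0 := by
  rw [← charR₂_eq]
  exact mul_ne_zero h.ne_zero (csqrt_ne_zero (Complex.slitPlane_ne_zero h.argB))

/-! ### Differentiability -/

theorem CharGood.differentiableAt_delta (h : CharGood c z) :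
    DifferentiableAt ℂ (charDelta c) z := by
  have h1 := h.ne_zero
  unfold charDelta
  refine DifferentiableAt.csqrt ?_ h.delta
  fun_prop (disch := positivity)

theorem CharGood.differentiableAt_R₁ (h : CharGood c z) : DifferentiableAt ℂ (charR₁ c) z := by
  have h1 := h.ne_zero
  unfold charR₁
  refine differentiableAt_id.mul (DifferentiableAt.csqrt ?_ h.argA)
  fun_prop (disch := positivity)

theorem CharGood.differentiableAt_R₁_neg (h : CharGood c z) :
    DifferentiableAt ℂ (charR₁ (-c)) z := by
  have h1 := h.ne_zero
  rw [show charR₁ (-c) = charR₂ c from funext fun z => (charR₂_eq c z).symm]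
  unfold charR₂
  refine differentiableAt_id.mul (DifferentiableAt.csqrt ?_ h.argB)
  fun_prop (disch := positivity)

theorem CharGood.differentiableAt_S₁ (h : CharGood c z) : DifferentiableAt ℂ (charS₁ c) z := by
  have h1 := h.ne_zero
  have h2 := h.inv_one_add
  have h3 := h.differentiableAt_delta
  unfold charS₁
  refine differentiableAt_id.mul (DifferentiableAt.csqrt ?_ h.argS)
  fun_prop (disch := first | assumption | simpa using h2)

theorem CharGood.differentiableAt_S₂ (h : CharGood c z) : DifferentiableAt ℂ (charS₂ c) z := by
  have h1 := h.ne_zero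
  have h2 := h.inv_one_add
  have h3 := h.differentiableAt_delta
  unfold charS₂
  refine (differentiableAt_csqrt h.slit).mul (DifferentiableAt.csqrt ?_ h.argT)
  fun_prop (disch := first | assumption | simpa using h2)

theorem CharGood.differentiableAt_sigma (h : CharGood c z) :
    DifferentiableAt ℂ (charSigma c) z := by
  have h1 := h.ne_zero
  have h2 := h.one_add_delta
  have h3 := h.differentiableAt_delta
  unfold charSigma
  fun_prop (disch := exact mul_ne_zero (pow_ne_zero _ h1) h2)

theorem CharGood.differentiableAt_omega (h : CharGood c z) :
    DifferentiableAt ℂ (charOmega c) z := by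
  have h3 := h.differentiableAt_sigma
  unfold charOmega
  fun_prop

end Relations

/-! ### The interface determinant as a function of the spectral parameter -/

noncomputable def oscFun (c : ℝ) (z : ℂ) : ℂ :=
  oscCoeff (charR₁ c z) (charS₁ c z) (charSigma c z) (charOmega c z)

noncomputable def layerFun (c : ℝ) (z : ℂ) : ℂ :=
  layerCoeff z (charR₁ c z) (charS₂ c z) (charSigma c z) (charOmega c z)

noncomputable def detFun (c : ℝ) (z : ℂ) : ℂ :=
  oscFun c z * layerFun (-c) z + oscFun (-c) z * layerFun c z

/-- The mode parameters at a good point. -/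
noncomputable def modeData {c : ℝ} {z : ℂ} (h : ∀ᶠ w in 𝓝 z, CharGood c w) : ModeData c z :=
  have h0 := h.self_of_nhds
  have da := h0.differentiableAt_R₁.hasDerivAt
  have db := h0.differentiableAt_R₁_neg.hasDerivAt
  have ds := h0.differentiableAt_S₁.hasDerivAt
  have dt := h0.differentiableAt_S₂.hasDerivAt
  have dσ := h0.differentiableAt_sigma.hasDerivAt
  have dω := h0.differentiableAt_omega.hasDerivAt
  have did := hasDerivAt_id z
  { a := charR₁ c z
    b := charR₁ (-c) z
    s := charS₁ c z
    t := charS₂ c z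
    σ := charSigma c z
    ω := charOmega c z
    a' := deriv (charR₁ c) z
    b' := deriv (charR₁ (-c)) z
    s' := deriv (charS₁ c) z
    t' := deriv (charS₂ c) z
    σ' := deriv (charSigma c) z
    ω' := deriv (charOmega c) z
    ha := mul_ne_zero h0.ne_zero (csqrt_ne_zero (Complex.slitPlane_ne_zero h0.argA))
    hb := h0.hb
    hs := mul_ne_zero h0.ne_zero (csqrt_ne_zero (Complex.slitPlane_ne_zero h0.argS))
    ht := mul_ne_zero (csqrt_ne_zero h0.ne_zero) (csqrt_ne_zero (Complex.slitPlane_ne_zero h0.argT))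
    hμ := h0.one_add
    hωσ := h0.det_ne
    eω := rfl
    ea := h0.ea
    eb := h0.eb
    es := h0.es
    es₂ := h0.es₂
    et := h0.et
    et₂ := h0.et₂
    eω' := by
      refine (dω.unique ((did.const_add 1).mul dσ)).trans ?_
      simp only [id]; ring
    ea' := by
      -- The relations between the derivatives come from uniqueness of the derivative, applied to
      -- relations that hold in a whole neighbourhood of z; goodness at z alone would not be enough.
      have e := ((da.pow 2).congr_of_eventuallyEq (h.mono fun w hw => hw.ea.symm)).unique
        ((did.pow 2).add (did.const_mul (Complex.I * c)))
      simp only [id] at e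
      linear_combination e
    eb' := by
      have e := ((db.pow 2).congr_of_eventuallyEq (h.mono fun w hw => hw.eb.symm)).unique
        ((did.pow 2).sub (did.const_mul (Complex.I * c)))
      simp only [id] at e
      linear_combination e
    es' := by
      have e := ((ds.pow 2).congr_of_eventuallyEq (h.mono fun w hw => hw.es.symm)).unique
        ((did.pow 2).add ((did.const_mul (Complex.I * c)).mul dσ))
      simp only [id] at e
      linear_combination e
    es₂' := by
      have e := ((((did.const_add 1).mul dσ).mul (ds.pow 2)).congr_of_eventuallyEq
        (h.mono fun w hw => hw.es₂.symm)).unique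
        (((did.pow 2).mul dσ).add (did.const_mul (Complex.I * c)))
      simp only [id, Pi.mul_apply, Pi.pow_apply] at e
      linear_combination e
    et' := by
      have e := (((did.const_add 1).mul (dt.pow 2)).congr_of_eventuallyEq
        (h.mono fun w hw => hw.et.symm)).unique
        ((did.pow 2).sub ((did.const_mul (Complex.I * c)).mul dω))
      simp only [id, Pi.pow_apply] at e
      linear_combination e
    et₂' := by
      have e := ((dω.mul (dt.pow 2)).congr_of_eventuallyEq
        (h.mono fun w hw => hw.et₂.symm)).unique
        ((dω.mul (did.pow 2)).sub (did.const_mul (Complex.I * c)))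
      simp only [id, Pi.pow_apply] at e
      linear_combination e }

theorem hasDerivAt_detFun {c : ℝ} {z : ℂ} (h : ∀ᶠ w in 𝓝 z, CharGood c w) :
    HasDerivAt (detFun c) (modeData h).detDeriv z := by
  have h0 := h.self_of_nhds
  have da := h0.differentiableAt_R₁.hasDerivAt
  have db := h0.differentiableAt_R₁_neg.hasDerivAt
  have ds := h0.differentiableAt_S₁.hasDerivAt
  have dt := h0.differentiableAt_S₂.hasDerivAt
  have dσ := h0.differentiableAt_sigma.hasDerivAt
  have dω := h0.differentiableAt_omega.hasDerivAt
  have e : detFun c = fun z =>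
      oscCoeff (charR₁ c z) (charS₁ c z) (charSigma c z) (charOmega c z) *
        layerCoeff z (charR₁ (-c) z) (charS₂ c z) (-charSigma c z) (-charOmega c z) +
      oscCoeff (charR₁ (-c) z) (charS₁ c z) (-charSigma c z) (-charOmega c z) *
        layerCoeff z (charR₁ c z) (charS₂ c z) (charSigma c z) (charOmega c z) := by
    funext z
    simp only [detFun, oscFun, layerFun, charS₁_neg, charS₂_neg, charSigma_neg, charOmega_neg]
  rw [e]
  exact ((hasDerivAt_oscCoeff da ds dσ dω).mul (hasDerivAt_layerCoeff db dt dσ.neg dω.neg)).add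
    ((hasDerivAt_oscCoeff db ds dσ.neg dω.neg).mul (hasDerivAt_layerCoeff da dt dσ dω))

/-- Simple zeros of the interface determinant are simple eigenvalues. -/
theorem isSimpleEigenvalue_of_detFun {c : ℝ} {z : ℂ} (h : ∀ᶠ w in 𝓝 z, CharGood c w)
    (h0 : detFun c z = 0) (h1 : deriv (detFun c) z ≠ 0) :
    IsSimpleEigenvalue (localGenerator c) z := by
  refine (modeData h).isSimpleEigenvalue ?_ ?_
  · rw [← h0]
    simp only [detFun, oscFun, layerFun, charS₁_neg, charS₂_neg, charSigma_neg, charOmega_neg]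
    rfl
  · rwa [← (hasDerivAt_detFun h).deriv]

/-! ### Asymptotics of the mode parameters and of the boundary layer in a strip -/

section Strip
variable (c : ℝ) (r : ℝ)

theorem invSqrt_pow_tendsto_zero {k : ℕ} (hk : k ≠ 0) :
    Tendsto (fun z => invSqrt z ^ k) (stripFilter r) (𝓝 0) := by
  simpa [hk] using (tendsto_invSqrt r).pow k

theorem mul_invSqrt_pow {z : ℂ} (hz : z ≠ 0) (k : ℕ) : z * invSqrt z ^ (k + 2) = invSqrt z ^ k := by
  rw [pow_add, invSqrt_sq]; field_simp

theorem isBigO_mul_self {k : ℕ} {f : ℂ → ℂ}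
    (h : f =O[stripFilter r] fun z => invSqrt z ^ (k + 2)) :
    (fun z => z * f z) =O[stripFilter r] fun z => invSqrt z ^ k := by
  refine ((isBigO_refl (fun z : ℂ => z) (stripFilter r)).mul h).congr' EventuallyEq.rfl ?_
  filter_upwards [eventually_ne_zero_strip r] with z hz
  exact mul_invSqrt_pow hz k

theorem charSigma_isBigO : charSigma c =O[stripFilter r] fun z => invSqrt z ^ 4 := by
  have h := ((charSigma_sub c r).trans (invSqrt_pow_isBigO (show 4 ≤ 10 by norm_num))).add
    ((isBigO_refl (fun z => invSqrt z ^ 4) (stripFilter r)).const_mul_left (Complex.I * c))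
  exact h.congr_left fun z => by ring

theorem charOmega_isBigO : charOmega c =O[stripFilter r] fun z => invSqrt z ^ 2 := by
  have h := ((charOmega_sub c r).trans (invSqrt_pow_isBigO (show 2 ≤ 4 by norm_num))).add
    ((isBigO_refl (fun z => invSqrt z ^ 2) (stripFilter r)).const_mul_left (Complex.I * c))
  exact h.congr_left fun z => by ring

theorem tendsto_argS : Tendsto (fun z => (1 + 2 / z + charDelta c z) / (2 * (1 + 1 / z)))
    (stripFilter r) (𝓝 1) := by
  have hi := tendsto_inv_strip r
  have := ((hi.const_mul 2).const_add 1 |>.add (tendsto_charDelta c r)).div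
    ((hi.const_add 1).const_mul 2) (by norm_num)
  norm_num at this
  refine this.congr fun z => ?_
  simp only [Pi.div_apply, div_eq_mul_inv, one_mul]

/-- Since Δ - 1 = O(z^(-3)), even z(Δ - 1) tends to zero, and the numerator tends to 2 although its
terms grow. -/
theorem tendsto_argT : Tendsto (fun z => (z + 2 - z * charDelta c z) / (2 * (1 + 1 / z)))
    (stripFilter r) (𝓝 1) := by
  have hi := tendsto_inv_strip r
  have h1 : Tendsto (fun z => z * (charDelta c z - 1)) (stripFilter r) (𝓝 0) :=
    (isBigO_mul_self r (k := 4) (charDelta_sub_one c r)).trans_tendsto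
      (invSqrt_pow_tendsto_zero r (by norm_num))
  have := (h1.const_sub 2).div ((hi.const_add 1).const_mul 2) (by norm_num)
  norm_num at this
  refine this.congr fun z => ?_
  simp only [Pi.div_apply, div_eq_mul_inv]
  ring

theorem tendsto_rootS : Tendsto (rootS c) (stripFilter r) (𝓝 1) := tendsto_csqrt_one (tendsto_argS c r)

theorem tendsto_rootT : Tendsto (rootT c) (stripFilter r) (𝓝 1) := tendsto_csqrt_one (tendsto_argT c r)

/-- The boundary layer mode decays. -/
theorem exp_neg_charS₂_isBigO :
    (fun z => Complex.exp (-charS₂ c z)) =O[stripFilter r] invSqrt := by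
  have h1 : ∀ᶠ z in stripFilter r, ‖rootT c z - 1‖ < 1 / 4 := by
    have := (tendsto_rootT c r).sub_const 1
    rw [sub_self] at this
    exact this.norm.eventually_lt_const (by norm_num)
  refine IsBigO.of_bound 4 ?_
  filter_upwards [h1, (tendsto_norm_stripFilter r).eventually_ge_atTop (2 * r),
    eventually_ne_zero_strip r, eventually_stripFilter.2 ⟨0, fun z _ h => h⟩] with z h1 h2 h3 h4
  have hn : 0 < ‖csqrt z‖ := norm_pos_iff.2 (csqrt_ne_zero h3)
  -- For |Re z| ≤ r and |z| ≥ 2r the identity (Re √z)² = (|z| + Re z)/2 gives at least |z|/4. The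
  -- deviation of `rootT` from 1, less than 1/4, costs half of the resulting bound.
  have e1 : ‖csqrt z‖ / 2 ≤ (csqrt z).re := by
    refine (sq_le_sq₀ (by positivity) (csqrt_re_nonneg z)).1 ?_
    rw [csqrt_re_sq, div_pow, norm_csqrt_sq]
    have := (abs_le.1 h4).1
    linarith
  have e2 : (charS₂ c z).re = (csqrt z).re + (csqrt z * (rootT c z - 1)).re := by
    rw [charS₂_eq, ← Complex.add_re]; congr 1; ring
  have e3 : -(‖csqrt z‖ * (1 / 4)) ≤ (csqrt z * (rootT c z - 1)).re := by
    have := (abs_le.1 ((Complex.abs_re_le_norm (csqrt z * (rootT c z - 1))))).1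
    rw [norm_mul] at this
    have := mul_le_mul_of_nonneg_left h1.le hn.le
    linarith
  have e4 : ‖csqrt z‖ / 4 ≤ (charS₂ c z).re := by rw [e2]; linarith
  rw [Complex.norm_exp, Complex.neg_re, Real.exp_neg, invSqrt, norm_inv]
  -- The exponential decay is only used through x ≤ exp x, since order z^(-1/2) is all that is
  -- needed.
  have e5 : ‖csqrt z‖ / 4 ≤ Real.exp (charS₂ c z).re :=
    e4.trans ((by linarith [Real.add_one_le_exp (charS₂ c z).re] : _ ≤ _))
  calc (Real.exp (charS₂ c z).re)⁻¹ ≤ (‖csqrt z‖ / 4)⁻¹ := by gcongr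
    _ = 4 * ‖csqrt z‖⁻¹ := by field_simp

theorem two_cosh_half (t : ℂ) :
    2 * Complex.cosh (t / 2) = Complex.exp (t / 2) * (1 + Complex.exp (-t)) := by
  rw [Complex.two_cosh, mul_add, mul_one, ← Complex.exp_add]; congr 2; ring

theorem two_sinh_half (t : ℂ) :
    2 * Complex.sinh (t / 2) = Complex.exp (t / 2) * (1 - Complex.exp (-t)) := by
  rw [Complex.two_sinh, mul_sub, mul_one, ← Complex.exp_add]; congr 2; ring

theorem eventually_one_add_exp : ∀ᶠ z in stripFilter r, 1 + Complex.exp (-charS₂ c z) ≠ 0 := by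
  have := ((exp_neg_charS₂_isBigO c r).trans_tendsto (tendsto_invSqrt r)).const_add 1
  exact this.eventually_ne (by norm_num)

theorem eventually_charGood : ∀ᶠ z in stripFilter r, CharGood c z := by
  have hi := tendsto_inv_strip r
  have tA : ∀ k : ℂ, Tendsto (fun z => 1 + k / z) (stripFilter r) (𝓝 1) := fun k => by
    simpa [div_eq_mul_inv] using (hi.const_mul k).const_add 1
  have hD : Tendsto (fun z : ℂ => 1 - 4 * (c:ℂ) ^ 2 / z ^ 3 - 4 * c ^ 2 / z ^ 4) (stripFilter r)
      (𝓝 1) := tendsto_of_sub_isBigO (by norm_num)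
    ((charDelta_arg_isBigO c r).congr_left fun z => by rw [one_pow]) tendsto_const_nhds
  have hd : Tendsto (fun z => 1 + charOmega c z * charSigma c z) (stripFilter r) (𝓝 1) := by
    have := (((charOmega_isBigO c r).trans_tendsto (invSqrt_pow_tendsto_zero r (by norm_num))).mul
      ((charSigma_isBigO c r).trans_tendsto (invSqrt_pow_tendsto_zero r (by norm_num)))).const_add 1
    simpa using this
  filter_upwards [eventually_ne_zero_strip r, eventually_slitPlane_strip r,
    (tA 1).eventually_ne one_ne_zero, eventually_mem_slitPlane hD, eventually_one_add_charDelta c r,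
    eventually_mem_slitPlane (tA (Complex.I * c)), eventually_mem_slitPlane (tA (-(Complex.I * c))),
    eventually_mem_slitPlane (tendsto_argS c r), eventually_mem_slitPlane (tendsto_argT c r),
    eventually_one_add_exp c r, hd.eventually_ne one_ne_zero]
    with z h1 h2 h3 h4 h5 h6 h7 h8 h9 h10 h11
  refine ⟨h1, ?_, h2, h4, h5, h6, by simpa [sub_eq_add_neg, neg_div] using h7, h8, h9, ?_, h11⟩
  · rw [show 1 + z = z * (1 + 1 / z) by field_simp; ring]
    exact mul_ne_zero h1 h3
  · intro h0
    have := two_cosh_half (charS₂ c z)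
    rw [h0, mul_zero] at this
    exact (mul_ne_zero (Complex.exp_ne_zero _) h10) this.symm

/-- The hyperbolic tangent of the boundary layer exponent. -/
theorem tanh_charS₂ : (fun z => Complex.sinh (charS₂ c z / 2) / Complex.cosh (charS₂ c z / 2) - 1)
    =O[stripFilter r] fun z => invSqrt z ^ 1 := by
  have h0 := exp_neg_charS₂_isBigO c r
  have h1 : Tendsto (fun z => (-2) * (1 + Complex.exp (-charS₂ c z))⁻¹) (stripFilter r)
      (𝓝 ((-2) * (1 + 0)⁻¹)) :=
    (((h0.trans_tendsto (tendsto_invSqrt r)).const_add 1).inv₀ (by norm_num)).const_mul (-2)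
  have h2 := (h1.isBigO_one ℂ).mul h0
  simp only [one_mul, pow_one] at h2 ⊢
  refine h2.congr' ?_ EventuallyEq.rfl
  filter_upwards [eventually_charGood c r, eventually_one_add_exp c r] with z h3 h4
  have e : ∀ a b : ℂ, a / b = (2 * a) / (2 * b) := fun a b => by
    rw [mul_div_mul_left _ _ two_ne_zero]
  rw [e, two_cosh_half, two_sinh_half]
  have := Complex.exp_ne_zero (charS₂ c z / 2)
  field_simp
  ring

theorem rootS_sub : (fun z => rootS c z - (1 - c ^ 2 * invSqrt z ^ 6 / 2))
    =O[stripFilter r] fun z => invSqrt z ^ 8 := by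
  have hy : Tendsto (fun z => 1 - (c:ℂ) ^ 2 * invSqrt z ^ 6 / 2) (stripFilter r) (𝓝 1) := by
    have := (((invSqrt_pow_tendsto_zero r (k := 6) (by norm_num)).const_mul ((c:ℂ) ^ 2)).div_const
      2).const_sub 1
    simpa using this
  refine isBigO_sub_of_sq (tendsto_rootS c r) hy ?_
  have h1 := ((charSigma_sub c r).mul (isBigO_refl (fun z => invSqrt z ^ 2) (stripFilter r))
    ).const_mul_left (Complex.I * c)
  have h2 : (fun z => -((c:ℂ) ^ 4 / 4) * invSqrt z ^ 12) =O[stripFilter r]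
    fun z => invSqrt z ^ 12 := (isBigO_refl _ _).const_mul_left _
  have h3 : (fun z => invSqrt z ^ 10 * invSqrt z ^ 2) =O[stripFilter r] fun z => invSqrt z ^ 12 :=
    (isBigO_refl _ _).congr_left fun z => by ring
  refine (((h1.trans h3).add h2).trans (invSqrt_pow_isBigO (by norm_num))).congr' ?_
    EventuallyEq.rfl
  filter_upwards [eventually_charGood c r] with z hz
  rw [hz.rootS_sq, div_eq_mul_inv _ z, ← invSqrt_sq z]
  linear_combination -(c ^ 2 * invSqrt z ^ 6) * Complex.I_sq

theorem rootT_sub_one : (fun z => rootT c z - 1) =O[stripFilter r] fun z => invSqrt z ^ 2 := by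
  refine isBigO_sub_of_sq (tendsto_rootT c r) tendsto_const_nhds ?_
  have hi := tendsto_inv_strip r
  have h1 : Tendsto (fun z => -(1 + Complex.I * c * charOmega c z) * (1 + z⁻¹)⁻¹) (stripFilter r)
      (𝓝 (-(1 + Complex.I * c * 0) * (1 + 0)⁻¹)) :=
    ((((charOmega_isBigO c r).trans_tendsto (invSqrt_pow_tendsto_zero r (by norm_num))).const_mul
      _).const_add 1).neg.mul ((hi.const_add 1).inv₀ (by norm_num))
  refine (isBigO_mul_invSqrt 2 (h1.isBigO_one ℂ)).congr' ?_ EventuallyEq.rfl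
  filter_upwards [eventually_charGood c r] with z hz
  have e := hz.rootT_sq
  have n1 := hz.ne_zero
  have n2 := hz.one_add
  have e2 : rootT c z ^ 2 = (z - Complex.I * c * charOmega c z) / (1 + z) := by
    rw [← e]; field_simp
  rw [e2, invSqrt_sq, show 1 + z⁻¹ = (1 + z) / z by field_simp; ring]
  field_simp
  ring

/-- The expansion of `r₁ / 2`. -/
theorem charR₁_half_sub : (fun z => charR₁ c z / 2 - (z / 2 + Complex.I * c / 4 +
      c ^ 2 * invSqrt z ^ 2 / 16 - Complex.I * c ^ 3 * invSqrt z ^ 4 / 32))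
    =O[stripFilter r] fun z => invSqrt z ^ 6 := by
  refine ((isBigO_mul_self r (k := 6) (rootA_sub c r)).const_mul_left (1 / 2)).congr' ?_
    EventuallyEq.rfl
  filter_upwards [eventually_ne_zero_strip r] with z hz
  rw [charR₁_eq]
  simp only [rootPoly]
  have e0 := mul_invSqrt_pow hz 0
  rw [zero_add, pow_zero] at e0
  linear_combination (-(Complex.I * c) / 4 + Complex.I ^ 2 * c ^ 2 * invSqrt z ^ 2 / 16
    - Complex.I ^ 3 * c ^ 3 * invSqrt z ^ 4 / 32) * e0
    + (c ^ 2 * invSqrt z ^ 2 / 16 - Complex.I * c ^ 3 * invSqrt z ^ 4 / 32) * Complex.I_sq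

/-- The expansion of `s₁ / 2`. -/
theorem charS₁_half_sub : (fun z => charS₁ c z / 2 - (z / 2 - c ^ 2 * invSqrt z ^ 4 / 4))
    =O[stripFilter r] fun z => invSqrt z ^ 6 := by
  refine ((isBigO_mul_self r (k := 6) (rootS_sub c r)).const_mul_left (1 / 2)).congr' ?_
    EventuallyEq.rfl
  filter_upwards [eventually_ne_zero_strip r] with z hz
  rw [charS₁_eq]
  have e0 := mul_invSqrt_pow hz 4
  linear_combination ((c:ℂ) ^ 2 / 4) * e0

/-! ### The normalized determinant -/

theorem norm_cosh_le (w : ℂ) : ‖Complex.cosh w‖ ≤ Real.exp |w.re| := by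
  rw [Complex.cosh, norm_div, Complex.norm_ofNat, div_le_iff₀ two_pos]
  refine (norm_add_le _ _).trans ?_
  rw [Complex.norm_exp, Complex.norm_exp, Complex.neg_re]
  have h1 := Real.exp_le_exp.2 (le_abs_self w.re)
  have h2 := Real.exp_le_exp.2 (neg_le_abs w.re)
  linarith

theorem norm_sinh_le (w : ℂ) : ‖Complex.sinh w‖ ≤ Real.exp |w.re| := by
  rw [Complex.sinh, norm_div, Complex.norm_ofNat, div_le_iff₀ two_pos]
  refine (norm_sub_le _ _).trans ?_
  rw [Complex.norm_exp, Complex.norm_exp, Complex.neg_re]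
  have h1 := Real.exp_le_exp.2 (le_abs_self w.re)
  have h2 := Real.exp_le_exp.2 (neg_le_abs w.re)
  linarith

/-- Bounded hyperbolic functions on a strip. -/
theorem hyperbolic_isBigO_one (k θ : ℝ) :
    ((fun z : ℂ => Complex.sinh (k * z + Complex.I * θ)) =O[stripFilter r] fun _ => (1 : ℂ)) ∧
    ((fun z : ℂ => Complex.cosh (k * z + Complex.I * θ)) =O[stripFilter r] fun _ => (1 : ℂ)) := by
  have key : ∀ z : ℂ, |z.re| ≤ r →
      Real.exp |(k * z + Complex.I * θ).re| ≤ Real.exp (|k| * r) * ‖(1:ℂ)‖ := by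
    intro z hz
    rw [norm_one, mul_one]
    refine Real.exp_le_exp.2 ?_
    have : (k * z + Complex.I * θ).re = k * z.re := by simp
    rw [this, abs_mul]
    gcongr
  have hs : ∀ᶠ z in stripFilter r, |z.re| ≤ r := eventually_stripFilter.2 ⟨0, fun z _ h => h⟩
  exact ⟨IsBigO.of_bound _ (hs.mono fun z hz => (norm_sinh_le _).trans (key z hz)),
    IsBigO.of_bound _ (hs.mono fun z hz => (norm_cosh_le _).trans (key z hz))⟩

/-- The addition theorems express f through g and the small increment f - g. Only sinh g and cosh g
have to be bounded, not g itself, which matters because the exponents grow along the strip. -/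
theorem hyperbolic_sub_isBigO {l : Filter ℂ} {f g e : ℂ → ℂ} (h : (fun z => f z - g z) =O[l] e)
    (he : Tendsto e l (𝓝 0)) (hs : (fun z => Complex.sinh (g z)) =O[l] fun _ => (1 : ℂ))
    (hc : (fun z => Complex.cosh (g z)) =O[l] fun _ => (1 : ℂ)) :
    ((fun z => Complex.sinh (f z) - Complex.sinh (g z)) =O[l] e) ∧
    ((fun z => Complex.cosh (f z) - Complex.cosh (g z)) =O[l] e) := by
  have h0 : Tendsto (fun z => f z - g z) l (𝓝 0) := h.trans_tendsto he
  have s1 : (fun z => Complex.sinh (f z - g z)) =O[l] e := by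
    have := ((Complex.hasDerivAt_sinh 0).isBigO_sub).comp_tendsto h0
    simp only [Function.comp_def, Complex.sinh_zero, sub_zero] at this
    exact this.trans h
  have c1 : (fun z => Complex.cosh (f z - g z) - 1) =O[l] e := by
    have := ((Complex.hasDerivAt_cosh 0).isBigO_sub).comp_tendsto h0
    simp only [Function.comp_def, Complex.cosh_zero, sub_zero] at this
    exact this.trans h
  have p1 := (hs.mul c1).add (hc.mul s1)
  have p2 := (hc.mul c1).add (hs.mul s1)
  simp only [one_mul] at p1 p2
  constructor
  · refine p1.congr_left fun z => ?_
    have : Complex.sinh (f z) = Complex.sinh (g z + (f z - g z)) := by congr 1; ring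
    rw [this, Complex.sinh_add]; ring
  · refine p2.congr_left fun z => ?_
    have : Complex.cosh (f z) = Complex.cosh (g z + (f z - g z)) := by congr 1; ring
    rw [this, Complex.cosh_add]; ring

theorem stripApprox_charR₁ :
    StripApprox r 2 (fun z => Complex.sinh (charR₁ c z / 2))
      (fun z => Complex.sinh (z / 2 + Complex.I * c / 4)) ∧
    StripApprox r 2 (fun z => Complex.cosh (charR₁ c z / 2))
      (fun z => Complex.cosh (z / 2 + Complex.I * c / 4)) := by
  have hb := hyperbolic_isBigO_one r (1 / 2) (c / 4)
  have e : ∀ z : ℂ, ((1 / 2 : ℝ) : ℂ) * z + Complex.I * ((c / 4 : ℝ) : ℂ)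
      = z / 2 + Complex.I * c / 4 := fun z => by push_cast; ring
  simp only [e] at hb
  have h : (fun z => charR₁ c z / 2 - (z / 2 + Complex.I * c / 4)) =O[stripFilter r]
      fun z => invSqrt z ^ 2 := by
    have t : Tendsto (fun z => (c:ℂ) ^ 2 / 16 - Complex.I * c ^ 3 / 32 * invSqrt z ^ 2)
      (stripFilter r) (𝓝 _) :=
      ((invSqrt_pow_tendsto_zero r (k := 2) (by norm_num)).const_mul
        (Complex.I * c ^ 3 / 32)).const_sub ((c:ℂ) ^ 2 / 16)
    refine (((charR₁_half_sub c r).trans (invSqrt_pow_isBigO (show 2 ≤ 6 by norm_num))).add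
      (isBigO_mul_invSqrt 2 (t.isBigO_one ℂ))).congr_left fun z => by ring
  have := hyperbolic_sub_isBigO h (invSqrt_pow_tendsto_zero r (by norm_num)) hb.1 hb.2
  exact ⟨.of_sub this.1 hb.1, .of_sub this.2 hb.2⟩

theorem stripApprox_charS₁ :
    StripApprox r 2 (fun z => Complex.sinh (charS₁ c z / 2)) (fun z => Complex.sinh (z / 2)) ∧
    StripApprox r 2 (fun z => Complex.cosh (charS₁ c z / 2)) (fun z => Complex.cosh (z / 2)) := by
  have hb := hyperbolic_isBigO_one r (1 / 2) 0
  have e : ∀ z : ℂ, ((1 / 2 : ℝ) : ℂ) * z + Complex.I * ((0 : ℝ) : ℂ)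
      = z / 2 := fun z => by push_cast; ring
  simp only [e] at hb
  have h : (fun z => charS₁ c z / 2 - z / 2) =O[stripFilter r] fun z => invSqrt z ^ 2 := by
    have t : (fun z => -((c:ℂ) ^ 2 / 4) * invSqrt z ^ 4) =O[stripFilter r]
      fun z => invSqrt z ^ 4 := (isBigO_refl _ _).const_mul_left _
    exact (((charS₁_half_sub c r).trans (invSqrt_pow_isBigO (show 2 ≤ 6 by norm_num))).add
      (t.trans (invSqrt_pow_isBigO (by norm_num)))).congr_left fun z => by ring
  have := hyperbolic_sub_isBigO h (invSqrt_pow_tendsto_zero r (by norm_num)) hb.1 hb.2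
  exact ⟨.of_sub this.1 hb.1, .of_sub this.2 hb.2⟩

end Strip

noncomputable def oscNorm (c : ℝ) (z : ℂ) : ℂ := oscFun c z / z

/-- The divisor removes the exponential growth of the layer mode. It is even in c, so it factors out
of both products of the determinant. -/
noncomputable def layerNorm (c : ℝ) (z : ℂ) : ℂ :=
  layerFun c z / ((1 + z) * charS₂ c z * Complex.cosh (charS₂ c z / 2))

noncomputable def detNorm (c : ℝ) (z : ℂ) : ℂ :=
  oscNorm c z * layerNorm (-c) z + oscNorm (-c) z * layerNorm c z

/-- The coefficient of the boundary layer in the normalized determinant, `1 / √z + O(1 / z)`. -/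
noncomputable def layerRatio (c : ℝ) (z : ℂ) : ℂ :=
  z * Complex.sinh (charS₂ c z / 2) / ((1 + z) * charS₂ c z * Complex.cosh (charS₂ c z / 2))

theorem detNorm_eq (c : ℝ) (z : ℂ) : detNorm c z =
    detFun c z / (z * ((1 + z) * charS₂ c z * Complex.cosh (charS₂ c z / 2))) := by
  simp only [detNorm, detFun, oscNorm, layerNorm, charS₂_neg]
  rw [div_mul_div_comm, div_mul_div_comm, ← add_div]

theorem oscNorm_eq {c : ℝ} {z : ℂ} (hz : z ≠ 0) : oscNorm c z =
    rootS c z * (1 + charOmega c z) *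
      (Complex.sinh (charR₁ c z / 2) * Complex.cosh (charS₁ c z / 2)) +
    rootA c z * (1 + charSigma c z) *
      (Complex.cosh (charR₁ c z / 2) * Complex.sinh (charS₁ c z / 2)) := by
  rw [oscNorm, div_eq_iff hz]
  simp only [oscFun, oscCoeff]
  rw [show (charS₁ c z) * (1 + charOmega c z) = z * (rootS c z * (1 + charOmega c z)) by
    rw [charS₁_eq]; ring, show (charR₁ c z) * (1 + charSigma c z) =
    z * (rootA c z * (1 + charSigma c z)) by rw [charR₁_eq]; ring]
  ring

theorem CharGood.layerDenom_ne {c : ℝ} {z : ℂ} (h : CharGood c z) :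
    (1 + z) * charS₂ c z * Complex.cosh (charS₂ c z / 2) ≠ 0 :=
  mul_ne_zero (mul_ne_zero h.one_add (mul_ne_zero (csqrt_ne_zero h.ne_zero)
    (csqrt_ne_zero (Complex.slitPlane_ne_zero h.argT)))) h.cosh_ne

theorem layerNorm_eq {c : ℝ} {z : ℂ} (h : CharGood c z) : layerNorm c z =
    Complex.sinh (charR₁ c z / 2) * (1 - charSigma c z) +
      layerRatio c z * (rootA c z * (1 - charOmega c z) * Complex.cosh (charR₁ c z / 2)) := by
  have hd := h.layerDenom_ne
  rw [layerNorm, layerRatio, layerFun, layerCoeff, div_mul_eq_mul_div, ← sub_eq_zero,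
    ← sub_sub, div_sub' hd, div_sub_div_same, div_eq_zero_iff]
  left
  rw [show (charR₁ c z) * (1 - charOmega c z) = z * (rootA c z * (1 - charOmega c z)) by
    rw [charR₁_eq]; ring]
  ring

/-! ### Expansion of the entries of the normalized determinant -/

section DetExpansion
variable (c r : ℝ)

theorem StripApprox.of_tendsto {r : ℝ} {k : ℕ} {f : ℂ → ℂ} {a : ℂ}
    (h : (fun z => f z - a) =O[stripFilter r] fun z => invSqrt z ^ k)
    (hf : Tendsto f (stripFilter r) (𝓝 a)) : StripApprox r k f fun _ => a :=
  ⟨h, hf.isBigO_one ℂ⟩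

theorem StripApprox.inv_one {r : ℝ} {k : ℕ} {f : ℂ → ℂ}
    (h : (fun z => f z - 1) =O[stripFilter r] fun z => invSqrt z ^ k)
    (hf : Tendsto f (stripFilter r) (𝓝 1)) : StripApprox r k (fun z => (f z)⁻¹) fun _ => 1 := by
  have hi : Tendsto (fun z => (f z)⁻¹) (stripFilter r) (𝓝 1) := by
    simpa using hf.inv₀ one_ne_zero
  refine .of_tendsto ?_ hi
  have := h.neg_left.mul (hi.isBigO_one ℂ)
  simp only [mul_one] at this
  refine this.congr' ?_ EventuallyEq.rfl
  filter_upwards [hf.eventually_ne one_ne_zero] with z hz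
  field_simp
  ring

/-- The ratio is z^(-1/2) times the factors (1 + 1/z)^(-1), 1/`rootT` and tanh(s₂/2). Each of these
is 1 + O(z^(-1/2)), so the total error has order 1/z. -/
theorem stripApprox_layerRatio : StripApprox r 2 (layerRatio c) invSqrt := by
  have hi := tendsto_inv_strip r
  have a1 : StripApprox r 1 (fun z : ℂ => (1 + z⁻¹)⁻¹) fun _ => 1 := by
    refine StripApprox.inv_one ?_ (by simpa using hi.const_add 1)
    refine (invSqrt_pow_isBigO (show 1 ≤ 2 by norm_num)).congr_left fun z => ?_
    rw [invSqrt_sq]; ring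
  have a2 : StripApprox r 1 (fun z : ℂ => (rootT c z)⁻¹) fun _ => 1 :=
    StripApprox.inv_one ((rootT_sub_one c r).trans (invSqrt_pow_isBigO (by norm_num)))
      (tendsto_rootT c r)
  have a3 : StripApprox r 1 (fun z => Complex.sinh (charS₂ c z / 2) / Complex.cosh (charS₂ c z / 2))
      fun _ => 1 :=
    .of_sub (tanh_charS₂ c r) (isBigO_refl _ _)
  have a := (a1.mul a2).mul a3
  have e : ∀ᶠ z in stripFilter r, layerRatio c z = invSqrt z * ((1 + z⁻¹)⁻¹ * (rootT c z)⁻¹ *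
      (Complex.sinh (charS₂ c z / 2) / Complex.cosh (charS₂ c z / 2))) := by
    filter_upwards [eventually_charGood c r] with z hz
    have n1 := hz.ne_zero
    have n2 := hz.one_add
    have n3 := csqrt_ne_zero n1
    have n4 : rootT c z ≠ 0 := csqrt_ne_zero (Complex.slitPlane_ne_zero hz.argT)
    have n5 := hz.cosh_ne
    rw [layerRatio, invSqrt, show 1 + z⁻¹ = (1 + z) / z by field_simp; ring, charS₂_eq]
    rw [charS₂_eq] at n5
    field_simp
  refine .of_sub ?_ (invSqrt_isBigO_one r)
  refine ((isBigO_refl invSqrt (stripFilter r)).mul a.sub).congr' ?_ ?_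
  · filter_upwards [e] with z hz
    rw [hz]; ring
  · exact Eventually.of_forall fun z => by ring

theorem stripApprox_rootA : StripApprox r 2 (rootA c) fun _ => 1 := by
  refine .of_tendsto ?_ (tendsto_rootA c r)
  have t : Tendsto (fun z => Complex.I * c * (1 / 2 - (Complex.I * c * invSqrt z ^ 2) / 8
      + (Complex.I * c * invSqrt z ^ 2) ^ 2 / 16)) (stripFilter r) (𝓝 _) :=
    ((((((invSqrt_pow_tendsto_zero r (k := 2) (by norm_num)).const_mul (Complex.I * c)).div_const
      8).const_sub (1 / 2)).add (((invSqrt_pow_tendsto_zero r (k := 2) (by norm_num)).const_mul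
      (Complex.I * c)).pow 2 |>.div_const 16)).const_mul (Complex.I * c))
  refine (((rootA_sub c r).trans (invSqrt_pow_isBigO (show 2 ≤ 8 by norm_num))).add
    (isBigO_mul_invSqrt 2 (t.isBigO_one ℂ))).congr_left fun z => ?_
  rw [rootPoly]; ring

theorem stripApprox_rootS : StripApprox r 2 (rootS c) fun _ => 1 := by
  refine .of_tendsto ?_ (tendsto_rootS c r)
  have t : (fun z => -((c:ℂ) ^ 2 / 2) * invSqrt z ^ 6) =O[stripFilter r]
    fun z => invSqrt z ^ 6 := (isBigO_refl _ _).const_mul_left _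
  exact (((rootS_sub c r).trans (invSqrt_pow_isBigO (show 2 ≤ 8 by norm_num))).add
    (t.trans (invSqrt_pow_isBigO (show 2 ≤ 6 by norm_num)))).congr_left fun z => by ring

theorem stripApprox_charSigma : StripApprox r 2 (charSigma c) fun _ => 0 := by
  refine .of_sub ?_ (isBigO_zero _ _)
  simpa using (charSigma_isBigO c r).trans (invSqrt_pow_isBigO (show 2 ≤ 4 by norm_num))

theorem stripApprox_charOmega : StripApprox r 2 (charOmega c) fun _ => 0 := by
  refine .of_sub ?_ (isBigO_zero _ _)
  simpa using charOmega_isBigO c r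

/-- The prefactors are 1 + O(1/z), and the half exponents are z/2 + ic/4 and z/2 up to O(1/z); the
addition theorem for sinh sums them. -/
theorem stripApprox_oscNorm : StripApprox r 2 (oscNorm c)
    fun z => Complex.sinh (z + Complex.I * c / 4) := by
  have one : StripApprox r 2 (fun _ => (1:ℂ)) fun _ => 1 := .const 1
  have h := (((stripApprox_rootS c r).mul (one.add (stripApprox_charOmega c r))).mul
    ((stripApprox_charR₁ c r).1.mul (stripApprox_charS₁ c r).2)).add
    (((stripApprox_rootA c r).mul (one.add (stripApprox_charSigma c r))).mul
    ((stripApprox_charR₁ c r).2.mul (stripApprox_charS₁ c r).1))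
  refine h.congr ?_ (Eventually.of_forall fun z => ?_)
  · filter_upwards [eventually_ne_zero_strip r] with z hz
    rw [oscNorm_eq hz]
  · dsimp only
    rw [show z + Complex.I * c / 4 = (z / 2 + Complex.I * c / 4) + z / 2 by ring,
      Complex.sinh_add (z / 2 + Complex.I * c / 4)]
    ring

theorem stripApprox_layerNorm : StripApprox r 2 (layerNorm c)
    fun z => Complex.sinh (z / 2 + Complex.I * c / 4) +
      invSqrt z * Complex.cosh (z / 2 + Complex.I * c / 4) := by
  have one : StripApprox r 2 (fun _ => (1:ℂ)) fun _ => 1 := .const 1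
  have h := ((stripApprox_charR₁ c r).1.mul (one.add (stripApprox_charSigma c r).neg)).add
    ((stripApprox_layerRatio c r).mul (((stripApprox_rootA c r).mul
      (one.add (stripApprox_charOmega c r).neg)).mul (stripApprox_charR₁ c r).2))
  refine h.congr ?_ (Eventually.of_forall fun z => ?_)
  · filter_upwards [eventually_charGood c r] with z hz
    rw [layerNorm_eq hz]
    ring
  · dsimp only
    ring

end DetExpansion

/-- The leading term of the normalized determinant. -/
noncomputable def limitDet (c : ℝ) (z : ℂ) : ℂ :=
  Complex.cosh (3 * z / 2) - Complex.cosh (z / 2) * Real.cos (c / 2)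

/-- The boundary layer correction of the normalized determinant. -/
noncomputable def limitLayer (c : ℝ) (z : ℂ) : ℂ :=
  Complex.sinh (3 * z / 2) + Complex.sinh (z / 2) * Real.cos (c / 2)

noncomputable def limitDetDeriv (c : ℝ) (z : ℂ) : ℂ :=
  3 / 2 * Complex.sinh (3 * z / 2) - Complex.sinh (z / 2) * Real.cos (c / 2) / 2

noncomputable def limitLayerDeriv (c : ℝ) (z : ℂ) : ℂ :=
  3 / 2 * Complex.cosh (3 * z / 2) + Complex.cosh (z / 2) * Real.cos (c / 2) / 2

theorem hasDerivAt_limitDet (c : ℝ) (z : ℂ) : HasDerivAt (limitDet c) (limitDetDeriv c z) z := by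
  have h3 : HasDerivAt (fun z : ℂ => 3 * z / 2) (3 * 1 / 2) z :=
    ((hasDerivAt_id z).const_mul 3).div_const 2
  have h1 : HasDerivAt (fun z : ℂ => z / 2) (1 / 2) z := (hasDerivAt_id z).div_const 2
  refine (h3.ccosh.sub (h1.ccosh.mul_const _)).congr_deriv ?_
  rw [limitDetDeriv]; ring

theorem hasDerivAt_limitLayer (c : ℝ) (z : ℂ) :
    HasDerivAt (limitLayer c) (limitLayerDeriv c z) z := by
  have h3 : HasDerivAt (fun z : ℂ => 3 * z / 2) (3 * 1 / 2) z :=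
    ((hasDerivAt_id z).const_mul 3).div_const 2
  have h1 : HasDerivAt (fun z : ℂ => z / 2) (1 / 2) z := (hasDerivAt_id z).div_const 2
  refine (h3.csinh.add (h1.csinh.mul_const _)).congr_deriv ?_
  rw [limitLayerDeriv]; ring

/-- Product-to-sum formulas: adding the arguments gives 3z/2, subtracting them gives z/2 ± ic/2, and
symmetrization in c leaves only the even part cosh(ic/2) = cos(c/2). -/
theorem limit_expand (c : ℝ) (z q : ℂ) :
    Complex.sinh (z + Complex.I * c / 4) * (Complex.sinh (z / 2 + Complex.I * (-c) / 4) +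
      q * Complex.cosh (z / 2 + Complex.I * (-c) / 4)) +
    Complex.sinh (z + Complex.I * (-c) / 4) * (Complex.sinh (z / 2 + Complex.I * c / 4) +
      q * Complex.cosh (z / 2 + Complex.I * c / 4)) = limitDet c z + q * limitLayer c z := by
  have e1 : Complex.cosh (3 * z / 2) = Complex.cosh ((z + Complex.I * c / 4) +
    (z / 2 + Complex.I * (-c) / 4)) := by congr 1; ring
  have e1' : Complex.cosh (3 * z / 2) = Complex.cosh ((z + Complex.I * (-c) / 4) +
    (z / 2 + Complex.I * c / 4)) := by congr 1; ring
  have e2 : Complex.sinh (3 * z / 2) = Complex.sinh ((z + Complex.I * c / 4) +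
    (z / 2 + Complex.I * (-c) / 4)) := by congr 1; ring
  have e2' : Complex.sinh (3 * z / 2) = Complex.sinh ((z + Complex.I * (-c) / 4) +
    (z / 2 + Complex.I * c / 4)) := by congr 1; ring
  have hc : ((Real.cos (c / 2) : ℝ) : ℂ) = Complex.cosh (Complex.I * c / 2) := by
    rw [Complex.ofReal_cos, ← Complex.cosh_mul_I]; push_cast; congr 1; ring
  have f1 : Complex.cosh (z / 2 + Complex.I * c / 2) = Complex.cosh ((z + Complex.I * c / 4) -
    (z / 2 + Complex.I * (-c) / 4)) := by congr 1; ring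
  have f1' : Complex.cosh (z / 2 - Complex.I * c / 2) = Complex.cosh ((z + Complex.I * (-c) / 4) -
    (z / 2 + Complex.I * c / 4)) := by congr 1; ring
  have f2 : Complex.sinh (z / 2 + Complex.I * c / 2) = Complex.sinh ((z + Complex.I * c / 4) -
    (z / 2 + Complex.I * (-c) / 4)) := by congr 1; ring
  have f2' : Complex.sinh (z / 2 - Complex.I * c / 2) = Complex.sinh ((z + Complex.I * (-c) / 4) -
    (z / 2 + Complex.I * c / 4)) := by congr 1; ring
  rw [limitDet, limitLayer, hc]
  rw [Complex.cosh_add] at e1 e1'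
  rw [Complex.sinh_add] at e2 e2'
  rw [Complex.cosh_add, Complex.cosh_sub] at f1
  rw [Complex.cosh_sub, Complex.cosh_sub] at f1'
  rw [Complex.sinh_add, Complex.sinh_sub] at f2
  rw [Complex.sinh_sub, Complex.sinh_sub] at f2'
  linear_combination -(e1 + e1') / 2 - q * (e2 + e2') / 2 + (f1 + f1') / 2 - q * (f2 + f2') / 2

/-! ### Expansion of the normalized determinant and of its derivative -/

section DetDeriv
variable (c r : ℝ)

theorem stripApprox_detNorm :
    StripApprox r 2 (detNorm c) fun z => limitDet c z + invSqrt z * limitLayer c z := by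
  have h := ((stripApprox_oscNorm c r).mul (stripApprox_layerNorm (-c) r)).add
    ((stripApprox_oscNorm (-c) r).mul (stripApprox_layerNorm c r))
  refine h.congr EventuallyEq.rfl (Eventually.of_forall fun z => ?_)
  have := limit_expand c z (invSqrt z)
  dsimp only
  push_cast
  exact this

theorem hasDerivAt_csqrt {z : ℂ} (hz : z ∈ Complex.slitPlane) :
    HasDerivAt csqrt (1 / (2 * csqrt z)) z := by
  have h := (differentiableAt_csqrt hz).hasDerivAt
  have hn := csqrt_ne_zero (Complex.slitPlane_ne_zero hz)
  have e := (h.pow 2).unique ((hasDerivAt_id z).congr_of_eventuallyEq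
    (Eventually.of_forall fun w => csqrt_sq w))
  refine h.congr_deriv ?_
  field_simp
  simpa [mul_comm, mul_assoc, mul_left_comm] using e

theorem hasDerivAt_invSqrt {z : ℂ} (hz : z ∈ Complex.slitPlane) :
    HasDerivAt invSqrt (-invSqrt z ^ 3 / 2) z := by
  have hn := csqrt_ne_zero (Complex.slitPlane_ne_zero hz)
  refine ((hasDerivAt_csqrt hz).inv hn).congr_deriv ?_
  rw [invSqrt]
  field_simp

/-- Good points are good together with a unit ball. -/
theorem eventually_charGood_ball :
    ∀ᶠ z in stripFilter r, ∀ w ∈ Metric.closedBall z 1, CharGood c w :=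
  eventually_stripFilter_forall_closedBall (eventually_charGood c (r + 1))

theorem eventually_charGood_nhds : ∀ᶠ z in stripFilter r, ∀ᶠ w in 𝓝 z, CharGood c w := by
  filter_upwards [eventually_charGood_ball c r] with z hz
  filter_upwards [Metric.closedBall_mem_nhds z one_pos] with w hw using hz w hw

theorem differentiableAt_layerDenom {c : ℝ} {z : ℂ} (h : CharGood c z) : DifferentiableAt ℂ
    (fun z => z * ((1 + z) * charS₂ c z * Complex.cosh (charS₂ c z / 2))) z := by
  have := h.differentiableAt_S₂
  have h2 : DifferentiableAt ℂ (fun z => Complex.cosh (charS₂ c z / 2)) z :=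
    (this.div_const 2).ccosh
  fun_prop

theorem differentiableAt_detNorm {c : ℝ} {z : ℂ} (h : ∀ᶠ w in 𝓝 z, CharGood c w) :
    DifferentiableAt ℂ (detNorm c) z := by
  have h0 := h.self_of_nhds
  rw [show detNorm c = _ from funext (detNorm_eq c)]
  exact (hasDerivAt_detFun h).differentiableAt.div (differentiableAt_layerDenom h0)
    (mul_ne_zero h0.ne_zero h0.layerDenom_ne)

/-- Cauchy's estimate along a strip. -/
theorem deriv_isBigO_strip {r : ℝ} {k : ℕ} {f : ℂ → ℂ}
    (hd : ∀ᶠ z in stripFilter (r + 1), DifferentiableAt ℂ f z)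
    (hf : f =O[stripFilter (r + 1)] fun z => invSqrt z ^ (2 * k)) :
    deriv f =O[stripFilter r] fun z => invSqrt z ^ (2 * k) := by
  obtain ⟨K, hK, hb⟩ := hf.exists_pos
  -- On the unit circle about z one has |w| ≥ |z| - 1 ≥ |z|/2 as soon as |z| ≥ 2, so each power of
  -- 1/|w| costs a factor 2.
  refine IsBigO.of_bound (K * 2 ^ k) ?_
  filter_upwards [eventually_stripFilter_forall_closedBall (hd.and hb.bound),
    (tendsto_norm_stripFilter r).eventually_ge_atTop 2] with z hz h2
  have hmem : ∀ w ∈ Metric.sphere z 1, ‖f w‖ ≤ K * 2 ^ k * ‖invSqrt z ^ (2 * k)‖ := by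
    intro w hw
    refine ((hz w (Metric.sphere_subset_closedBall hw)).2).trans ?_
    rw [mul_assoc]
    gcongr
    rw [pow_mul, pow_mul, invSqrt_sq, invSqrt_sq, norm_pow, norm_pow, ← mul_pow]
    gcongr
    rw [norm_inv, norm_inv, ← div_eq_mul_inv]
    have h3 : ‖z‖ ≤ ‖w‖ + 1 := by
      have : ‖w - z‖ = 1 := by rw [← dist_eq_norm]; exact hw
      have := norm_sub_norm_le z w
      rw [norm_sub_rev] at this
      linarith
    rw [inv_eq_one_div, div_le_div_iff₀ (by linarith) (by linarith)]
    linarith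
  have := Complex.norm_deriv_le_of_forall_mem_sphere_norm_le one_pos
    (DifferentiableOn.diffContOnCl (fun w hw => ?_)) hmem
  · simpa using this
  · refine (hz w ?_).1.differentiableWithinAt
    rwa [closure_ball _ one_ne_zero] at hw

theorem limit_isBigO_one :
    (limitDet c =O[stripFilter r] fun _ => (1 : ℂ)) ∧
    (limitLayer c =O[stripFilter r] fun _ => (1 : ℂ)) ∧
    (limitLayerDeriv c =O[stripFilter r] fun _ => (1 : ℂ)) := by
  have h3 := hyperbolic_isBigO_one r (3 / 2) 0
  have h1 := hyperbolic_isBigO_one r (1 / 2) 0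
  have e3 : ∀ z : ℂ, ((3 / 2 : ℝ) : ℂ) * z + Complex.I * ((0 : ℝ) : ℂ) = 3 * z / 2 :=
    fun z => by push_cast; ring
  have e1 : ∀ z : ℂ, ((1 / 2 : ℝ) : ℂ) * z + Complex.I * ((0 : ℝ) : ℂ) = z / 2 :=
    fun z => by push_cast; ring
  simp only [e3, e1] at h3 h1
  have k : (fun _ : ℂ => ((Real.cos (c / 2) : ℝ) : ℂ)) =O[stripFilter r] fun _ => (1 : ℂ) :=
    isBigO_const_const _ one_ne_zero _
  have kc := h1.2.mul k
  have ks := h1.1.mul k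
  simp only [one_mul] at kc ks
  exact ⟨h3.2.sub kc, h3.1.add ks, ((h3.2.const_mul_left (3 / 2)).add
    (kc.const_mul_left (1 / 2))).congr_left fun z => by rw [limitLayerDeriv]; ring⟩

/-- The error in a strip wider by one is O(1/z), and Cauchy's estimate on unit circles transfers
this to its derivative. The derivative of z^(-1/2) has order z^(-3/2) and is absorbed. -/
theorem deriv_detNorm_sub :
    (fun z => deriv (detNorm c) z - (limitDetDeriv c z + invSqrt z * limitLayerDeriv c z))
      =O[stripFilter r] fun z => invSqrt z ^ 2 := by
  have hL : ∀ z ∈ Complex.slitPlane,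
      HasDerivAt (fun z => limitDet c z + invSqrt z * limitLayer c z)
      (limitDetDeriv c z + (-invSqrt z ^ 3 / 2 * limitLayer c z + invSqrt z * limitLayerDeriv c z))
      z := fun z hz =>
    (hasDerivAt_limitDet c z).add ((hasDerivAt_invSqrt hz).mul (hasDerivAt_limitLayer c z))
  have h1 := deriv_isBigO_strip (k := 1) (r := r) (f := fun z => detNorm c z -
    (limitDet c z + invSqrt z * limitLayer c z)) ?_ (stripApprox_detNorm c (r + 1)).sub
  · have h2 : (fun z => limitLayer c z * invSqrt z ^ 3 * (-1 / 2)) =O[stripFilter r]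
        fun z => invSqrt z ^ 2 := by
      have := (isBigO_mul_invSqrt 3 (limit_isBigO_one c r).2.1).trans
        (invSqrt_pow_isBigO (show 2 ≤ 3 by norm_num))
      exact (this.const_mul_left (-1 / 2)).congr_left fun z => by ring
    refine (h1.add h2).congr' ?_ EventuallyEq.rfl
    filter_upwards [eventually_charGood_nhds c r] with z hz
    have e := (differentiableAt_detNorm hz).hasDerivAt.sub (hL z hz.self_of_nhds.slit)
    have e' := e.deriv
    change deriv (fun z => detNorm c z - (limitDet c z + invSqrt z * limitLayer c z)) z = _ at e'
    rw [e']
    ring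
  · filter_upwards [eventually_charGood_nhds c (r + 1)] with z hz
    exact (differentiableAt_detNorm hz).sub (hL z hz.self_of_nhds.slit).differentiableAt

end DetDeriv

/-! ### The characteristic determinant -/

/-- Linearity in the last column. After multiplication by ω the powers of t in that column can be
reduced by `CharGood.et₂`. -/
theorem det_fin_four_smul_col (ω : ℂ) (m : Fin 4 → Fin 4 → ℂ) :
    ω * (Matrix.of ![![m 0 0, m 0 1, m 0 2, m 0 3], ![m 1 0, m 1 1, m 1 2, m 1 3],
      ![m 2 0, m 2 1, m 2 2, m 2 3], ![m 3 0, m 3 1, m 3 2, m 3 3]]).det =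
    (Matrix.of ![![m 0 0, m 0 1, m 0 2, ω * m 0 3], ![m 1 0, m 1 1, m 1 2, ω * m 1 3],
      ![m 2 0, m 2 1, m 2 2, ω * m 2 3], ![m 3 0, m 3 1, m 3 2, ω * m 3 3]]).det := by
  simp [Matrix.det_succ_row_zero, Fin.sum_univ_succ, Fin.succAbove]
  ring

/-- By the dispersion relations, row three minus z² times row one and row four minus z² times row
two are icz times rows in which the two left modes carry the factors 1 and -1. Adding and
subtracting these from the first two rows separates the left modes, and the determinant collapses to
the interface determinant. The exponential comes from 1 ∓ exp(-t) = 2 exp(-t/2) times sinh(t/2) or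
cosh(t/2). -/
theorem charDet_eq {c : ℝ} {z : ℂ} (h : CharGood c z) : charOmega c z * charDet c z =
    -2 * (Complex.I * c * z) ^ 2 * Complex.exp (-(charS₂ c z / 2)) * detFun c z := by
  have x1 : 1 - Complex.exp (-charS₂ c z) =
      2 * Complex.exp (-(charS₂ c z / 2)) * Complex.sinh (charS₂ c z / 2) := by
    rw [mul_right_comm, Complex.two_sinh, sub_mul, ← Complex.exp_add, ← Complex.exp_add]
    congr 1
    · simp
    · congr 1; ring
  have x2 : 1 + Complex.exp (-charS₂ c z) =
      2 * Complex.exp (-(charS₂ c z / 2)) * Complex.cosh (charS₂ c z / 2) := by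
    rw [mul_right_comm, Complex.two_cosh, add_mul, ← Complex.exp_add, ← Complex.exp_add]
    congr 1
    · simp
    · congr 1; ring
  have ea := h.ea
  have eb := h.eb
  have es := h.es
  have et₂ := h.et₂
  have eω : charOmega c z = (1 + z) * charSigma c z := rfl
  rw [charDet, charMatrix, charR₂_eq, x1, x2]
  simp only [detFun, oscFun, layerFun, charS₁_neg, charS₂_neg, charSigma_neg, charOmega_neg,
    oscCoeff, layerCoeff]
  generalize charR₁ c z = a at *
  generalize charR₁ (-c) z = b at *
  generalize charS₁ c z = s at *
  generalize charS₂ c z = t at *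
  generalize charSigma c z = σ at *
  generalize charOmega c z = ω at *
  generalize Complex.exp (-(t / 2)) = ε
  generalize Complex.cosh (t / 2) = Ct
  generalize Complex.sinh (t / 2) = St
  generalize Complex.cosh (a / 2) = Ca
  generalize Complex.sinh (a / 2) = Sa
  generalize Complex.cosh (b / 2) = Cb
  generalize Complex.sinh (b / 2) = Sb
  generalize Complex.cosh (s / 2) = Cs
  generalize Complex.sinh (s / 2) = Ss
  have k := det_fin_four_smul_col ω ![![Sa, Sb, Ss, 2 * ε * St],
    ![a * Ca, b * Cb, -s * Cs, -t * (2 * ε * Ct)],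
    ![a ^ 2 * Sa, b ^ 2 * Sb, s ^ 2 * Ss, t ^ 2 * (2 * ε * St)],
    ![a ^ 3 * Ca, b ^ 3 * Cb, -s * (s ^ 2 - z * (z ^ 2 - s ^ 2)) * Cs,
      -t * (t ^ 2 - z * (z ^ 2 - t ^ 2)) * (2 * ε * Ct)]]
  refine k.trans ?_
  have k3 : ω * (t ^ 2 * (2 * ε * St)) = (ω * z ^ 2 - Complex.I * c * z) * (2 * ε * St) := by
    rw [← et₂]; ring
  have k4 : ω * (-t * (t ^ 2 - z * (z ^ 2 - t ^ 2)) * (2 * ε * Ct)) =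
      -t * (ω * z ^ 2 - Complex.I * c * z * (1 + z)) * (2 * ε * Ct) := by
    linear_combination (-t * (2 * ε * Ct)) * (1 + z) * et₂
  have a3 : a ^ 3 * Ca = a * (z ^ 2 + Complex.I * c * z) * Ca := by rw [← ea]; ring
  have b3 : b ^ 3 * Cb = b * (z ^ 2 - Complex.I * c * z) * Cb := by rw [← eb]; ring
  simp only [Matrix.cons_val]
  rw [k3, k4, a3, b3, ea, eb, es, eω]
  generalize Complex.I * (c : ℂ) = κ
  simp [Matrix.det_succ_row_zero, Fin.sum_univ_succ, Fin.succAbove]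
  ring

/-- Simple zeros are preserved under multiplication by nonvanishing functions. -/
theorem simple_zero_of_mul_eq {f g u v : ℂ → ℂ} {z : ℂ} (h : ∀ᶠ w in 𝓝 z, u w * f w = v w * g w)
    (hf : DifferentiableAt ℂ f z) (hg : DifferentiableAt ℂ g z) (hu : DifferentiableAt ℂ u z)
    (hv : DifferentiableAt ℂ v z) (hu0 : u z ≠ 0) (hv0 : v z ≠ 0) (h0 : g z = 0)
    (h1 : deriv g z ≠ 0) : f z = 0 ∧ deriv f z ≠ 0 := by
  have e := h.self_of_nhds
  rw [h0, mul_zero] at e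
  have f0 := (mul_eq_zero.1 e).resolve_left hu0
  refine ⟨f0, fun f1 => ?_⟩
  have d := (hu.hasDerivAt.mul hf.hasDerivAt).unique
    ((hv.hasDerivAt.mul hg.hasDerivAt).congr_of_eventuallyEq h)
  rw [f0, h0, f1] at d
  simp only [mul_zero, zero_add] at d
  exact mul_ne_zero hv0 h1 d.symm

theorem detFun_simple_zero {c : ℝ} {z : ℂ} (h : ∀ᶠ w in 𝓝 z, CharGood c w)
    (h0 : detNorm c z = 0) (h1 : deriv (detNorm c) z ≠ 0) :
    detFun c z = 0 ∧ deriv (detFun c) z ≠ 0 := by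
  have hg := h.self_of_nhds
  refine simple_zero_of_mul_eq (u := fun _ => 1) (g := detNorm c) ?_
    (hasDerivAt_detFun h).differentiableAt (differentiableAt_detNorm h)
    (differentiableAt_const 1) (differentiableAt_layerDenom hg) one_ne_zero
    (mul_ne_zero hg.ne_zero hg.layerDenom_ne) h0 h1
  filter_upwards [h] with w hw
  have := mul_ne_zero hw.ne_zero hw.layerDenom_ne
  rw [detNorm_eq, one_mul, mul_div_cancel₀ _ this]

/-- All factors relating the determinants are nonzero once c ≠ 0. For c = 0 the first two columns
coincide and the characteristic determinant vanishes identically. -/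
theorem charDet_order {c : ℝ} (hc : c ≠ 0) {z : ℂ} (h : ∀ᶠ w in 𝓝 z, CharGood c w)
    (h0 : detNorm c z = 0) (h1 : deriv (detNorm c) z ≠ 0) :
    analyticOrderAt (charDet c) z = 1 := by
  have hc' : (c : ℂ) ≠ 0 := Complex.ofReal_ne_zero.2 hc
  have hω : ∀ w, CharGood c w → charOmega c w ≠ 0 := fun w hw =>
    mul_ne_zero hw.one_add (div_ne_zero (mul_ne_zero (mul_ne_zero two_ne_zero Complex.I_ne_zero) hc')
      (mul_ne_zero (pow_ne_zero 2 hw.ne_zero) hw.one_add_delta))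
  have hv : ∀ w, CharGood c w → DifferentiableAt ℂ (fun z : ℂ =>
      -2 * (Complex.I * c * z) ^ 2 * Complex.exp (-(charS₂ c z / 2))) w := fun w hw => by
    have := hw.differentiableAt_S₂
    have h2 : DifferentiableAt ℂ (fun z => Complex.exp (-(charS₂ c z / 2))) w :=
      (this.div_const 2).neg.cexp
    fun_prop
  have hd : ∀ᶠ w in 𝓝 z, DifferentiableAt ℂ (charDet c) w := by
    filter_upwards [eventually_eventually_nhds.2 h] with w hw
    have hg := hw.self_of_nhds
    have := ((hv w hg).mul (hasDerivAt_detFun hw).differentiableAt).div hg.differentiableAt_omega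
      (hω w hg)
    refine this.congr_of_eventuallyEq ?_
    filter_upwards [hw] with x hx
    exact eq_div_of_mul_eq (hω x hx) ((mul_comm _ _).trans (charDet_eq hx))
  have hg := h.self_of_nhds
  obtain ⟨g0, g1⟩ := detFun_simple_zero h h0 h1
  obtain ⟨f0, f1⟩ := simple_zero_of_mul_eq (h.mono fun w hw => charDet_eq hw) hd.self_of_nhds
    (hasDerivAt_detFun h).differentiableAt hg.differentiableAt_omega (hv z hg) (hω z hg)
    (mul_ne_zero (mul_ne_zero (neg_ne_zero.2 two_ne_zero) (pow_ne_zero 2 (mul_ne_zero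
      (mul_ne_zero Complex.I_ne_zero hc') hg.ne_zero))) (Complex.exp_ne_zero _)) g0 g1
  exact (Complex.analyticAt_iff_eventually_differentiableAt.2
    hd).analyticOrderAt_eq_one_of_zero_deriv_ne_zero f0 f1

theorem isSimpleEigenvalue_of_detNorm {c : ℝ} {z : ℂ} (h : ∀ᶠ w in 𝓝 z, CharGood c w)
    (h0 : detNorm c z = 0) (h1 : deriv (detNorm c) z ≠ 0) :
    IsSimpleEigenvalue (localGenerator c) z :=
  isSimpleEigenvalue_of_detFun h (detFun_simple_zero h h0 h1).1 (detFun_simple_zero h h0 h1).2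

/-! ### Locating zeros -/

/-- A zero of `f` near a point at which `f` is small compared with its nearly constant derivative. -/
theorem exists_zero_near {f : ℂ → ℂ} {p A : ℂ} (hA : A ≠ 0)
    (h : ∀ w ∈ Metric.closedBall p (2 * ‖f p‖ / ‖A‖),
      DifferentiableAt ℂ f w ∧ ‖deriv f w - A‖ ≤ ‖A‖ / 2) :
    ∃ z ∈ Metric.closedBall p (2 * ‖f p‖ / ‖A‖), f z = 0 ∧ deriv f z ≠ 0 := by
  set R := 2 * ‖f p‖ / ‖A‖ with hR
  have hAn : 0 < ‖A‖ := norm_pos_iff.2 hA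
  have hR0 : 0 ≤ R := by positivity
  have hp : p ∈ Metric.closedBall p R := Metric.mem_closedBall_self hR0
  -- The simplified Newton map w - f(w)/A has derivative of size at most 1/2 on the ball. As R is
  -- twice the length of its first step, the ball is mapped into itself and the contraction
  -- principle applies.
  have hd : ∀ w ∈ Metric.closedBall p R, HasDerivWithinAt (fun w => w - f w / A)
      (1 - deriv f w / A) (Metric.closedBall p R) w := fun w hw =>
    ((hasDerivAt_id w).sub ((h w hw).1.hasDerivAt.div_const A)).hasDerivWithinAt
  have hb : ∀ w ∈ Metric.closedBall p R, ‖1 - deriv f w / A‖₊ ≤ (1 / 2 : NNReal) := fun w hw => by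
    rw [← NNReal.coe_le_coe, coe_nnnorm, show 1 - deriv f w / A = -(deriv f w - A) / A by
      field_simp; ring, norm_div, norm_neg, div_le_iff₀ hAn]
    have := (h w hw).2
    push_cast
    linarith
  have hl := (convex_closedBall p R).lipschitzOnWith_of_nnnorm_hasDerivWithin_le hd hb
  have hc : ∀ w ∈ Metric.closedBall p R, ‖w - f w / A - (p - f p / A)‖ ≤ 1 / 2 * ‖w - p‖ :=
    fun w hw => by
      have := hl.dist_le_mul w hw p hp
      rw [dist_eq_norm, dist_eq_norm] at this
      simpa using this
  have hfp : ‖f p / A‖ = R / 2 := by rw [norm_div, hR]; ring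
  have hm : MapsTo (fun w => w - f w / A) (Metric.closedBall p R) (Metric.closedBall p R) := by
    intro w hw
    have h1 := hc w hw
    rw [mem_closedBall_iff_norm] at hw ⊢
    have : w - f w / A - p = (w - f w / A - (p - f p / A)) - f p / A := by ring
    rw [this]
    refine (norm_sub_le _ _).trans ?_
    rw [hfp]
    linarith
  have hK : ContractingWith (1 / 2 : NNReal) (hm.restrict _ _ _) := by
    refine ⟨by rw [← NNReal.coe_lt_coe]; push_cast; norm_num, ?_⟩
    exact fun x y => lipschitzOnWith_iff_restrict.1 hl x y
  obtain ⟨z, hz, hfix, -⟩ := hK.exists_fixedPoint' Metric.isClosed_closedBall.isComplete hm hp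
    (edist_ne_top _ _)
  refine ⟨z, hz, ?_, fun h0 => ?_⟩
  · have : z - f z / A = z := hfix
    have h2 : f z / A = 0 := by linear_combination -this
    exact (div_eq_zero_iff.1 h2).resolve_right hA
  · have := (h z hz).2
    rw [h0, zero_sub, norm_neg] at this
    linarith

/-- Sequences of zeros near sequences of approximate zeros. -/
theorem exists_zeros {f : ℂ → ℂ} {p A : ℤ → ℂ} {g : ℤ → ℝ} (hA : ∀ᶠ n in cofinite, A n ≠ 0)
    (hf : (fun n => f (p n)) =O[cofinite] fun n => A n * g n)
    (hd : ∀ K : ℝ, ∀ᶠ n in cofinite, ∀ w, ‖w - p n‖ ≤ K * ‖g n‖ →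
      DifferentiableAt ℂ f w ∧ ‖deriv f w - A n‖ ≤ ‖A n‖ / 2) :
    ∃ lam : ℤ → ℂ, (∀ᶠ n in cofinite, f (lam n) = 0 ∧ deriv f (lam n) ≠ 0) ∧
      (fun n => lam n - p n) =O[cofinite] g := by
  obtain ⟨K, hK⟩ := hf.bound
  have key : ∀ᶠ n in cofinite, ∃ z, (f z = 0 ∧ deriv f z ≠ 0) ∧ ‖z - p n‖ ≤ 2 * K * ‖g n‖ := by
    filter_upwards [hA, hK, hd (2 * K)] with n h1 h2 h3
    have hAn : 0 < ‖A n‖ := norm_pos_iff.2 h1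
    have hr : 2 * ‖f (p n)‖ / ‖A n‖ ≤ 2 * K * ‖g n‖ := by
      rw [div_le_iff₀ hAn]
      rw [norm_mul, Complex.norm_real] at h2
      linarith
    obtain ⟨z, hz, h4⟩ := exists_zero_near h1 fun w hw =>
      h3 w ((mem_closedBall_iff_norm.1 hw).trans hr)
    exact ⟨z, h4, (mem_closedBall_iff_norm.1 hz).trans hr⟩
  classical
  -- The value 0 fills in the finitely many n for which no zero is provided.
  refine ⟨fun n => if h : ∃ z, (f z = 0 ∧ deriv f z ≠ 0) ∧ ‖z - p n‖ ≤ 2 * K * ‖g n‖ then h.choose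
    else 0, ?_, IsBigO.of_bound (2 * K) ?_⟩
  · filter_upwards [key] with n hn
    rw [dif_pos hn]
    exact hn.choose_spec.1
  · filter_upwards [key] with n hn
    rw [dif_pos hn]
    exact hn.choose_spec.2

/-! ### Sequences along the imaginary axis -/

/-- The points `2 π i n`. -/
noncomputable def latticePoint (n : ℤ) : ℂ := 2 * n * Real.pi * Complex.I

/-- The principal value of `1 / √(2 π i n)`. -/
noncomputable def layerSeq (n : ℤ) : ℂ := (1 - Complex.I * (n.sign : ℂ)) / (2 * √(|(n : ℝ)| * Real.pi))

theorem norm_latticePoint (n : ℤ) : ‖latticePoint n‖ = 2 * |(n : ℝ)| * Real.pi := by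
  simp [latticePoint, abs_of_pos Real.pi_pos]

theorem tendsto_abs_cofinite : Tendsto (fun n : ℤ => |(n : ℝ)|) cofinite atTop := by
  exact tendsto_norm_cocompact_atTop.comp Int.tendsto_coe_cofinite

theorem tendsto_one_div_cofinite : Tendsto (fun n : ℤ => 1 / (n : ℝ)) cofinite (𝓝 0) := by
  refine tendsto_zero_iff_norm_tendsto_zero.2 (tendsto_abs_cofinite.inv_tendsto_atTop.congr
    fun n => ?_)
  rw [norm_div, norm_one, Real.norm_eq_abs, one_div]; rfl

theorem eventually_ne_zero_cofinite : ∀ᶠ n : ℤ in cofinite, n ≠ 0 := by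
  filter_upwards [tendsto_abs_cofinite.eventually_gt_atTop 0] with n hn h0
  simp [h0] at hn

theorem sign_cast_sq {n : ℤ} (hn : n ≠ 0) : (n.sign : ℝ) ^ 2 = 1 := by
  rcases lt_or_gt_of_ne hn with h | h
  · simp [Int.sign_eq_neg_one_of_neg h]
  · simp [Int.sign_eq_one_of_pos h]

theorem sign_cast_mul_abs (n : ℤ) : (n.sign : ℝ) * |(n : ℝ)| = n := by
  have := Int.sign_mul_abs n
  exact_mod_cast this

theorem layerSeq_eq (n : ℤ) : layerSeq n = (1 / (2 * √(|(n : ℝ)| * Real.pi)) : ℝ) *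
    (1 - Complex.I * ((n.sign : ℝ) : ℂ)) := by
  rw [layerSeq]; push_cast; ring

theorem layerSeq_re (n : ℤ) : (layerSeq n).re = 1 / (2 * √(|(n : ℝ)| * Real.pi)) := by
  rw [layerSeq_eq, Complex.re_ofReal_mul]
  simp

/-- Here (1 - i sign n)² = -2i sign n, and division by 4π|n| gives 1/(2πin). -/
theorem layerSeq_sq {n : ℤ} (hn : n ≠ 0) : layerSeq n ^ 2 = (latticePoint n)⁻¹ := by
  have hr : (0:ℝ) < |(n : ℝ)| := by positivity
  have e1 : ((√(|(n : ℝ)| * Real.pi) : ℝ) : ℂ) ^ 2 = ((|(n : ℝ)| * Real.pi : ℝ) : ℂ) := by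
    rw [← Complex.ofReal_pow, Real.sq_sqrt (by positivity)]
  have e2 : ((n.sign : ℝ) : ℂ) ^ 2 = 1 := by exact_mod_cast sign_cast_sq hn
  have e3 : ((n.sign : ℝ) : ℂ) * ((|(n : ℝ)| : ℝ) : ℂ) = n := by
    exact_mod_cast sign_cast_mul_abs n
  have hn' : (n : ℂ) ≠ 0 := by exact_mod_cast hn
  have ha : ((|(n : ℝ)| : ℝ) : ℂ) ≠ 0 := by exact_mod_cast hr.ne'
  have hpi : (Real.pi : ℂ) ≠ 0 := by exact_mod_cast Real.pi_ne_zero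
  have hI := Complex.I_ne_zero
  rw [layerSeq, div_pow, mul_pow, e1, latticePoint, Complex.ofReal_mul]
  rw [show ((n.sign : ℂ)) = ((n.sign : ℝ) : ℂ) by push_cast; rfl]
  rw [inv_eq_one_div, div_eq_div_iff (by simp [ha, hpi]) (by simp [hn', hpi]), ← e3]
  linear_combination (2 * Complex.I * Real.pi * ((n.sign : ℝ) : ℂ) * ((|(n : ℝ)| : ℝ) : ℂ)) *
    (Complex.I_sq * ((n.sign : ℝ) : ℂ) ^ 2 - e2) -
    4 * ((|(n : ℝ)| : ℝ) : ℂ) * Real.pi * (((n.sign : ℝ) : ℂ) ^ 2 * Complex.I_sq - e2)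

theorem layerSeq_ne_zero {n : ℤ} (hn : n ≠ 0) : layerSeq n ≠ 0 := fun h => by
  have := layerSeq_sq hn
  rw [h, latticePoint] at this
  have hn' : (n : ℂ) ≠ 0 := by exact_mod_cast hn
  have hpi : (Real.pi : ℂ) ≠ 0 := by exact_mod_cast Real.pi_ne_zero
  have : (2 * n * Real.pi * Complex.I : ℂ)⁻¹ ≠ 0 :=
    inv_ne_zero (mul_ne_zero (mul_ne_zero (mul_ne_zero two_ne_zero hn') hpi) Complex.I_ne_zero)
  simp_all

/-- The real part is a fixed proportion of the modulus, so adding a number of nonnegative real part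
cannot cancel it. This fixes the branch in `invSqrt_sub_layerSeq`. -/
theorem norm_layerSeq_le {n : ℤ} (hn : n ≠ 0) : ‖layerSeq n‖ ≤ 2 * (layerSeq n).re := by
  rw [layerSeq_re, layerSeq_eq, norm_mul, Complex.norm_real, Real.norm_of_nonneg (by positivity),
    mul_comm]
  gcongr
  refine (norm_sub_le _ _).trans ?_
  rw [norm_mul, Complex.norm_real, Complex.norm_I, norm_one, one_mul, Real.norm_eq_abs]
  rcases (sq_eq_sq_iff_eq_or_eq_neg.1 ((sign_cast_sq hn).trans (one_pow 2).symm)) with h | h <;> norm_num [h]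

theorem norm_layerSeq_sq {n : ℤ} (hn : n ≠ 0) : ‖layerSeq n‖ ^ 2 = 1 / (2 * |(n : ℝ)| * Real.pi) := by
  rw [← norm_pow, layerSeq_sq hn, norm_inv, norm_latticePoint, one_div]

theorem layerSeq_sq_isBigO :
    (fun n => layerSeq n ^ 2) =O[cofinite] fun n : ℤ => 1 / (n : ℝ) := by
  refine IsBigO.of_bound 1 ?_
  filter_upwards [eventually_ne_zero_cofinite] with n hn
  have hr : (0:ℝ) < |(n : ℝ)| := by positivity
  rw [norm_pow, norm_layerSeq_sq hn, norm_div, norm_one, Real.norm_eq_abs, one_mul]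
  gcongr
  nlinarith [Real.pi_gt_three]

theorem layerSeq_pow_five_isBigO :
    (fun n => layerSeq n ^ 5) =O[cofinite] fun n : ℤ => 1 / |(n : ℝ)| ^ (5 / 2 : ℝ) := by
  refine IsBigO.of_bound 1 ?_
  filter_upwards [eventually_ne_zero_cofinite] with n hn
  have hr : (0:ℝ) < |(n : ℝ)| := by positivity
  have h1 : ‖layerSeq n‖ ≤ |(n : ℝ)| ^ (-1 / 2 : ℝ) := by
    refine (sq_le_sq₀ (norm_nonneg _) (by positivity)).1 ?_
    rw [norm_layerSeq_sq hn, ← Real.rpow_natCast, ← Real.rpow_mul hr.le]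
    norm_num
    rw [Real.rpow_neg_one, mul_comm Real.pi⁻¹]
    have : Real.pi⁻¹ ≤ 1 := inv_le_one_of_one_le₀ (by linarith [Real.pi_gt_three])
    have h0 : 0 < |(n : ℝ)|⁻¹ := by positivity
    nlinarith
  rw [one_mul, norm_pow]
  refine (pow_le_pow_left₀ (norm_nonneg _) h1 5).trans (le_of_eq ?_)
  rw [← Real.rpow_natCast, ← Real.rpow_mul hr.le, Real.norm_of_nonneg (by positivity), one_div,
    ← Real.rpow_neg hr.le]
  norm_num

theorem tendsto_layerSeq : Tendsto layerSeq cofinite (𝓝 0) := by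
  have h := (layerSeq_sq_isBigO.trans_tendsto tendsto_one_div_cofinite).norm
  rw [norm_zero] at h
  have := h.sqrt
  rw [Real.sqrt_zero] at this
  refine tendsto_zero_iff_norm_tendsto_zero.2 (this.congr fun n => ?_)
  rw [norm_pow, Real.sqrt_sq (norm_nonneg _)]

section Along
variable {α : Type*} {l : Filter α} {N : α → ℤ} {w : α → ℂ} {r : ℝ}

theorem tendsto_stripFilter (hN : Tendsto N l cofinite)
    (h : ∀ᶠ x in l, ‖w x - latticePoint (N x)‖ ≤ r) : Tendsto w l (stripFilter r) := by
  rw [tendsto_iff_eventually]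
  intro P hP
  obtain ⟨R, hR⟩ := eventually_stripFilter.1 hP
  filter_upwards [h, (tendsto_abs_cofinite.comp hN).eventually_ge_atTop (R + r)] with x h1 h2
  have i1 := (Complex.abs_im_le_norm _).trans h1
  have i2 := (Complex.abs_re_le_norm _).trans h1
  have e1 : (latticePoint (N x)).im = 2 * N x * Real.pi := by simp [latticePoint]
  have e2 : (latticePoint (N x)).re = 0 := by simp [latticePoint]
  rw [Complex.sub_im, e1] at i1
  rw [Complex.sub_re, e2, sub_zero] at i2
  refine hR _ ?_ i2
  have h3 := abs_sub_abs_le_abs_sub (2 * N x * Real.pi) (w x).im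
  rw [abs_sub_comm, abs_mul, abs_mul, abs_of_pos Real.pi_pos, abs_two] at h3
  have h4 : R + r ≤ |(N x : ℝ)| := h2
  have := mul_le_mul_of_nonneg_left (show (1:ℝ) ≤ Real.pi by linarith [Real.pi_gt_three])
    (abs_nonneg (N x : ℝ))
  have := abs_nonneg (N x : ℝ)
  linarith

theorem invSqrt_re_nonneg (z : ℂ) : 0 ≤ (invSqrt z).re := by
  rw [invSqrt, Complex.inv_re]
  exact div_nonneg (csqrt_re_nonneg z) (Complex.normSq_nonneg _)

/-- The squares 1/w and 1/(2πin) differ by O(n^(-2)). Dividing by the sum of the roots, which is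
bounded below because both lie in the right half plane, leaves order |n|^(-3/2). -/
theorem invSqrt_sub_layerSeq (hN : Tendsto N l cofinite)
    (h : ∀ᶠ x in l, ‖w x - latticePoint (N x)‖ ≤ r) :
    (fun x => invSqrt (w x) - layerSeq (N x)) =O[l] fun x => layerSeq (N x) ^ 3 := by
  refine IsBigO.of_bound (4 * r) ?_
  filter_upwards [h, (tendsto_abs_cofinite.comp hN).eventually_gt_atTop r,
    hN.eventually eventually_ne_zero_cofinite, (tendsto_abs_cofinite.comp hN).eventually_gt_atTop 0]
    with x h1 h2 h3 h0
  have h2 : r < |(N x : ℝ)| := h2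
  have h0 : 0 < |(N x : ℝ)| := h0
  have hr : 0 ≤ r := (norm_nonneg _).trans h1
  have hq := norm_latticePoint (N x)
  have hq0 : 0 < ‖latticePoint (N x)‖ := by rw [hq]; have := Real.pi_pos; positivity
  have hq2 : 2 * r ≤ ‖latticePoint (N x)‖ := by
    rw [hq]; nlinarith [Real.pi_gt_three]
  have hw : ‖latticePoint (N x)‖ / 2 ≤ ‖w x‖ := by
    have := norm_sub_norm_le (latticePoint (N x)) (w x)
    rw [norm_sub_rev] at this
    linarith
  have hw0 : 0 < ‖w x‖ := by linarith
  set e := layerSeq (N x) with he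
  have he0 : 0 < ‖e‖ := norm_pos_iff.2 (layerSeq_ne_zero h3)
  have hsq : ‖invSqrt (w x) ^ 2 - e ^ 2‖ ≤ 2 * r * ‖e‖ ^ 4 := by
    have e4 : ‖e‖ ^ 4 = ‖latticePoint (N x)‖⁻¹ ^ 2 := by
      rw [show ‖e‖ ^ 4 = (‖e ^ 2‖) ^ 2 by rw [norm_pow]; ring, layerSeq_sq h3, norm_inv]
    rw [invSqrt_sq, layerSeq_sq h3, inv_sub_inv (norm_pos_iff.1 hw0) (norm_pos_iff.1 hq0), norm_div,
      norm_mul, e4, norm_sub_rev]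
    rw [div_le_iff₀ (by positivity)]
    have : 2 * r * ‖latticePoint (N x)‖⁻¹ ^ 2 * (‖w x‖ * ‖latticePoint (N x)‖) =
      r * (‖w x‖ / (‖latticePoint (N x)‖ / 2)) := by field_simp
    rw [this]
    have h5 : 1 ≤ ‖w x‖ / (‖latticePoint (N x)‖ / 2) := (one_le_div (by positivity)).2 hw
    nlinarith
  have hsum : ‖e‖ / 2 ≤ ‖invSqrt (w x) + e‖ := by
    refine le_trans ?_ ((le_abs_self _).trans (Complex.abs_re_le_norm _))
    rw [Complex.add_re]
    have := norm_layerSeq_le h3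
    have := invSqrt_re_nonneg (w x)
    linarith
  have hm : ‖invSqrt (w x) - e‖ * (‖e‖ / 2) ≤ 2 * r * ‖e‖ ^ 4 := by
    refine (mul_le_mul_of_nonneg_left hsum (norm_nonneg _)).trans ?_
    rw [← norm_mul, show (invSqrt (w x) - e) * (invSqrt (w x) + e) = invSqrt (w x) ^ 2 - e ^ 2 by
      ring]
    exact hsq
  rw [norm_pow]
  refine le_of_mul_le_mul_right (hm.trans (le_of_eq ?_)) (half_pos he0)
  ring

theorem layerSeq_pow_isBigO (hN : Tendsto N l cofinite) {m n : ℕ} (h : m ≤ n) :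
    (fun x => layerSeq (N x) ^ n) =O[l] fun x => layerSeq (N x) ^ m := by
  obtain ⟨k, rfl⟩ := Nat.exists_eq_add_of_le h
  have := (isBigO_refl (fun x => layerSeq (N x) ^ m) l).mul
    (((tendsto_layerSeq.comp hN).isBigO_one ℂ).pow k)
  simpa [pow_add] using this

theorem invSqrt_isBigO_layerSeq (hN : Tendsto N l cofinite)
    (h : ∀ᶠ x in l, ‖w x - latticePoint (N x)‖ ≤ r) (k : ℕ) :
    (fun x => invSqrt (w x) ^ k) =O[l] fun x => layerSeq (N x) ^ k := by
  have h1 := (invSqrt_sub_layerSeq hN h).trans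
    (layerSeq_pow_isBigO hN (show 1 ≤ 3 by norm_num))
  simp only [pow_one] at h1
  have := (h1.add (isBigO_refl (fun x => layerSeq (N x)) l)).congr_left fun x => sub_add_cancel _ _
  exact this.pow k

/-- Expansions in a strip hold along sequences close to `2 π i n`. -/
theorem comp_isBigO_layerSeq (hN : Tendsto N l cofinite)
    (h : ∀ᶠ x in l, ‖w x - latticePoint (N x)‖ ≤ r) {f : ℂ → ℂ} {k : ℕ}
    (hf : f =O[stripFilter r] fun z => invSqrt z ^ k) :
    (fun x => f (w x)) =O[l] fun x => layerSeq (N x) ^ k :=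
  (hf.comp_tendsto (tendsto_stripFilter hN h)).trans (invSqrt_isBigO_layerSeq hN h k)

end Along

/-! ### Translation by 2πin -/

theorem cosh_add_int_mul (z : ℂ) (n : ℤ) :
    Complex.cosh (z + n * Real.pi * Complex.I) = (-1) ^ n * Complex.cosh z := by
  rw [Complex.cosh_add, Complex.cosh_mul_I, Complex.sinh_mul_I,
    show (n : ℂ) * Real.pi = ((n * Real.pi : ℝ) : ℂ) by push_cast; rfl, ← Complex.ofReal_cos,
    ← Complex.ofReal_sin, Real.cos_int_mul_pi, Real.sin_int_mul_pi]
  push_cast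
  ring

theorem sinh_add_int_mul (z : ℂ) (n : ℤ) :
    Complex.sinh (z + n * Real.pi * Complex.I) = (-1) ^ n * Complex.sinh z := by
  rw [Complex.sinh_add, Complex.cosh_mul_I, Complex.sinh_mul_I,
    show (n : ℂ) * Real.pi = ((n * Real.pi : ℝ) : ℂ) by push_cast; rfl, ← Complex.ofReal_cos,
    ← Complex.ofReal_sin, Real.cos_int_mul_pi, Real.sin_int_mul_pi]
  push_cast
  ring

theorem neg_one_zpow_three_mul (n : ℤ) : (-1 : ℂ) ^ (3 * n) = (-1) ^ n := by
  rw [zpow_mul]; norm_num [zpow_ofNat]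

theorem norm_neg_one_zpow (n : ℤ) : ‖(-1 : ℂ) ^ n‖ = 1 := by simp

section Periodic
variable (c : ℝ) (z : ℂ) (n : ℤ)

theorem half_add_latticePoint :
    (z + latticePoint n) / 2 = z / 2 + n * Real.pi * Complex.I := by rw [latticePoint]; ring

theorem three_half_add_latticePoint :
    3 * (z + latticePoint n) / 2 = 3 * z / 2 + (3 * n : ℤ) * Real.pi * Complex.I := by
  rw [latticePoint]; push_cast; ring

theorem limitDet_add : limitDet c (z + latticePoint n) = (-1) ^ n * limitDet c z := by
  rw [limitDet, limitDet, half_add_latticePoint, three_half_add_latticePoint, cosh_add_int_mul,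
    cosh_add_int_mul, neg_one_zpow_three_mul]
  ring

theorem limitLayer_add : limitLayer c (z + latticePoint n) = (-1) ^ n * limitLayer c z := by
  rw [limitLayer, limitLayer, half_add_latticePoint, three_half_add_latticePoint, sinh_add_int_mul,
    sinh_add_int_mul, neg_one_zpow_three_mul]
  ring

theorem limitDetDeriv_add :
    limitDetDeriv c (z + latticePoint n) = (-1) ^ n * limitDetDeriv c z := by
  rw [limitDetDeriv, limitDetDeriv, half_add_latticePoint, three_half_add_latticePoint,
    sinh_add_int_mul, sinh_add_int_mul, neg_one_zpow_three_mul]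
  ring

theorem limitLayerDeriv_add :
    limitLayerDeriv c (z + latticePoint n) = (-1) ^ n * limitLayerDeriv c z := by
  rw [limitLayerDeriv, limitLayerDeriv, half_add_latticePoint, three_half_add_latticePoint,
    cosh_add_int_mul, cosh_add_int_mul, neg_one_zpow_three_mul]
  ring

end Periodic

/-! ### Branches of eigenvalues near approximate zeros -/

/-- Pairs `(n, w)` with `w` at distance at most `ρ n` from `p n`, as `|n| → ∞`. -/
def tubeFilter (p : ℤ → ℂ) (ρ : ℤ → ℝ) : Filter (ℤ × ℂ) :=
  comap Prod.fst cofinite ⊓ 𝓟 {x | ‖x.2 - p x.1‖ ≤ ρ x.1}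

section Tube
variable {p : ℤ → ℂ} {ρ : ℤ → ℝ} {ϑ : ℝ}

theorem eventually_tubeFilter {P : ℤ × ℂ → Prop} : (∀ᶠ x in tubeFilter p ρ, P x) ↔
    ∀ᶠ n in cofinite, ∀ w, ‖w - p n‖ ≤ ρ n → P (n, w) := by
  rw [tubeFilter, eventually_inf_principal, eventually_comap]
  constructor
  · intro h
    filter_upwards [h] with n hn w hw using hn (n, w) rfl hw
  · intro h
    filter_upwards [h] with n hn x hx hw
    subst hx
    exact hn x.2 hw

theorem tendsto_fst_tubeFilter : Tendsto Prod.fst (tubeFilter p ρ) cofinite :=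
  tendsto_comap.mono_left inf_le_left

theorem eventually_mem_tubeFilter : ∀ᶠ x in tubeFilter p ρ, ‖x.2 - p x.1‖ ≤ ρ x.1 :=
  eventually_tubeFilter.2 (Eventually.of_forall fun _ _ h => h)

theorem tendsto_sub_tubeFilter (hp : Tendsto (fun n => p n - latticePoint n) cofinite
    (𝓝 (Complex.I * ϑ))) (hρ : Tendsto ρ cofinite (𝓝 0)) :
    Tendsto (fun x : ℤ × ℂ => x.2 - latticePoint x.1) (tubeFilter p ρ) (𝓝 (Complex.I * ϑ)) := by
  have h1 : Tendsto (fun x : ℤ × ℂ => x.2 - p x.1) (tubeFilter p ρ) (𝓝 0) :=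
    squeeze_zero_norm' eventually_mem_tubeFilter (hρ.comp tendsto_fst_tubeFilter)
  have := h1.add (hp.comp tendsto_fst_tubeFilter)
  rw [zero_add] at this
  refine this.congr fun x => ?_
  simp

theorem eventually_norm_sub_le {α : Type*} {l : Filter α} {f : α → ℂ}
    (h : Tendsto f l (𝓝 (Complex.I * ϑ))) : ∀ᶠ x in l, ‖f x‖ ≤ |ϑ| + 1 := by
  have := h.norm
  simp only [norm_mul, Complex.norm_I, one_mul, Complex.norm_real, Real.norm_eq_abs] at this
  exact this.eventually_le_const (by linarith)

end Tube

/-- The spectral properties of the members of a branch of eigenvalues. -/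
def IsSimpleRoot (c : ℝ) (z : ℂ) : Prop :=
  IsSimpleEigenvalue (localGenerator c) z ∧ (c ≠ 0 → analyticOrderAt (charDet c) z = 1)

/-- Approximate zeros of the normalized determinant are close to simple eigenvalues. -/
theorem exists_branch (c : ℝ) {ϑ : ℝ} {p A : ℤ → ℂ} {g : ℤ → ℝ}
    (hp : Tendsto (fun n => p n - latticePoint n) cofinite (𝓝 (Complex.I * ϑ)))
    (hg : Tendsto g cofinite (𝓝 0)) (hA : ∀ᶠ n in cofinite, A n ≠ 0)
    (hf : (fun n => detNorm c (p n)) =O[cofinite] fun n => A n * g n)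
    (hd : ∀ K : ℝ, ∀ᶠ x in tubeFilter p (fun n => K * ‖g n‖),
      ‖deriv (detNorm c) x.2 - A x.1‖ ≤ ‖A x.1‖ / 2) :
    ∃ lam : ℤ → ℂ, (∀ᶠ n in cofinite, IsSimpleRoot c (lam n)) ∧
      (fun n => lam n - p n) =O[cofinite] g ∧ Tendsto (fun n => (lam n).re) cofinite (𝓝 0) := by
  obtain ⟨lam, h1, h2⟩ := exists_zeros hA hf fun K => by
    have hρ : Tendsto (fun n => K * ‖g n‖) cofinite (𝓝 0) := by
      simpa using hg.norm.const_mul K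
    have ht := tendsto_stripFilter tendsto_fst_tubeFilter
      (eventually_norm_sub_le (tendsto_sub_tubeFilter hp hρ))
    have := (ht.eventually (eventually_charGood_nhds c _)).and (hd K)
    filter_upwards [eventually_tubeFilter.1 this] with n hn w hw
    exact ⟨differentiableAt_detNorm (hn w hw).1, (hn w hw).2⟩
  have h3 : Tendsto (fun n => lam n - latticePoint n) cofinite (𝓝 (Complex.I * ϑ)) := by
    have := (h2.trans_tendsto hg).add hp
    rw [zero_add] at this
    exact this.congr fun n => by ring
  refine ⟨lam, ?_, h2, ?_⟩
  · filter_upwards [h1, (tendsto_stripFilter tendsto_id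
      (eventually_norm_sub_le h3)).eventually (eventually_charGood_nhds c _)] with n hn hgood
    exact ⟨isSimpleEigenvalue_of_detNorm hgood hn.1 hn.2,
      fun hc => charDet_order hc hgood hn.1 hn.2⟩
  · have := (Complex.continuous_re.tendsto _).comp h3
    simp only [Function.comp_def, Complex.sub_re] at this
    have e : ∀ n : ℤ, (latticePoint n).re = 0 := fun n => by simp [latticePoint]
    have e0 : (Complex.I * (ϑ : ℂ)).re = 0 := by simp
    simpa only [e, sub_zero, e0] using this

theorem neg_one_zpow_mul_isBigO {α : Type*} {l : Filter α} (N : α → ℤ) (u : α → ℂ) :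
    (fun x => (-1 : ℂ) ^ N x * u x) =O[l] u :=
  IsBigO.of_bound 1 (Eventually.of_forall fun x => by rw [norm_mul, norm_neg_one_zpow])

/-! ### Simple zeros of the leading term -/

section Simple
variable (c : ℝ) {ϑ : ℝ}

/-- After translation by 2πin the leading derivative is (-1)^n times its value near iϑ, while the
layer term and the error tend to zero. Hence the derivative is nearly constant on shrinking
neighbourhoods. -/
theorem deriv_detNorm_near {p : ℤ → ℂ} {ρ : ℤ → ℝ}
    (hp : Tendsto (fun n => p n - latticePoint n) cofinite (𝓝 (Complex.I * ϑ)))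
    (hρ : Tendsto ρ cofinite (𝓝 0)) (hA : limitDetDeriv c (Complex.I * ϑ) ≠ 0) :
    ∀ᶠ x in tubeFilter p ρ, ‖deriv (detNorm c) x.2 - (-1) ^ x.1 * limitDetDeriv c (Complex.I * ϑ)‖
      ≤ ‖(-1) ^ x.1 * limitDetDeriv c (Complex.I * ϑ)‖ / 2 := by
  have ht := tendsto_sub_tubeFilter hp hρ
  have hb := eventually_norm_sub_le ht
  have hN : Tendsto Prod.fst (tubeFilter p ρ) cofinite := tendsto_fst_tubeFilter
  have hs := tendsto_stripFilter hN hb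
  have t1 := (comp_isBigO_layerSeq hN hb (deriv_detNorm_sub c _)).trans_tendsto
    (by simpa using (tendsto_layerSeq.comp hN).pow 2)
  have hcont : Continuous (limitDetDeriv c) := by unfold limitDetDeriv; fun_prop
  have t2 := (neg_one_zpow_mul_isBigO (l := tubeFilter p ρ) Prod.fst _).trans_tendsto
    (((hcont.tendsto _).comp ht).sub_const (limitDetDeriv c (Complex.I * ϑ)) |>.trans
      (by rw [sub_self]))
  have t3 : Tendsto (fun x : ℤ × ℂ => invSqrt x.2 * limitLayerDeriv c x.2) (tubeFilter p ρ)
      (𝓝 0) := by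
    have := ((isBigO_refl invSqrt _).mul (limit_isBigO_one c (|ϑ| + 1)).2.2).trans_tendsto
      (by simpa using tendsto_invSqrt (|ϑ| + 1))
    exact this.comp hs
  have t := (t1.add t2).add t3
  rw [add_zero, add_zero] at t
  replace t := t.norm
  rw [norm_zero] at t
  have hA' : 0 < ‖limitDetDeriv c (Complex.I * ϑ)‖ := norm_pos_iff.2 hA
  filter_upwards [t.eventually_le_const (half_pos hA')] with x hx
  rw [norm_mul, norm_neg_one_zpow, one_mul]
  have e := limitDetDeriv_add c (x.2 - latticePoint x.1) x.1
  rw [sub_add_cancel] at e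
  refine le_trans (le_of_eq (congrArg norm ?_)) hx
  simp only [Function.comp_apply]
  linear_combination e

/-- The second order Taylor estimate. -/
theorem isBigO_taylor_two {f : ℂ → ℂ} {f' a : ℂ} (hf : Differentiable ℂ f) (h : HasDerivAt f f' a)
    {α : Type*} {l : Filter α} {δ : α → ℂ} (hδ : Tendsto δ l (𝓝 0)) :
    (fun x => f (a + δ x) - (f a + f' * δ x)) =O[l] fun x => δ x ^ 2 := by
  obtain ⟨q, hq⟩ := hf.analyticAt a
  have e := (hq.isBigO_sub_partialSum_pow 2).comp_tendsto hδ
  have e1 : q 1 (fun _ => 1) = f' := by rw [← hq.deriv, h.deriv]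
  refine (e.congr_left fun x => ?_).trans (IsBigO.of_bound 1 (Eventually.of_forall fun x => ?_))
  · have e0 : q 0 (fun _ => δ x) = f a := hq.coeff_zero _
    have e2 : q 1 (fun _ => δ x) = δ x * q 1 (fun _ => 1) := by
      simp
    simp only [Function.comp_apply, FormalMultilinearSeries.partialSum, Finset.sum_range_succ,
      Finset.sum_range_zero, zero_add, e0, e2, e1]
    ring
  · simp

/-- Eigenvalues near the simple zeros of the leading term of the determinant. -/
theorem exists_branch_of_simple (h0 : limitDet c (Complex.I * ϑ) = 0)
    (hA : limitDetDeriv c (Complex.I * ϑ) ≠ 0) :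
    ∃ lam : ℤ → ℂ, (∀ᶠ n in cofinite, IsSimpleRoot c (lam n)) ∧
      (fun n => lam n - (latticePoint n + Complex.I * ϑ - limitLayer c (Complex.I * ϑ) /
        limitDetDeriv c (Complex.I * ϑ) * layerSeq n)) =O[cofinite] (fun n : ℤ => 1 / (n : ℝ)) ∧
      Tendsto (fun n => (lam n).re) cofinite (𝓝 0) := by
  set A := limitDetDeriv c (Complex.I * ϑ) with hAdef
  set B := limitLayer c (Complex.I * ϑ) with hBdef
  -- One Newton step from 2πin + iϑ: the shift δ solves Aδ + B (2πin)^(-1/2) = 0, so the terms of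
  -- order |n|^(-1/2) in the determinant cancel.
  set p : ℤ → ℂ := fun n => latticePoint n + Complex.I * ϑ - B / A * layerSeq n with hpdef
  set δ : ℤ → ℂ := fun n => -(B / A * layerSeq n) with hδdef
  have hδ : Tendsto δ cofinite (𝓝 0) := by
    simpa using (tendsto_layerSeq.const_mul (B / A)).neg
  have hδO : δ =O[cofinite] layerSeq := ((isBigO_refl _ _).const_mul_left _).neg_left
  have hpδ : ∀ n, p n = (Complex.I * ϑ + δ n) + latticePoint n := fun n => by
    simp only [hpdef, hδdef]; ring
  have hp : Tendsto (fun n => p n - latticePoint n) cofinite (𝓝 (Complex.I * ϑ)) := by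
    have := hδ.const_add (Complex.I * (ϑ : ℂ))
    rw [add_zero] at this
    exact this.congr fun n => by rw [hpδ]; ring
  have hg := tendsto_one_div_cofinite
  have hb := eventually_norm_sub_le hp
  refine exists_branch c (A := fun n => (-1) ^ n * A) hp hg
    (Eventually.of_forall fun n => mul_ne_zero (zpow_ne_zero _ (by norm_num)) hA) ?_ fun K =>
    deriv_detNorm_near c hp (by simpa using hg.norm.const_mul K) hA
  have r1 := comp_isBigO_layerSeq tendsto_id hb (stripApprox_detNorm c _).sub
  have r2 := ((isBigO_taylor_two (fun z => (hasDerivAt_limitDet c z).differentiableAt)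
    (hasDerivAt_limitDet c (Complex.I * ϑ)) hδ).trans (hδO.pow 2))
  have i1 := (invSqrt_sub_layerSeq tendsto_id hb).trans
    (layerSeq_pow_isBigO tendsto_id (show 2 ≤ 3 by norm_num))
  have hLt : Tendsto (fun n => limitLayer c (Complex.I * ϑ + δ n)) cofinite (𝓝 B) := by
    have hc : Continuous (limitLayer c) := by unfold limitLayer; fun_prop
    have := hδ.const_add (Complex.I * (ϑ : ℂ))
    rw [add_zero] at this
    exact (hc.tendsto _).comp this
  have r3 := i1.mul (hLt.isBigO_one ℂ)
  have hL : (fun n => limitLayer c (Complex.I * ϑ + δ n) - B) =O[cofinite] layerSeq := by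
    have h := (hasDerivAt_limitLayer c (Complex.I * ϑ)).isBigO_sub.comp_tendsto
      (show Tendsto (fun n => Complex.I * ϑ + δ n) cofinite (𝓝 (Complex.I * ϑ)) by
        simpa using hδ.const_add (Complex.I * (ϑ : ℂ)))
    simp only [Function.comp_def, add_sub_cancel_left] at h
    exact h.trans hδO
  have r4 := (isBigO_refl layerSeq cofinite).mul hL
  simp only [id, mul_one, ← pow_two] at r1 r2 r3 r4
  have r := r1.add ((neg_one_zpow_mul_isBigO (l := cofinite) (fun n : ℤ => n) _).trans
    ((r2.add r3).add r4))
  have e : (fun n => layerSeq n ^ 2) =O[cofinite] fun n : ℤ => (-1) ^ n * A * ((1 / (n : ℝ) : ℝ) : ℂ) := by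
    have hh : (fun n : ℤ => 1 / (n : ℝ)) =O[cofinite]
        fun n : ℤ => (-1) ^ n * A * ((1 / (n : ℝ) : ℝ) : ℂ) := by
      refine IsBigO.of_bound ‖A‖⁻¹ (Eventually.of_forall fun n => le_of_eq ?_)
      rw [norm_mul, norm_mul, norm_neg_one_zpow, one_mul, Complex.norm_real,
        inv_mul_cancel_left₀ (norm_ne_zero_iff.2 hA)]
    exact layerSeq_sq_isBigO.trans hh
  refine (r.congr_left fun n => ?_).trans e
  have e1 := limitDet_add c (Complex.I * ϑ + δ n) n
  have e2 := limitLayer_add c (Complex.I * ϑ + δ n) n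
  rw [← hpδ] at e1 e2
  rw [e1, e2, h0]
  have e3 : A * δ n + B * layerSeq n = 0 := by
    simp only [hδdef]; field_simp; ring
  linear_combination -(-1) ^ n * e3

end Simple

/-! ### The leading and layer terms at iπ -/

section Values
variable (c ϑ : ℝ)

theorem cosh_I_mul (x : ℝ) : Complex.cosh (Complex.I * x) = (Real.cos x : ℝ) := by
  rw [mul_comm, Complex.cosh_mul_I, Complex.ofReal_cos]

theorem sinh_I_mul (x : ℝ) : Complex.sinh (Complex.I * x) = (Real.sin x : ℝ) * Complex.I := by
  rw [mul_comm, Complex.sinh_mul_I, Complex.ofReal_sin]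

theorem half_I_mul : Complex.I * ϑ / 2 = Complex.I * (ϑ / 2 : ℝ) := by push_cast; ring

theorem three_half_I_mul : 3 * (Complex.I * ϑ) / 2 = Complex.I * (3 * ϑ / 2 : ℝ) := by
  push_cast; ring

theorem limitDet_I : limitDet c (Complex.I * ϑ) =
    ((Real.cos (3 * ϑ / 2) - Real.cos (ϑ / 2) * Real.cos (c / 2) : ℝ) : ℂ) := by
  rw [limitDet, half_I_mul, three_half_I_mul, cosh_I_mul, cosh_I_mul]
  push_cast; rfl

theorem limitDetDeriv_I : limitDetDeriv c (Complex.I * ϑ) =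
    ((3 / 2 * Real.sin (3 * ϑ / 2) - Real.sin (ϑ / 2) * Real.cos (c / 2) / 2 : ℝ) : ℂ) *
      Complex.I := by
  rw [limitDetDeriv, half_I_mul, three_half_I_mul, sinh_I_mul, sinh_I_mul]
  push_cast; ring

theorem limitLayer_I : limitLayer c (Complex.I * ϑ) =
    ((Real.sin (3 * ϑ / 2) + Real.sin (ϑ / 2) * Real.cos (c / 2) : ℝ) : ℂ) * Complex.I := by
  rw [limitLayer, half_I_mul, three_half_I_mul, sinh_I_mul, sinh_I_mul]
  push_cast; ring

theorem cos_three_pi_div_two : Real.cos (3 * Real.pi / 2) = 0 := by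
  rw [show 3 * Real.pi / 2 = Real.pi / 2 + Real.pi by ring, Real.cos_add_pi, Real.cos_pi_div_two,
    neg_zero]

theorem sin_three_pi_div_two : Real.sin (3 * Real.pi / 2) = -1 := by
  rw [show 3 * Real.pi / 2 = Real.pi / 2 + Real.pi by ring, Real.sin_add_pi, Real.sin_pi_div_two]

theorem limitDet_I_pi : limitDet c (Complex.I * Real.pi) = 0 := by
  rw [limitDet_I, cos_three_pi_div_two, Real.cos_pi_div_two]
  simp

theorem limitDetDeriv_I_pi : limitDetDeriv c (Complex.I * Real.pi) =
    ((-(3 + Real.cos (c / 2)) / 2 : ℝ) : ℂ) * Complex.I := by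
  rw [limitDetDeriv_I, sin_three_pi_div_two, Real.sin_pi_div_two]
  congr 2; ring

theorem three_add_cos_pos (x : ℝ) : 0 < 3 + Real.cos x := by linarith [Real.neg_one_le_cos x]

theorem limitDetDeriv_I_pi_ne_zero : limitDetDeriv c (Complex.I * Real.pi) ≠ 0 := by
  rw [limitDetDeriv_I_pi]
  refine mul_ne_zero (Complex.ofReal_ne_zero.2 ?_) Complex.I_ne_zero
  have := three_add_cos_pos (c / 2)
  exact (div_neg_of_neg_of_pos (by linarith) two_pos).ne

theorem cos_half_eq : Real.cos (c / 2) = 2 * Real.cos (c / 4) ^ 2 - 1 := by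
  rw [← Real.cos_two_mul]; congr 1; ring

/-- Because `layerSeq` carries a factor 1/2, the constant 4 here becomes 2 in the final formula. -/
theorem limit_ratio_pi : limitLayer c (Complex.I * Real.pi) / limitDetDeriv c (Complex.I * Real.pi) =
    ((4 * Real.sin (c / 4) ^ 2 / (3 + Real.cos (c / 2)) : ℝ) : ℂ) := by
  have h := three_add_cos_pos (c / 2)
  rw [limitLayer_I, limitDetDeriv_I_pi, mul_div_mul_right _ _ Complex.I_ne_zero,
    sin_three_pi_div_two, Real.sin_pi_div_two, ← Complex.ofReal_div]
  congr 1
  rw [div_eq_div_iff (by linarith) (by linarith), Real.sin_sq, cos_half_eq]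
  ring

end Values

/-! ### The leading and layer terms at iθ -/

section BranchAngle
variable {c : ℝ}

theorem cos_branchAngle : Real.cos (branchAngle c) = Real.cos (c / 4) ^ 2 := by
  rw [branchAngle, Real.cos_arccos (by nlinarith [sq_nonneg (Real.cos (c / 4))])
    (Real.cos_sq_le_one _)]

theorem sin_branchAngle : Real.sin (branchAngle c) = √(1 - Real.cos (c / 4) ^ 4) := by
  rw [branchAngle, Real.sin_arccos]; congr 1; ring

theorem sin_branchAngle_pos (h : Real.sin (c / 4) ≠ 0) : 0 < Real.sin (branchAngle c) := by
  rw [sin_branchAngle]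
  refine Real.sqrt_pos.2 ?_
  have h1 := Real.sin_sq_add_cos_sq (c / 4)
  have h2 : 0 < Real.sin (c / 4) ^ 2 := by positivity
  nlinarith [sq_nonneg (Real.cos (c / 4))]

/-- With x = θ/2 the triple angle formula factors cos 3x - cos x cos(c/2) as 2 cos x (cos 2x -
cos²(c/4)). The first factor accounts for the zero at iπ, the second defines θ. -/
theorem limitDet_branchAngle : limitDet c (Complex.I * branchAngle c) = 0 := by
  rw [limitDet_I, Complex.ofReal_eq_zero]
  have h1 := cos_branchAngle (c := c)
  rw [show branchAngle c = 2 * (branchAngle c / 2) by ring, Real.cos_two_mul] at h1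
  rw [show 3 * branchAngle c / 2 = 3 * (branchAngle c / 2) by ring, Real.cos_three_mul,
    cos_half_eq c, ← h1]
  ring

theorem limitDetDeriv_branchAngle : limitDetDeriv c (Complex.I * branchAngle c) =
    ((2 * √(1 - Real.cos (c / 4) ^ 4) * Real.cos (branchAngle c / 2) : ℝ) : ℂ) * Complex.I := by
  rw [limitDetDeriv_I, ← sin_branchAngle]
  congr 2
  have h1 := cos_branchAngle (c := c)
  have h2 : Real.sin (branchAngle c) = 2 * Real.sin (branchAngle c / 2) *
      Real.cos (branchAngle c / 2) := by rw [← Real.sin_two_mul]; congr 1; ring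
  rw [show branchAngle c = 2 * (branchAngle c / 2) by ring, Real.cos_two_mul] at h1
  have h3 := Real.sin_sq_add_cos_sq (branchAngle c / 2)
  rw [show 3 * branchAngle c / 2 = 3 * (branchAngle c / 2) by ring, Real.sin_three_mul,
    cos_half_eq c, ← h1, h2]
  linear_combination (-6 * Real.sin (branchAngle c / 2)) * h3

theorem limitDetDeriv_branchAngle_ne_zero (h : Real.sin (c / 4) ≠ 0) :
    limitDetDeriv c (Complex.I * branchAngle c) ≠ 0 := by
  rw [limitDetDeriv_branchAngle, ← sin_branchAngle]
  refine mul_ne_zero (Complex.ofReal_ne_zero.2 (mul_ne_zero (mul_ne_zero two_ne_zero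
    (sin_branchAngle_pos h).ne') fun h0 => ?_)) Complex.I_ne_zero
  have := sin_branchAngle_pos h
  rw [show branchAngle c = 2 * (branchAngle c / 2) by ring, Real.sin_two_mul, h0, mul_zero] at this
  exact lt_irrefl _ this

theorem limit_ratio_branchAngle : limitLayer c (Complex.I * branchAngle c) /
    limitDetDeriv c (Complex.I * branchAngle c) = ((2 * branchGamma c : ℝ) : ℂ) := by
  rw [limitLayer_I, limitDetDeriv_branchAngle, mul_div_mul_right _ _ Complex.I_ne_zero,
    ← Complex.ofReal_div, branchGamma]
  congr 1
  rw [mul_div_assoc', show 4 * √(1 - Real.cos (c / 4) ^ 4) * Real.cos (branchAngle c / 2) =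
    2 * (2 * √(1 - Real.cos (c / 4) ^ 4) * Real.cos (branchAngle c / 2)) by ring,
    mul_div_mul_left _ _ two_ne_zero]
  congr 1; ring

end BranchAngle

theorem one_div_isBigO_layerSeq_sq :
    (fun n : ℤ => 1 / (n : ℝ)) =O[cofinite] fun n => layerSeq n ^ 2 := by
  refine IsBigO.of_bound (2 * Real.pi) ?_
  filter_upwards [eventually_ne_zero_cofinite] with n hn
  have hr : (0:ℝ) < |(n : ℝ)| := by positivity
  rw [norm_pow, norm_layerSeq_sq hn, norm_div, norm_one, Real.norm_eq_abs]
  have := Real.pi_pos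
  field_simp
  exact le_rfl

/-! ### The degenerate case: double zeros of the leading term for c in 4πℤ -/

section Multiple
variable {c : ℝ} {k : ℤ}

theorem I_mul_div_four (hk : c = 4 * k * Real.pi) (w : ℂ) :
    w + Complex.I * c / 4 = w + k * Real.pi * Complex.I := by
  rw [hk]; push_cast; ring

theorem sinh_latticePoint_add (hk : c = 4 * k * Real.pi) (n : ℤ) :
    Complex.sinh (latticePoint n + Complex.I * c / 4) = 0 := by
  rw [I_mul_div_four hk, sinh_add_int_mul,
    show latticePoint n = 0 + (2 * n : ℤ) * Real.pi * Complex.I by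
      rw [latticePoint]; push_cast; ring, sinh_add_int_mul, Complex.sinh_zero, mul_zero, mul_zero]

theorem sinh_half_latticePoint_add (hk : c = 4 * k * Real.pi) (n : ℤ) :
    Complex.sinh (latticePoint n / 2 + Complex.I * c / 4) = 0 := by
  rw [I_mul_div_four hk, sinh_add_int_mul,
    show latticePoint n / 2 = 0 + n * Real.pi * Complex.I by rw [latticePoint]; ring,
    sinh_add_int_mul, Complex.sinh_zero, mul_zero, mul_zero]

theorem cos_half_eq_one (hk : c = 4 * k * Real.pi) : Real.cos (c / 2) = 1 := by
  rw [hk, show 4 * k * Real.pi / 2 = k * (2 * Real.pi) by ring, Real.cos_int_mul_two_pi]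

/-- At 2πin both hyperbolic limits vanish, so the oscillating entry is O(1/n) and the layer entry
O(|n|^(-1/2)). Estimating the entries separately gives O(|n|^(-3/2)) for the determinant, better
than the O(1/n) of its expansion. -/
theorem oscNorm_latticePoint (hk : c = 4 * k * Real.pi) :
    (fun n => oscNorm c (latticePoint n)) =O[cofinite] fun n => layerSeq n ^ 2 := by
  have h := comp_isBigO_layerSeq (N := id) (w := latticePoint) tendsto_id (r := 0)
    (by simp) (stripApprox_oscNorm c 0).sub
  simpa only [sinh_latticePoint_add hk, sub_zero, id] using h

theorem layerNorm_latticePoint (hk : c = 4 * k * Real.pi) :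
    (fun n => layerNorm c (latticePoint n)) =O[cofinite] layerSeq := by
  have h := comp_isBigO_layerSeq (N := id) (w := latticePoint) tendsto_id (r := 0)
    (by simp) (stripApprox_layerNorm c 0).sub
  simp only [sinh_half_latticePoint_add hk, zero_add, id] at h
  have e : ∀ n, Complex.cosh (latticePoint n / 2 + Complex.I * c / 4) = (-1) ^ n * (-1) ^ k :=
    fun n => by
      rw [I_mul_div_four hk, cosh_add_int_mul,
        show latticePoint n / 2 = 0 + n * Real.pi * Complex.I by rw [latticePoint]; ring,
        cosh_add_int_mul, Complex.cosh_zero, mul_one, mul_comm]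
  have h1 : (fun n => invSqrt (latticePoint n) ^ 1) =O[cofinite] fun n => layerSeq n ^ 1 :=
    invSqrt_isBigO_layerSeq (N := id) (w := latticePoint) tendsto_id (r := 0) (by simp) 1
  have h2 := (neg_one_zpow_mul_isBigO (l := cofinite) (fun n : ℤ => n) _).trans
    (h1.const_mul_left ((-1) ^ k))
  have h3 := (h.trans (layerSeq_pow_isBigO tendsto_id (show 1 ≤ 2 by norm_num))).add h2
  simp only [pow_one, e, id] at h3
  exact h3.congr_left fun n => by ring

/-- Eigenvalues near the double zeros of the leading term. -/
theorem exists_branch_of_double (hk : c = 4 * k * Real.pi) :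
    ∃ lam : ℤ → ℂ, (∀ᶠ n in cofinite, IsSimpleRoot c (lam n)) ∧
      (fun n => lam n - latticePoint n) =O[cofinite] (fun n : ℤ => 1 / (n : ℝ)) ∧
      Tendsto (fun n => (lam n).re) cofinite (𝓝 0) := by
  have hk' : -c = 4 * (-k : ℤ) * Real.pi := by rw [hk]; push_cast; ring
  have hp : Tendsto (fun n => latticePoint n - latticePoint n) cofinite
      (𝓝 (Complex.I * (0 : ℝ))) := by simp
  -- The derivative of the leading term vanishes at 0 and that of the layer term is 2 there, so the
  -- reference slope is 2(-1)^n (2πin)^(-1/2), which tends to zero.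
  refine exists_branch c (ϑ := 0) (A := fun n => 2 * (-1) ^ n * layerSeq n) hp
    tendsto_one_div_cofinite ?_ ?_ fun K => ?_
  · filter_upwards [eventually_ne_zero_cofinite] with n hn
    exact mul_ne_zero (mul_ne_zero two_ne_zero (zpow_ne_zero _ (by norm_num))) (layerSeq_ne_zero hn)
  · have h := ((oscNorm_latticePoint hk).mul (layerNorm_latticePoint hk')).add
      ((oscNorm_latticePoint hk').mul (layerNorm_latticePoint hk))
    refine h.trans (((Complex.isBigO_ofReal_right.2 layerSeq_sq_isBigO).mul
      (isBigO_refl layerSeq cofinite)).trans (IsBigO.of_bound 1 (Eventually.of_forall fun n => ?_)))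
    simp only [norm_mul, norm_neg_one_zpow, Complex.norm_ofNat]
    nlinarith [mul_nonneg (norm_nonneg (layerSeq n)) (norm_nonneg ((1 / (n : ℝ) : ℝ) : ℂ))]
  · set ρ : ℤ → ℝ := fun n => K * ‖1 / (n : ℝ)‖
    have hρ : Tendsto ρ cofinite (𝓝 0) := by
      have := tendsto_one_div_cofinite.norm.const_mul K
      rwa [norm_zero, mul_zero] at this
    have ht := tendsto_sub_tubeFilter hp hρ
    have hb := eventually_norm_sub_le ht
    have hN : Tendsto Prod.fst (tubeFilter latticePoint ρ) cofinite := tendsto_fst_tubeFilter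
    have hy : (fun x : ℤ × ℂ => x.2 - latticePoint x.1) =O[tubeFilter latticePoint ρ]
        fun x => layerSeq x.1 ^ 2 := by
      refine IsBigO.trans (g := fun x : ℤ × ℂ => 1 / (x.1 : ℝ)) (IsBigO.of_bound K
        eventually_mem_tubeFilter) (one_div_isBigO_layerSeq_sq.comp_tendsto hN)
    have ht0 : Tendsto (fun x : ℤ × ℂ => x.2 - latticePoint x.1) (tubeFilter latticePoint ρ)
        (𝓝 0) := by simpa using ht
    have t1 := comp_isBigO_layerSeq hN hb (deriv_detNorm_sub c _)
    have hd1 : DifferentiableAt ℂ (limitDetDeriv c) 0 := by unfold limitDetDeriv; fun_prop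
    have hd2 : DifferentiableAt ℂ (limitLayerDeriv c) 0 := by unfold limitLayerDeriv; fun_prop
    have v1 : limitDetDeriv c 0 = 0 := by simp [limitDetDeriv]
    have v2 : limitLayerDeriv c 0 = 2 := by
      simp only [limitLayerDeriv, cos_half_eq_one hk]; norm_num
    have t2 := hd1.hasDerivAt.isBigO_sub.comp_tendsto ht0
    have t3 := hd2.hasDerivAt.isBigO_sub.comp_tendsto ht0
    simp only [Function.comp_def, v1, v2, sub_zero] at t2 t3
    have t2' := (neg_one_zpow_mul_isBigO (l := tubeFilter latticePoint ρ) Prod.fst _).trans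
      (t2.trans hy)
    have t4 : (fun x : ℤ × ℂ => layerSeq x.1 * (limitLayerDeriv c (x.2 - latticePoint x.1) - 2))
        =O[tubeFilter latticePoint ρ] fun x => layerSeq x.1 ^ 2 := by
      have := ((tendsto_layerSeq.comp hN).isBigO_one ℂ).mul (t3.trans hy)
      simp only [one_mul] at this
      exact this
    have hbd : (fun x : ℤ × ℂ => limitLayerDeriv c (x.2 - latticePoint x.1))
        =O[tubeFilter latticePoint ρ] fun _ => (1 : ℂ) :=
      (hd2.continuousAt.tendsto.comp ht0).isBigO_one ℂ
    have t5 := (invSqrt_sub_layerSeq hN hb).mul hbd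
    simp only [mul_one] at t5
    have t6 := (neg_one_zpow_mul_isBigO (l := tubeFilter latticePoint ρ) Prod.fst _).trans
      ((t5.trans (layerSeq_pow_isBigO hN (show 2 ≤ 3 by norm_num))).add t4)
    have hlo : (fun x : ℤ × ℂ => layerSeq x.1 ^ 2) =o[tubeFilter latticePoint ρ]
        fun x => layerSeq x.1 := by
      have := ((isLittleO_one_iff ℂ).2 (tendsto_layerSeq.comp hN)).mul_isBigO
        (isBigO_refl (fun x : ℤ × ℂ => layerSeq x.1) _)
      simpa only [Function.comp_apply, one_mul, ← pow_two] using this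
    -- On discs of radius O(1/n) every error is O(1/n), which is negligible against the slope of
    -- order |n|^(-1/2).
    have t := ((t1.add t2').add t6).trans_isLittleO hlo
    filter_upwards [t.bound one_pos] with x hx
    have e1 := limitDetDeriv_add c (x.2 - latticePoint x.1) x.1
    have e2 := limitLayerDeriv_add c (x.2 - latticePoint x.1) x.1
    rw [sub_add_cancel] at e1 e2
    rw [norm_mul, norm_mul, norm_neg_one_zpow, Complex.norm_ofNat, mul_one,
      mul_div_cancel_left₀ _ two_ne_zero]
    refine le_trans (le_of_eq (congrArg norm ?_)) (hx.trans (le_of_eq (one_mul _)))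
    linear_combination e1 + invSqrt x.2 * e2

end Multiple

/-- In (f - f₀) g + f₀ (g - g₀) the smallness of g compensates for a cruder approximation of f. -/
theorem isBigO_mul_sub_mul {α : Type*} {l : Filter α} {e f f₀ g g₀ : α → ℂ}
    (he : e =O[l] fun _ => (1 : ℂ)) {i j m : ℕ} (hf : (fun x => f x - f₀ x) =O[l] fun x => e x ^ i)
    (hg : g =O[l] fun x => e x ^ j) (hf₀ : f₀ =O[l] fun _ => (1 : ℂ))
    (hg₀ : (fun x => g x - g₀ x) =O[l] fun x => e x ^ m) (hm : m ≤ i + j) :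
    (fun x => f x * g x - f₀ x * g₀ x) =O[l] fun x => e x ^ m := by
  obtain ⟨d, hd⟩ := Nat.exists_eq_add_of_le hm
  have h1 : (fun x => (f x - f₀ x) * g x) =O[l] fun x => e x ^ m := by
    refine (hf.mul hg).trans ?_
    have := (isBigO_refl (fun x => e x ^ m) l).mul (he.pow d)
    simpa only [← pow_add, hd, one_pow, mul_one] using this
  have h2 := hf₀.mul hg₀
  simp only [one_mul] at h2
  exact (h1.add h2).congr_left fun x => by ring

theorem sinh_sub_self_isBigO :
    (fun x : ℂ => Complex.sinh x - x) =O[𝓝 0] fun x => x ^ 3 := by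
  have h := Complex.exp_sub_sum_range_isBigO_pow 3
  have h' := h.comp_tendsto (show Tendsto (fun x : ℂ => -x) (𝓝 0) (𝓝 0) by
    simpa using (continuous_neg (G := ℂ)).tendsto 0)
  have h2 : (fun x : ℂ => (-x) ^ 3) =O[𝓝 0] fun x => x ^ 3 :=
    IsBigO.of_bound 1 (Eventually.of_forall fun x => by simp)
  refine ((h.sub (h'.trans h2)).const_mul_left (1 / 2)).congr_left fun x => ?_
  simp only [Function.comp_apply, Finset.sum_range_succ, Finset.sum_range_zero, Complex.sinh]
  norm_num [Nat.factorial]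
  ring

theorem cosh_sub_one_isBigO {α : Type*} {l : Filter α} {η : α → ℂ} (h : Tendsto η l (𝓝 0)) :
    (fun x => Complex.cosh (η x) - 1) =O[l] fun x => η x ^ 2 := by
  have := isBigO_taylor_two Complex.differentiable_cosh (Complex.hasDerivAt_cosh 0) h
  simpa using this

theorem sinh_quarter_add (w : ℂ) (m : ℤ) :
    Complex.sinh (Complex.I * Real.pi / 2 + w + m * Real.pi * Complex.I) =
      (-1) ^ m * (Complex.I * Complex.cosh w) := by
  rw [sinh_add_int_mul, Complex.sinh_add, half_I_mul, sinh_I_mul, cosh_I_mul]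
  simp

theorem cosh_quarter_add (w : ℂ) (m : ℤ) :
    Complex.cosh (Complex.I * Real.pi / 2 + w + m * Real.pi * Complex.I) =
      (-1) ^ m * (Complex.I * Complex.sinh w) := by
  rw [cosh_add_int_mul, Complex.cosh_add, half_I_mul, sinh_I_mul, cosh_I_mul]
  simp

theorem neg_one_zpow_mul_self (n : ℤ) : (-1 : ℂ) ^ n * (-1) ^ n = 1 := by
  rw [← mul_zpow]; norm_num

/-! ### Refined expansions of the prefactors in the oscillating entry -/

section Strip
variable (c r : ℝ)

theorem rootS_mul_sub : (fun z => rootS c z * (1 + charOmega c z) -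
    1 * (1 + Complex.I * c * invSqrt z ^ 2)) =O[stripFilter r] fun z => invSqrt z ^ 4 := by
  have h1 : (fun z => rootS c z - 1) =O[stripFilter r] fun z => invSqrt z ^ 4 := by
    have t : (fun z => -((c:ℂ) ^ 2 / 2) * invSqrt z ^ 6) =O[stripFilter r]
      fun z => invSqrt z ^ 6 := (isBigO_refl _ _).const_mul_left _
    exact (((rootS_sub c r).trans (invSqrt_pow_isBigO (show 4 ≤ 8 by norm_num))).add
      (t.trans (invSqrt_pow_isBigO (show 4 ≤ 6 by norm_num)))).congr_left fun z => by ring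
  refine isBigO_mul_sub_mul (invSqrt_isBigO_one r) (j := 0) h1 ?_ (isBigO_refl _ _) ?_ le_rfl
  · simp only [pow_zero]
    have one : StripApprox r 2 (fun _ => (1:ℂ)) fun _ => 1 := .const 1
    exact (one.add (stripApprox_charOmega c r)).left
  · exact (charOmega_sub c r).congr_left fun z => by ring

theorem rootA_mul_sub : (fun z => rootA c z * (1 + charSigma c z) -
    (1 + Complex.I * c * invSqrt z ^ 2 / 2) * 1) =O[stripFilter r] fun z => invSqrt z ^ 4 := by
  have h1 : (fun z => rootA c z - (1 + Complex.I * c * invSqrt z ^ 2 / 2)) =O[stripFilter r]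
      fun z => invSqrt z ^ 4 := by
    have t : Tendsto (fun z => (Complex.I * c) ^ 2 * (-1 / 8 + Complex.I * c * invSqrt z ^ 2 / 16))
      (stripFilter r) (𝓝 _) := ((((invSqrt_pow_tendsto_zero r (k := 2) (by norm_num)).const_mul
        (Complex.I * c)).div_const 16).const_add (-1 / 8)).const_mul ((Complex.I * c) ^ 2)
    refine (((rootA_sub c r).trans (invSqrt_pow_isBigO (show 4 ≤ 8 by norm_num))).add
      (isBigO_mul_invSqrt 4 (t.isBigO_one ℂ))).congr_left fun z => ?_
    rw [rootPoly]; ring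
  refine isBigO_mul_sub_mul (invSqrt_isBigO_one r) (j := 0) h1 ?_ ?_ ?_ le_rfl
  · simp only [pow_zero]
    have one : StripApprox r 2 (fun _ => (1:ℂ)) fun _ => 1 := .const 1
    exact (one.add (stripApprox_charSigma c r)).left
  · have := ((invSqrt_pow_tendsto_zero r (k := 2) (by norm_num)).const_mul
      (Complex.I * c)).div_const 2 |>.const_add 1
    exact this.isBigO_one ℂ
  · exact (charSigma_isBigO c r).congr_left fun z => by ring

end Strip

/-- The deviation of the first order approximation from `2 π i n + i π`. -/
noncomputable def piShift (c : ℝ) (n : ℤ) : ℂ :=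
  -(c ^ 2 * layerSeq n ^ 2 / 16) + (1 / 4 + Complex.I * Real.pi / 16) * c ^ 2 * layerSeq n ^ 4

noncomputable def piPoint (c : ℝ) (n : ℤ) : ℂ := latticePoint n + Complex.I * Real.pi + piShift c n

/-- The deviations `etaR` and `etaS` of the half exponents from their limiting values are O(1/n).
All further expansions near iπ are made in them. -/
noncomputable def etaR (c : ℝ) (n : ℤ) : ℂ := charR₁ c (piPoint c n) / 2 -
  (latticePoint n / 2 + Complex.I * Real.pi / 2 + Complex.I * c / 4)

noncomputable def etaS (c : ℝ) (n : ℤ) : ℂ := charS₁ c (piPoint c n) / 2 -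
  (latticePoint n / 2 + Complex.I * Real.pi / 2)

theorem piPoint_neg (c : ℝ) : piPoint (-c) = piPoint c := by
  funext n; simp [piPoint, piShift]

theorem etaS_neg (c : ℝ) : etaS (-c) = etaS c := by
  funext n; simp [etaS, piPoint_neg, charS₁_neg]

/-! ### Deviations of the exponents at the approximate eigenvalue near iπ -/

section PiPoint
variable (c : ℝ)

theorem layerSeq_isBigO_one : layerSeq =O[cofinite] fun _ => (1 : ℂ) :=
  tendsto_layerSeq.isBigO_one ℂ

theorem layerSeq_pow_trans {f : ℤ → ℂ} {m n : ℕ} (h : f =O[cofinite] fun x => layerSeq x ^ n)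
    (hm : m ≤ n) : f =O[cofinite] fun x => layerSeq x ^ m :=
  h.trans (layerSeq_pow_isBigO tendsto_id hm)

theorem tendsto_of_layerSeq {f : ℤ → ℂ} (h : f =O[cofinite] fun x => layerSeq x ^ 2) :
    Tendsto f cofinite (𝓝 0) :=
  h.trans_tendsto (by simpa using tendsto_layerSeq.pow 2)

theorem piShift_isBigO : piShift c =O[cofinite] fun n => layerSeq n ^ 2 := by
  have h1 := (isBigO_refl (fun n => layerSeq n ^ 2) cofinite).const_mul_left (-((c:ℂ) ^ 2 / 16))
  have h2 := (isBigO_refl (fun n => layerSeq n ^ 4) cofinite).const_mul_left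
    ((1 / 4 + Complex.I * Real.pi / 16) * (c:ℂ) ^ 2)
  exact (h1.add (layerSeq_pow_trans h2 (by norm_num))).congr_left fun n => by
    rw [piShift]; ring

theorem tendsto_piPoint :
    Tendsto (fun n => piPoint c n - latticePoint n) cofinite (𝓝 (Complex.I * Real.pi)) := by
  have := (tendsto_of_layerSeq (piShift_isBigO c)).const_add (Complex.I * Real.pi)
  rw [add_zero] at this
  exact this.congr fun n => by rw [piPoint]; ring

theorem piPoint_near : ∀ᶠ n in cofinite, ‖piPoint c n - latticePoint (id n)‖ ≤ |Real.pi| + 1 :=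
  eventually_norm_sub_le (tendsto_piPoint c)

theorem comp_piPoint {f : ℂ → ℂ} {k : ℕ} (hf : f =O[stripFilter (|Real.pi| + 1)]
    fun z => invSqrt z ^ k) : (fun n => f (piPoint c n)) =O[cofinite] fun n => layerSeq n ^ k :=
  comp_isBigO_layerSeq tendsto_id (piPoint_near c) hf

theorem tendsto_piPoint_strip : Tendsto (piPoint c) cofinite (stripFilter (|Real.pi| + 1)) :=
  tendsto_stripFilter tendsto_id (piPoint_near c)

theorem invSqrt_piPoint (k : ℕ) :
    (fun n => invSqrt (piPoint c n) ^ k) =O[cofinite] fun n => layerSeq n ^ k :=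
  invSqrt_isBigO_layerSeq tendsto_id (piPoint_near c) k

theorem etaR_sub : (fun n => etaR c n - (piShift c n / 2 + c ^ 2 * invSqrt (piPoint c n) ^ 2 / 16 -
    Complex.I * c ^ 3 * invSqrt (piPoint c n) ^ 4 / 32)) =O[cofinite] fun n => layerSeq n ^ 6 :=
  (comp_piPoint c (charR₁_half_sub c _)).congr_left fun n => by
    simp only [etaR, piPoint]; ring

theorem etaS_sub : (fun n => etaS c n - (piShift c n / 2 - c ^ 2 * invSqrt (piPoint c n) ^ 4 / 4))
    =O[cofinite] fun n => layerSeq n ^ 6 :=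
  (comp_piPoint c (charS₁_half_sub c _)).congr_left fun n => by
    simp only [etaS, piPoint]; ring

theorem etaR_isBigO : etaR c =O[cofinite] fun n => layerSeq n ^ 2 := by
  have h2 := (invSqrt_piPoint c 2).const_mul_left ((c:ℂ) ^ 2 / 16)
  have h4 := layerSeq_pow_trans ((invSqrt_piPoint c 4).const_mul_left (-(Complex.I * c ^ 3 / 32)))
    (show 2 ≤ 4 by norm_num)
  exact ((((layerSeq_pow_trans (etaR_sub c) (show 2 ≤ 6 by norm_num)).add
    ((piShift_isBigO c).const_mul_left (1 / 2))).add h2).add h4).congr_left fun n => by ring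

theorem etaS_isBigO : etaS c =O[cofinite] fun n => layerSeq n ^ 2 := by
  have h4 := layerSeq_pow_trans ((invSqrt_piPoint c 4).const_mul_left (-((c:ℂ) ^ 2 / 4)))
    (show 2 ≤ 4 by norm_num)
  exact (((layerSeq_pow_trans (etaS_sub c) (show 2 ≤ 6 by norm_num)).add
    ((piShift_isBigO c).const_mul_left (1 / 2))).add h4).congr_left fun n => by ring

/-- The choice of the approximation: the sum of the deviations is of third order. -/
theorem eta_sum_isBigO : (fun n => 2 * etaS c n + etaR c n + etaR (-c) n)
    =O[cofinite] fun n => layerSeq n ^ 6 := by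
  have hR' := etaR_sub (-c)
  simp only [piPoint_neg] at hR'
  set q : ℤ → ℂ := fun n => invSqrt (piPoint c n) ^ 2 with hq
  set κ : ℤ → ℂ := fun n => piPoint c n - latticePoint n with hκ
  have q2 : q =O[cofinite] fun n => layerSeq n ^ 2 := invSqrt_piPoint c 2
  have k1 : κ =O[cofinite] fun _ => (1 : ℂ) := (tendsto_piPoint c).isBigO_one ℂ
  -- This is 1/p - 1/ℓ = -(p - ℓ)/(pℓ) for p the approximate eigenvalue and ℓ = 2πin. Applied twice,
  -- it gives q = 1/ℓ - iπ/ℓ² up to third order.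
  have rel : ∀ᶠ n in cofinite, q n - layerSeq n ^ 2 = -κ n * layerSeq n ^ 2 * q n := by
    filter_upwards [eventually_ne_zero_cofinite,
      (tendsto_piPoint_strip c).eventually (eventually_ne_zero_strip _)] with n hn h0
    have hl : latticePoint n ≠ 0 := fun h => by
      have := layerSeq_sq hn
      rw [h, inv_zero] at this
      exact layerSeq_ne_zero hn (pow_eq_zero_iff two_ne_zero |>.1 this)
    simp only [hq, hκ, invSqrt_sq, layerSeq_sq hn]
    field_simp
    ring
  have u2 := isBigO_refl (fun n => layerSeq n ^ 2) (cofinite : Filter ℤ)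
  have d1 : (fun n => q n - layerSeq n ^ 2) =O[cofinite] fun n => layerSeq n ^ 4 := by
    refine ((k1.neg_left.mul u2).mul q2).congr' (rel.mono fun n hn => hn.symm)
      (Eventually.of_forall fun n => by ring)
  have d2 : (fun n => q n - layerSeq n ^ 2 + Complex.I * Real.pi * layerSeq n ^ 4)
      =O[cofinite] fun n => layerSeq n ^ 6 := by
    have e1 := (((k1.mul k1).mul (u2.mul u2)).mul q2)
    have e2 := ((piShift_isBigO c).mul (u2.mul u2)).neg_left
    refine ((e1.trans (IsBigO.of_bound 1 ?_)).add (e2.trans (IsBigO.of_bound 1 ?_))).congr'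
      (rel.mono fun n hn => ?_) EventuallyEq.rfl
    · exact Eventually.of_forall fun n => le_of_eq (by simp only [one_mul]; ring_nf)
    · exact Eventually.of_forall fun n => le_of_eq (by rw [one_mul]; congr 1; ring)
    · have hk : κ n = Complex.I * Real.pi + piShift c n := by simp only [hκ, piPoint]; ring
      dsimp only
      linear_combination (-1 + κ n * layerSeq n ^ 2) * hn + layerSeq n ^ 4 * hk
  have d3 : (fun n => (q n - layerSeq n ^ 2) * (q n + layerSeq n ^ 2))
      =O[cofinite] fun n => layerSeq n ^ 6 :=
    (d1.mul (q2.add u2)).congr_right fun n => by ring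
  -- To third order the sum is twice the shift plus c²q/8 - c²q²/2. Inserting q = ℓ^(-1) - iπ ℓ^(-2)
  -- with ℓ = 2πin and requiring this to vanish produces both coefficients of `piShift`.
  have key := (((etaS_sub c).const_mul_left 2).add ((etaR_sub c).add hR')).add
    ((d2.const_mul_left ((c:ℂ) ^ 2 / 8)).add (d3.const_mul_left (-((c:ℂ) ^ 2 / 2))))
  refine key.congr_left fun n => ?_
  have e : piShift (-c) n = piShift c n := by simp [piShift]
  rw [e]
  simp only [hq, piShift]
  push_cast
  ring

/-- Only the term odd in c survives, and it is the one with c³; the difference is one power of 1/n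
smaller than each deviation. -/
theorem eta_diff_isBigO : (fun n => etaR c n - etaR (-c) n)
    =O[cofinite] fun n => layerSeq n ^ 4 := by
  have hR' := etaR_sub (-c)
  simp only [piPoint_neg] at hR'
  have h := (invSqrt_piPoint c 4).const_mul_left (-(Complex.I * c ^ 3 / 16))
  refine ((layerSeq_pow_trans ((etaR_sub c).sub hR') (show 4 ≤ 6 by norm_num)).add
    h).congr_left fun n => ?_
  have e : piShift (-c) n = piShift c n := by simp [piShift]
  rw [e]
  push_cast
  ring

end PiPoint

/-! ### The determinant and the branch near iπ in the degenerate case -/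

section PiBranch
variable {c : ℝ} {k : ℤ}

theorem charR₁_piPoint (hk : c = 4 * k * Real.pi) (n : ℤ) : charR₁ c (piPoint c n) / 2 =
    Complex.I * Real.pi / 2 + etaR c n + (n + k : ℤ) * Real.pi * Complex.I := by
  have := I_mul_div_four hk 0
  simp only [zero_add] at this
  rw [etaR, this, latticePoint]
  push_cast
  ring

theorem charS₁_piPoint (c : ℝ) (n : ℤ) : charS₁ c (piPoint c n) / 2 =
    Complex.I * Real.pi / 2 + etaS c n + n * Real.pi * Complex.I := by
  rw [etaS, latticePoint]
  ring

theorem cosh_isBigO_one {η : ℤ → ℂ} (h : η =O[cofinite] fun n => layerSeq n ^ 2) :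
    (fun n => Complex.cosh (η n)) =O[cofinite] fun _ => (1 : ℂ) :=
  ((Complex.continuous_cosh.tendsto 0).comp (tendsto_of_layerSeq h)).isBigO_one ℂ

theorem cosh_sub_one_layerSeq {η : ℤ → ℂ} (h : η =O[cofinite] fun n => layerSeq n ^ 2) :
    (fun n => Complex.cosh (η n) - 1) =O[cofinite] fun n => layerSeq n ^ 4 :=
  ((cosh_sub_one_isBigO (tendsto_of_layerSeq h)).trans (h.pow 2)).congr_right fun n => by ring

theorem sinh_sub_layerSeq {η : ℤ → ℂ} (h : η =O[cofinite] fun n => layerSeq n ^ 2) :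
    (fun n => Complex.sinh (η n) - η n) =O[cofinite] fun n => layerSeq n ^ 6 :=
  ((sinh_sub_self_isBigO.comp_tendsto (tendsto_of_layerSeq h)).trans (h.pow 3)).congr_right
    fun n => by ring

theorem sinh_layerSeq {η : ℤ → ℂ} (h : η =O[cofinite] fun n => layerSeq n ^ 2) :
    (fun n => Complex.sinh (η n)) =O[cofinite] fun n => layerSeq n ^ 2 :=
  ((layerSeq_pow_trans (sinh_sub_layerSeq h) (show 2 ≤ 6 by norm_num)).add h).congr_left
    fun n => by ring

/-- Products `f cosh η sinh η'` to third order. -/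
theorem mul_cosh_mul_sinh_sub {f f₀ η η' : ℤ → ℂ}
    (hf : (fun n => f n - f₀ n) =O[cofinite] fun n => layerSeq n ^ 4)
    (hf₀ : f₀ =O[cofinite] fun _ => (1 : ℂ)) (h : η =O[cofinite] fun n => layerSeq n ^ 2)
    (h' : η' =O[cofinite] fun n => layerSeq n ^ 2) :
    (fun n => f n * (Complex.cosh (η n) * Complex.sinh (η' n)) - f₀ n * (1 * η' n))
      =O[cofinite] fun n => layerSeq n ^ 6 := by
  refine isBigO_mul_sub_mul layerSeq_isBigO_one (j := 2) hf ?_ hf₀ ?_ le_rfl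
  · have := (cosh_isBigO_one h).mul (sinh_layerSeq h')
    simpa only [one_mul] using this
  · exact isBigO_mul_sub_mul layerSeq_isBigO_one (cosh_sub_one_layerSeq h) (sinh_layerSeq h')
      (isBigO_refl _ _) (sinh_sub_layerSeq h') le_rfl

/-- The third order expansion of the oscillating factor. -/
noncomputable def oscMain (c : ℝ) (n : ℤ) : ℂ :=
  (1 + Complex.I * c * invSqrt (piPoint c n) ^ 2) * etaS c n +
    (1 + Complex.I * c * invSqrt (piPoint c n) ^ 2 / 2) * etaR c n

theorem invSqrt_piPoint_isBigO_one (c : ℝ) (a : ℂ) :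
    (fun n => 1 + a * invSqrt (piPoint c n) ^ 2) =O[cofinite] fun _ => (1 : ℂ) := by
  have := ((tendsto_of_layerSeq (invSqrt_piPoint c 2)).const_mul a).const_add 1
  exact this.isBigO_one ℂ

/-- Near iπ/2 the functions sinh and cosh turn into i cosh and i sinh of the deviation, so each
product in the entry is linear in one deviation up to third order. The signs of the two translations
multiply to (-1)^k. -/
theorem oscNorm_piPoint (hk : c = 4 * k * Real.pi) :
    (fun n => oscNorm c (piPoint c n) - -(-1) ^ k * oscMain c n)
      =O[cofinite] fun n => layerSeq n ^ 6 := by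
  have f1 := invSqrt_piPoint_isBigO_one c (Complex.I * c)
  have f2 := invSqrt_piPoint_isBigO_one c (Complex.I * c / 2)
  have h1 := mul_cosh_mul_sinh_sub ((comp_piPoint c (rootS_mul_sub c _)).congr_left
    fun n => by rw [one_mul]) f1 (etaR_isBigO c) (etaS_isBigO c)
  have h2 := mul_cosh_mul_sinh_sub ((comp_piPoint c (rootA_mul_sub c _)).congr_left
    fun n => by rw [mul_one]) (f2.congr_left fun n => by ring_nf)
    (etaS_isBigO c) (etaR_isBigO c)
  refine ((h1.add h2).const_mul_left (-(-1) ^ k)).congr' ?_ EventuallyEq.rfl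
  filter_upwards [(tendsto_piPoint_strip c).eventually (eventually_ne_zero_strip _)] with n hn
  have hs : (-1 : ℂ) ^ (n + k) * (-1) ^ n = (-1) ^ k := by
    rw [zpow_add₀ (by norm_num)]
    linear_combination (-1 : ℂ) ^ k * neg_one_zpow_mul_self n
  rw [oscNorm_eq hn, charR₁_piPoint hk, charS₁_piPoint, sinh_quarter_add, cosh_quarter_add,
    sinh_quarter_add, cosh_quarter_add, oscMain]
  generalize rootS c (piPoint c n) * (1 + charOmega c (piPoint c n)) = P
  generalize rootA c (piPoint c n) * (1 + charSigma c (piPoint c n)) = Q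
  generalize Complex.cosh (etaR c n) = x1
  generalize Complex.sinh (etaR c n) = x2
  generalize Complex.cosh (etaS c n) = x3
  generalize Complex.sinh (etaS c n) = x4
  linear_combination (-Complex.I ^ 2 * (P * x1 * x4 + Q * x3 * x2)) * hs -
    (-1) ^ k * (P * x1 * x4 + Q * x3 * x2) * Complex.I_sq

/-- The layer contribution carries the factor cosh(r₁/2), which is O(1/n) near iπ/2. It therefore
enters only at order |n|^(-3/2), which is why no term of order |n|^(-1/2) appears in this branch. -/
theorem layerNorm_piPoint (hk : c = 4 * k * Real.pi) :
    (fun n => layerNorm c (piPoint c n) - (-1) ^ (n + k) * Complex.I)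
      =O[cofinite] fun n => layerSeq n ^ 3 := by
  have hs := comp_piPoint c ((charSigma_isBigO c _))
  have ho := comp_piPoint c ((charOmega_isBigO c _))
  have h1 : (fun n => Complex.cosh (etaR c n) * (1 - charSigma c (piPoint c n)) - 1 * 1)
      =O[cofinite] fun n => layerSeq n ^ 4 := by
    refine isBigO_mul_sub_mul layerSeq_isBigO_one (j := 0)
      (cosh_sub_one_layerSeq (etaR_isBigO c)) ?_ (isBigO_refl _ _) ?_ le_rfl
    · simp only [pow_zero]
      exact ((hs.trans_tendsto (by simpa using tendsto_layerSeq.pow 4)).const_sub 1).isBigO_one ℂ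
    · exact hs.neg_left.congr_left fun n => by ring
  have h2 : (fun n => layerRatio c (piPoint c n)) =O[cofinite] fun n => layerSeq n ^ 1 := by
    have := (comp_piPoint c (stripApprox_layerRatio c _).sub)
    refine ((layerSeq_pow_trans this one_le_two).add (invSqrt_piPoint c 1)).congr_left
      fun n => by ring
  have h3 : (fun n => rootA c (piPoint c n) * (1 - charOmega c (piPoint c n)))
      =O[cofinite] fun _ => (1 : ℂ) :=
    (((tendsto_rootA c _).comp (tendsto_piPoint_strip c)).mul
      ((ho.trans_tendsto (by simpa using tendsto_layerSeq.pow 2)).const_sub 1)).isBigO_one ℂ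
  have h4 := h2.mul (h3.mul (sinh_layerSeq (etaR_isBigO c)))
  have h5 := (neg_one_zpow_mul_isBigO (l := cofinite) (fun n : ℤ => n + k) _).trans
    (((layerSeq_pow_trans h1 (show 3 ≤ 4 by norm_num)).add
      (h4.congr_right fun n => by ring)).const_mul_left Complex.I)
  refine h5.congr' ?_ EventuallyEq.rfl
  filter_upwards [(tendsto_piPoint_strip c).eventually (eventually_charGood c _)] with n hn
  rw [layerNorm_eq hn, charR₁_piPoint hk, sinh_quarter_add, cosh_quarter_add]
  ring

theorem oscMain_isBigO (c : ℝ) : oscMain c =O[cofinite] fun n => layerSeq n ^ 2 := by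
  have h1 := (invSqrt_piPoint_isBigO_one c (Complex.I * c)).mul (etaS_isBigO c)
  have h2 := (invSqrt_piPoint_isBigO_one c (Complex.I * c / 2)).mul (etaR_isBigO c)
  simp only [one_mul] at h1 h2
  exact (h1.add h2).congr_left fun n => by rw [oscMain]; ring

/-- The even part is the sum of deviations cancelled by the choice of `piShift`; the odd part is
O(1/n) times the difference of the two left deviations. -/
theorem oscMain_add (c : ℝ) :
    (fun n => oscMain c n + oscMain (-c) n) =O[cofinite] fun n => layerSeq n ^ 6 := by
  have h := ((invSqrt_piPoint c 2).mul (eta_diff_isBigO c)).const_mul_left (Complex.I * c / 2)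
  refine ((eta_sum_isBigO c).add (h.congr_right fun n => by ring)).congr_left fun n => ?_
  simp only [oscMain, piPoint_neg, etaS_neg]
  push_cast
  ring

theorem oscNorm_piPoint_isBigO (hk : c = 4 * k * Real.pi) :
    (fun n => oscNorm c (piPoint c n)) =O[cofinite] fun n => layerSeq n ^ 2 :=
  ((layerSeq_pow_trans (oscNorm_piPoint hk) (show 2 ≤ 6 by norm_num)).add
    ((oscMain_isBigO c).const_mul_left (-(-1) ^ k))).congr_left fun n => by ring

/-- The layer entries for c and -c share the same main term, so up to errors the determinant is that
term times the sum of the oscillating entries, which is of third order in 1/n. What remains is an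
oscillating entry O(1/n) times a layer error O(|n|^(-3/2)), and this fixes the exponent 5/2. -/
theorem detNorm_piPoint (hk : c = 4 * k * Real.pi) :
    (fun n => detNorm c (piPoint c n)) =O[cofinite] fun n => layerSeq n ^ 5 := by
  have hk' : -c = 4 * (-k : ℤ) * Real.pi := by rw [hk]; push_cast; ring
  have hz : (-1 : ℂ) ^ (-k) = (-1) ^ k := by rw [zpow_neg, ← inv_zpow]; norm_num
  have hs : ∀ n : ℤ, (-1 : ℂ) ^ (n + -k) = (-1) ^ (n + k) := fun n => by
    rw [zpow_add₀ (by norm_num), zpow_add₀ (by norm_num), hz]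
  have o1 := oscNorm_piPoint hk
  have o2 := oscNorm_piPoint hk'
  have l1 := layerNorm_piPoint hk
  have l2 := layerNorm_piPoint hk'
  have b1 := oscNorm_piPoint_isBigO hk
  have b2 := oscNorm_piPoint_isBigO hk'
  simp only [piPoint_neg, hz, hs] at o2 l2 b2
  have hε : (fun n : ℤ => (-1 : ℂ) ^ (n + k) * Complex.I) =O[cofinite] fun _ => (1 : ℂ) :=
    (neg_one_zpow_mul_isBigO _ _).trans (isBigO_const_const _ one_ne_zero _)
  have p1 := isBigO_mul_sub_mul layerSeq_isBigO_one l2 b1 hε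
    (layerSeq_pow_trans o1 (show 5 ≤ 6 by norm_num)) le_rfl
  have p2 := isBigO_mul_sub_mul layerSeq_isBigO_one l1 b2 hε
    (layerSeq_pow_trans o2 (show 5 ≤ 6 by norm_num)) le_rfl
  have p3 := hε.mul (((layerSeq_pow_trans (oscMain_add c) (show 5 ≤ 6 by norm_num))).const_mul_left
    (-(-1) ^ k))
  simp only [one_mul] at p3
  refine ((p1.add p2).add p3).congr_left fun n => ?_
  rw [detNorm]
  ring

theorem tendsto_one_div_abs_rpow :
    Tendsto (fun n : ℤ => 1 / |(n : ℝ)| ^ (5 / 2 : ℝ)) cofinite (𝓝 0) := by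
  have := ((tendsto_rpow_atTop (show (0:ℝ) < 5 / 2 by norm_num)).comp
    tendsto_abs_cofinite).inv_tendsto_atTop
  exact this.congr fun n => (one_div _).symm

/-- Eigenvalues near `2 π i n + i π` in the degenerate case. -/
theorem exists_branch_piPoint (hk : c = 4 * k * Real.pi) :
    ∃ lam : ℤ → ℂ, (∀ᶠ n in cofinite, IsSimpleRoot c (lam n)) ∧
      (fun n => lam n - piPoint c n) =O[cofinite] (fun n : ℤ => 1 / |(n : ℝ)| ^ (5 / 2 : ℝ)) ∧
      Tendsto (fun n => (lam n).re) cofinite (𝓝 0) := by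
  have hA := limitDetDeriv_I_pi_ne_zero c
  refine exists_branch c (A := fun n => (-1) ^ n * limitDetDeriv c (Complex.I * Real.pi))
    (tendsto_piPoint c) tendsto_one_div_abs_rpow
    (Eventually.of_forall fun n => mul_ne_zero (zpow_ne_zero _ (by norm_num)) hA) ?_ fun K =>
    deriv_detNorm_near c (tendsto_piPoint c) ?_ hA
  · refine ((detNorm_piPoint hk).trans layerSeq_pow_five_isBigO).trans
      (IsBigO.of_bound ‖limitDetDeriv c (Complex.I * Real.pi)‖⁻¹
        (Eventually.of_forall fun n => le_of_eq ?_))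
    rw [norm_mul, norm_mul, norm_neg_one_zpow, one_mul, Complex.norm_real,
      inv_mul_cancel_left₀ (norm_ne_zero_iff.2 hA)]
  · have := tendsto_one_div_abs_rpow.norm.const_mul K
    rwa [norm_zero, mul_zero] at this

end PiBranch

/-! ### Explicit form of the branches and conclusion -/

theorem exists_forall_of_eventually_cofinite {P : ℤ → Prop} (h : ∀ᶠ n in cofinite, P n) :
    ∃ n₀ : ℕ, ∀ n : ℤ, (n₀ : ℤ) ≤ |n| → P n := by
  rw [eventually_cofinite] at h
  obtain ⟨M, hM⟩ := (h.image fun n : ℤ => n.natAbs).bddAbove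
  refine ⟨M + 1, fun n hn => ?_⟩
  by_contra hP
  have h1 : n.natAbs ≤ M := hM ⟨n, hP, rfl⟩
  rw [Int.abs_eq_natAbs] at hn
  omega

theorem piPoint_eq {c : ℝ} {n : ℤ} (hn : n ≠ 0) : piPoint c n =
    2 * n * Real.pi * Complex.I + Complex.I * Real.pi + Complex.I * c ^ 2 / (32 * Real.pi * n) -
      (4 + Complex.I * Real.pi) * c ^ 2 / (64 * Real.pi ^ 2 * n ^ 2) := by
  have hn' : (n : ℂ) ≠ 0 := by exact_mod_cast hn
  have hpi : (Real.pi : ℂ) ≠ 0 := by exact_mod_cast Real.pi_ne_zero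
  have hl : layerSeq n ^ 2 = -Complex.I / (2 * n * Real.pi) := by
    rw [layerSeq_sq hn, latticePoint, mul_inv, Complex.inv_I]
    field_simp
  rw [piPoint, piShift, show layerSeq n ^ 4 = (layerSeq n ^ 2) ^ 2 by ring, hl, latticePoint,
    div_pow, neg_sq, Complex.I_sq]
  field_simp
  ring

theorem mainTheorem5 (c : ℝ) :
    ∃ (n₀ : ℕ) (lam₁ lam₂ : ℤ → ℂ),
      (∀ n : ℤ, (n₀ : ℤ) ≤ |n| →
        IsSimpleEigenvalue (localGenerator c) (lam₁ n) ∧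
        IsSimpleEigenvalue (localGenerator c) (lam₂ n)) ∧
      (c ≠ 0 → ∀ n : ℤ, (n₀ : ℤ) ≤ |n| →
        analyticOrderAt (charDet c) (lam₁ n) = 1 ∧
        analyticOrderAt (charDet c) (lam₂ n) = 1) ∧
      (Real.sin (c / 4) ≠ 0 →
        ((fun n : ℤ => lam₁ n -
            (2 * n * Real.pi * Complex.I + Complex.I * Real.pi -
              2 * Real.sin (c / 4) ^ 2 * (1 - Complex.I * (n.sign : ℂ)) /
                ((3 + Real.cos (c / 2)) * √(|(n : ℝ)| * Real.pi))))
          =O[Filter.cofinite] fun n : ℤ => 1 / (n : ℝ)) ∧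
        ((fun n : ℤ => lam₂ n -
            (2 * n * Real.pi * Complex.I + Complex.I * branchAngle c -
              branchGamma c / √(|(n : ℝ)| * Real.pi) +
              Complex.I * ((n.sign : ℂ) * branchGamma c / √(|(n : ℝ)| * Real.pi))))
          =O[Filter.cofinite] fun n : ℤ => 1 / (n : ℝ))) ∧
      (Real.sin (c / 4) = 0 →
        ((fun n : ℤ => lam₁ n -
            (2 * n * Real.pi * Complex.I + Complex.I * Real.pi +
              Complex.I * c ^ 2 / (32 * Real.pi * n) -
              (4 + Complex.I * Real.pi) * c ^ 2 / (64 * Real.pi ^ 2 * n ^ 2)))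
          =O[Filter.cofinite] fun n : ℤ => 1 / |(n : ℝ)| ^ (5 / 2 : ℝ)) ∧
        ((fun n : ℤ => lam₂ n - 2 * n * Real.pi * Complex.I)
          =O[Filter.cofinite] fun n : ℤ => 1 / (n : ℝ))) ∧
      Filter.Tendsto (fun n : ℤ => (lam₁ n).re) Filter.cofinite (nhds 0) ∧
      Filter.Tendsto (fun n : ℤ => (lam₂ n).re) Filter.cofinite (nhds 0) := by
  -- The vanishing of sin(c/4) means c in 4πℤ, which is exactly when the zero iθ of the leading term
  -- degenerates to the double zero 0.
  by_cases hs : Real.sin (c / 4) = 0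
  · obtain ⟨k, hk⟩ := Real.sin_eq_zero_iff.1 hs
    have hk' : c = 4 * k * Real.pi := by linear_combination -4 * hk
    obtain ⟨lam₁, g₁, a₁, t₁⟩ := exists_branch_piPoint hk'
    obtain ⟨lam₂, g₂, a₂, t₂⟩ := exists_branch_of_double hk'
    obtain ⟨n₀, hn⟩ := exists_forall_of_eventually_cofinite (g₁.and g₂)
    refine ⟨n₀, lam₁, lam₂, fun n h => ⟨(hn n h).1.1, (hn n h).2.1⟩,
      fun hc n h => ⟨(hn n h).1.2 hc, (hn n h).2.2 hc⟩, fun h => absurd hs h, fun _ => ⟨?_, a₂⟩,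
      t₁, t₂⟩
    refine a₁.congr' ?_ EventuallyEq.rfl
    filter_upwards [eventually_ne_zero_cofinite] with n h0
    rw [piPoint_eq h0]
  · obtain ⟨lam₁, g₁, a₁, t₁⟩ := exists_branch_of_simple c (limitDet_I_pi c)
      (limitDetDeriv_I_pi_ne_zero c)
    obtain ⟨lam₂, g₂, a₂, t₂⟩ := exists_branch_of_simple c limitDet_branchAngle
      (limitDetDeriv_branchAngle_ne_zero hs)
    obtain ⟨n₀, hn⟩ := exists_forall_of_eventually_cofinite (g₁.and g₂)
    refine ⟨n₀, lam₁, lam₂, fun n h => ⟨(hn n h).1.1, (hn n h).2.1⟩,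
      fun hc n h => ⟨(hn n h).1.2 hc, (hn n h).2.2 hc⟩, fun _ => ⟨?_, ?_⟩, fun h => absurd h hs,
      t₁, t₂⟩
    · refine a₁.congr_left fun n => ?_
      rw [limit_ratio_pi, latticePoint, layerSeq, Complex.ofReal_div, div_mul_div_comm]
      push_cast
      rw [show (4 : ℂ) * Complex.sin (c / 4) ^ 2 * (1 - Complex.I * (n.sign : ℂ)) =
        2 * (2 * Complex.sin (c / 4) ^ 2 * (1 - Complex.I * (n.sign : ℂ))) by ring,
        mul_left_comm _ (2 : ℂ), mul_div_mul_left _ _ two_ne_zero]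
    · refine a₂.congr_left fun n => ?_
      rw [limit_ratio_branchAngle, latticePoint, layerSeq]
      push_cast
      ring
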